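/- Let $(M,g)$ and $(N,h)$ be smooth finite-dimensional Riemannian manifolds (Hausdorff, $\sigma$-compact, without boundary), let $p,q\ge 2$ be real numbers, and let $\varphi:M\to N$ be a smooth map. Let $\tau_p(\varphi)=\operatorname{div}\big(|d\varphi|^{p-2}d\varphi\big)=\operatorname{trace}_g\nabla\big(|d\varphi|^{p-2}d\varphi\big)$ be its $p$-tension field, where $|d\varphi|$ is the Hilbert--Schmidt norm and $\nabla$ is induced by the Levi-Civita connections of $g$ and $h$; for $D\subseteq M$ compact put $$E_{p,q}(\varphi;D)=\frac1q\int_D|\tau_p(\varphi)|^q\,v_g .$$ The map $\varphi$ is called $(p,q)$-harmonic if for every compact $D\subseteq M$ and every smooth variation $(\varphi_t)_{t\in(-\varepsilon,\varepsilon)}$ of $\varphi=\varphi_0$ supported in $D$ (that is, $(t,x)\mapsto\varphi_t(x)$ is smooth and $\varphi_t=\varphi$ outside $D$ for all $t$), the function $t\mapsto E_{p,q}(\varphi_t;D)$ is differentiable at $t=0$ with derivative $0$; it is called bi-$p$-harmonic if the same holds for $E_{p,2}(\varphi;D)=\frac12\int_D|\tau_p(\varphi)|^2\,v_g$. Assume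 that the function $|\tau_p(\varphi)|^{q-2}$ is constant on $M$ (with the convention $s^0=1$ for all $s\ge0$, including $s=0$). Then $\varphi$ is $(p,q)$-harmonic if and only if it is bi-$p$-harmonic. -/

import Mathlib

open Set MeasureTheory Bundle
open scoped Manifold ContDiff

noncomputable section

/-- The `i`-th standard basis vector of `ℝ^m`. -/
def stdVec {m : ℕ} (i : Fin m) : EuclideanSpace ℝ (Fin m) := EuclideanSpace.single i 1

/-- The matrix `G_ij = G(e_i, e_j)` of a bilinear form on `ℝ^m`. -/
def gramMatrix {m : ℕ}
    (G : EuclideanSpace ℝ (Fin m) →L[ℝ] EuclideanSpace ℝ (Fin m) →L[ℝ] ℝ) :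
    Matrix (Fin m) (Fin m) ℝ :=
  Matrix.of fun i j => G (stdVec i) (stdVec j)

/-- The trace `∑ G^ij B(e_i, e_j)` of a bilinear map `B` with respect to an inner product `G`. For
positive definite `G` this is `∑ B(b_i, b_i)` for any `G`-orthonormal basis `b`. -/
def metricTrace {m : ℕ} {F : Type*} [NormedAddCommGroup F] [NormedSpace ℝ F]
    (G : EuclideanSpace ℝ (Fin m) →L[ℝ] EuclideanSpace ℝ (Fin m) →L[ℝ] ℝ)
    (B : EuclideanSpace ℝ (Fin m) → EuclideanSpace ℝ (Fin m) → F) : F :=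
  ∑ i, ∑ j, (gramMatrix G)⁻¹ i j • B (stdVec i) (stdVec j)

/-- Smooth Riemannian metrics on an `m`-dimensional smooth manifold. -/
abbrev SmoothMetric (m : ℕ) (M : Type*) [TopologicalSpace M]
    [ChartedSpace (EuclideanSpace ℝ (Fin m)) M] [IsManifold (𝓡 m) ∞ M] :=
  ContMDiffRiemannianMetric (𝓡 m) ∞ (EuclideanSpace ℝ (Fin m))
    (fun x : M => TangentSpace (𝓡 m) x)

section Chart

variable {m : ℕ} {M : Type*} [TopologicalSpace M] [ChartedSpace (EuclideanSpace ℝ (Fin m)) M]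

/-- The differential at `u` of the inverse of the chart centred at `a`; it sends a coordinate
vector to the tangent vector that it represents. -/
def chartFrame (a : M) (u : EuclideanSpace ℝ (Fin m)) :
    EuclideanSpace ℝ (Fin m) →L[ℝ] TangentSpace (𝓡 m) ((extChartAt (𝓡 m) a).symm u) :=
  mfderiv 𝓘(ℝ, EuclideanSpace ℝ (Fin m)) (𝓡 m) (extChartAt (𝓡 m) a).symm u

variable [IsManifold (𝓡 m) ∞ M]

/-- The metric in the coordinates of the chart centred at `a`, as a function of the coordinate
point `u`: the pull-back of `g` by the inverse chart. -/
def chartMetric (g : SmoothMetric m M) (a : M) (u : EuclideanSpace ℝ (Fin m)) :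
    EuclideanSpace ℝ (Fin m) →L[ℝ] EuclideanSpace ℝ (Fin m) →L[ℝ] ℝ :=
  ContinuousLinearMap.bilinearComp (E := EuclideanSpace ℝ (Fin m))
    (F := EuclideanSpace ℝ (Fin m)) (g.inner ((extChartAt (𝓡 m) a).symm u))
    (chartFrame a u) (chartFrame a u)

/-- The Christoffel symbols of the Levi-Civita connection in the chart centred at `a`, as the
bilinear map `Γ(v, w) = ∑ Γ^k_ij v^i w^j e_k`, where
`Γ^k_ij = 1/2 ∑ g^kl (∂_i g_jl + ∂_j g_il - ∂_l g_ij)`. -/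
def christoffel (g : SmoothMetric m M) (a : M) (u v w : EuclideanSpace ℝ (Fin m)) :
    EuclideanSpace ℝ (Fin m) :=
  ∑ k, ∑ l, ((gramMatrix (chartMetric g a u))⁻¹ k l *
    (1 / 2 * (fderiv ℝ (chartMetric g a) u v w (stdVec l)
      + fderiv ℝ (chartMetric g a) u w v (stdVec l)
      - fderiv ℝ (chartMetric g a) u (stdVec l) v w))) • stdVec k

variable [MeasurableSpace M]

/-- The Riemannian measure `√(det g_ij) du` of the domain of the chart centred at `a`, extended by
zero to `M`. -/
def chartVolume (g : SmoothMetric m M) (a : M) : Measure M :=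
  Measure.map (extChartAt (𝓡 m) a).symm
    ((volume.restrict (extChartAt (𝓡 m) a).target).withDensity
      fun u => ENNReal.ofReal (Real.sqrt (gramMatrix (chartMetric g a u)).det))

variable [T2Space M] [SigmaCompactSpace M]

/-- A smooth partition of unity on `M` subordinate to the chart domains. -/
def chartPartition (m : ℕ) (M : Type*) [TopologicalSpace M]
    [ChartedSpace (EuclideanSpace ℝ (Fin m)) M] [IsManifold (𝓡 m) ∞ M] [T2Space M]
    [SigmaCompactSpace M] : SmoothPartitionOfUnity M (𝓡 m) M univ :=
  (SmoothPartitionOfUnity.exists_isSubordinate_chartAt_source (𝓡 m) M).choose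

/-- The Riemannian measure `v_g`, glued from the measures `√(det g_ij) du` in charts by a smooth
partition of unity: `∫ f v_g = ∑_a ∫ ρ_a f √(det g_ij) du`. -/
def riemannianVolume (g : SmoothMetric m M) : Measure M :=
  Measure.sum fun a : M =>
    (chartVolume g a).withDensity fun x => ENNReal.ofReal (chartPartition m M a x)

end Chart

section Maps

variable {m n : ℕ}
  {M : Type*} [TopologicalSpace M] [ChartedSpace (EuclideanSpace ℝ (Fin m)) M]
  [IsManifold (𝓡 m) ∞ M]
  {N : Type*} [TopologicalSpace N] [ChartedSpace (EuclideanSpace ℝ (Fin n)) N]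
  [IsManifold (𝓡 n) ∞ N]

/-- The Hilbert-Schmidt norm `|dφ|` at `x`: `|dφ|² = ∑ g^ij h(dφ(e_i), dφ(e_j))`. -/
def differentialNorm (g : SmoothMetric m M) (h : SmoothMetric n N) (φ : M → N) (x : M) : ℝ :=
  Real.sqrt (metricTrace (g.inner x) fun v w =>
    h.inner (φ x) (mfderiv (𝓡 m) (𝓡 n) φ x v) (mfderiv (𝓡 m) (𝓡 n) φ x w))

/-- The map `φ` in the charts centred at `a` and `b`. -/
def chartMap (a : M) (b : N) (φ : M → N) (u : EuclideanSpace ℝ (Fin m)) :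
    EuclideanSpace ℝ (Fin n) :=
  extChartAt (𝓡 n) b (φ ((extChartAt (𝓡 m) a).symm u))

/-- The `φ⁻¹TN`-valued one-form `|dφ|^(p-2) dφ` in the charts centred at `a` and `b`. -/
def chartPForm (g : SmoothMetric m M) (h : SmoothMetric n N) (p : ℝ) (a : M) (b : N) (φ : M → N)
    (u : EuclideanSpace ℝ (Fin m)) : EuclideanSpace ℝ (Fin m) →L[ℝ] EuclideanSpace ℝ (Fin n) :=
  differentialNorm g h φ ((extChartAt (𝓡 m) a).symm u) ^ (p - 2) • fderiv ℝ (chartMap a b φ) u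

/-- The covariant derivative of `ω = |dφ|^(p-2) dφ` in the charts centred at `a` and `b`:
`(∇_v ω)(w) = ∂_v (ω(w)) - ω(Γ^M(v, w)) + Γ^N(dφ(v), ω(w))` for constant coordinate
vectors `v`, `w`. -/
def chartCovDerivPForm (g : SmoothMetric m M) (h : SmoothMetric n N) (p : ℝ) (a : M) (b : N)
    (φ : M → N) (u v w : EuclideanSpace ℝ (Fin m)) : EuclideanSpace ℝ (Fin n) :=
  fderiv ℝ (chartPForm g h p a b φ) u v w
    - chartPForm g h p a b φ u (christoffel g a u v w)
    + christoffel h b (chartMap a b φ u) (fderiv ℝ (chartMap a b φ) u v)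
        (chartPForm g h p a b φ u w)

/-- The coordinates of `div (|dφ|^(p-2) dφ) = trace ∇ (|dφ|^(p-2) dφ)` in the charts centred at
`a` and `b`, at the coordinate point `u`. -/
def chartPTension (g : SmoothMetric m M) (h : SmoothMetric n N) (p : ℝ) (a : M) (b : N)
    (φ : M → N) (u : EuclideanSpace ℝ (Fin m)) : EuclideanSpace ℝ (Fin n) :=
  metricTrace (chartMetric g a u) (chartCovDerivPForm g h p a b φ u)

/-- The `p`-tension field `τ_p(φ) = div (|dφ|^(p-2) dφ)`, a vector field along `φ`. It is computed
at `x` in the charts centred at `x` and `φ x`; a vector of `TangentSpace (𝓡 n) (φ x)` is given by its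
coordinates in the chart centred at `φ x`. -/
def pTension (g : SmoothMetric m M) (h : SmoothMetric n N) (p : ℝ) (φ : M → N) (x : M) :
    TangentSpace (𝓡 n) (φ x) :=
  chartPTension g h p x (φ x) φ (extChartAt (𝓡 m) x x)

/-- The norm `|τ_p(φ)|` of the `p`-tension field at `x`. -/
def pTensionNorm (g : SmoothMetric m M) (h : SmoothMetric n N) (p : ℝ) (φ : M → N) (x : M) : ℝ :=
  Real.sqrt (h.inner (φ x) (pTension g h p φ x) (pTension g h p φ x))

/-- `Φ` is a smooth variation `(φ_t)` of `φ`, for `t ∈ (-ε, ε)`, supported in `D`. -/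
structure IsVariation (φ : M → N) (D : Set M) (ε : ℝ) (Φ : ℝ → M → N) : Prop where
  smooth : ContMDiffOn (𝓘(ℝ, ℝ).prod (𝓡 m)) (𝓡 n) ∞ (fun z : ℝ × M => Φ z.1 z.2)
    (Ioo (-ε) ε ×ˢ univ)
  initial : ∀ x, Φ 0 x = φ x
  support : ∀ t ∈ Ioo (-ε) ε, ∀ x ∉ D, Φ t x = φ x

/-- `φ` is a critical point of the functional `En(·; D)` for every compact `D ⊆ M`: for all
smooth variations of `φ` supported in `D`, `En(φ_t; D)` has derivative zero at `t = 0`. -/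
def IsCriticalPoint (m n : ℕ) {M : Type*} [TopologicalSpace M]
    [ChartedSpace (EuclideanSpace ℝ (Fin m)) M]
    {N : Type*} [TopologicalSpace N] [ChartedSpace (EuclideanSpace ℝ (Fin n)) N]
    (En : (M → N) → Set M → ℝ) (φ : M → N) : Prop :=
  ∀ D : Set M, IsCompact D → ∀ ε > 0, ∀ Φ : ℝ → M → N,
    IsVariation (m := m) (n := n) φ D ε Φ → HasDerivAt (fun t => En (Φ t) D) 0 0

variable [MeasurableSpace M] [T2Space M] [SigmaCompactSpace M]

/-- The `(p, q)`-energy `E_{p,q}(φ; D) = (1/q) ∫_D |τ_p(φ)|^q v_g`. -/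
def pqEnergy (g : SmoothMetric m M) (h : SmoothMetric n N) (p q : ℝ) (φ : M → N) (D : Set M) :
    ℝ :=
  1 / q * ∫ x in D, pTensionNorm g h p φ x ^ q ∂(riemannianVolume g)

/-- The bi-`p`-energy `E_{p,2}(φ; D) = (1/2) ∫_D |τ_p(φ)|² v_g`. -/
def biPEnergy (g : SmoothMetric m M) (h : SmoothMetric n N) (p : ℝ) (φ : M → N) (D : Set M) : ℝ :=
  1 / 2 * ∫ x in D, pTensionNorm g h p φ x ^ 2 ∂(riemannianVolume g)

/-- `(p, q)`-harmonic maps are the critical points of the `(p, q)`-energy. -/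
def IsPQHarmonic (g : SmoothMetric m M) (h : SmoothMetric n N) (p q : ℝ) (φ : M → N) : Prop :=
  IsCriticalPoint m n (pqEnergy g h p q) φ

/-- Bi-`p`-harmonic maps are the critical points of the bi-`p`-energy. -/
def IsBiPHarmonic (g : SmoothMetric m M) (h : SmoothMetric n N) (p : ℝ) (φ : M → N) : Prop :=
  IsCriticalPoint m n (biPEnergy g h p) φ

end Maps

end

/-! For q = 2 the two energies coincide. For q > 2 the hypothesis says that |τ_p(φ)| is a constant s
≥ 0, and the cases s > 0 and s = 0 have different reasons.

If s > 0, the function y ↦ y^(q/2)/q - s^(q-2) y/2 is stationary at y = s², so it has a quadratic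
Taylor remainder there (`exists_abs_rpow_taylor_le`). A nonzero p-tension field forces p = 2 or dφ ≠
0, so |τ_p(φ_t)|² is smooth in (t, x) near t = 0 and Lipschitz in t, uniformly on compact sets
(`IsVariation.exists_lipschitz`). Along every variation E_{p,q} - s^(q-2) E_{p,2} therefore changes
by O(t²) (`IsVariation.hasDerivAt_pqEnergy_sub`), and one energy is stationary exactly when the
other is.

If s = 0, the map is p-harmonic and both conditions are to be shown true. As |τ_p|^q is dominated by
|τ_p|² on compact sets, it suffices that ∫_D |τ_p(φ_t)|² = O(|t|^η) with some η > 1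
(`IsVariation.exists_setLIntegral_le`). For p = 2 this is clear with smoothness. For 2 < p < 3 the
factor |dφ|^(p-2) is not differentiable at zeros of dφ, and τ_p(φ_t) need not be Lipschitz in t. In
coordinates, with e = |df|² and s now denoting (p-2)/2, one has τ_p = e^s τ + s e^(s-1) df(grad e)
(`IsSmoothFamily.coordTension_eq`). Write R = |df|, b = |D²f|, and R₀, b₀ for their values at t = 0.
Then τ_p = O(R^(2s) (R + b)), and its time derivative is O(R^(2s-1) (R + b)) where R > 0. Where R₀
is at most a multiple of |t| the first bound is used directly; elsewhere R stays comparable to R₀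
and the second is integrated from τ_p = 0 at t = 0. For 0 < γ < 1 and 3 - γ ≤ p both give
|τ_p(φ_t)|² ≤ C |t|^(2-γ) (1 + (t² + R₀²)^(-γ/2) b₀²) (`PathBounds.exists_decay`).

The weight is singular where dφ = 0, but its integral against b₀² is bounded uniformly in t. For a
scalar f, integration by parts of the derivative of f (ε + f²)^(-γ/2) against that of f bounds ∫ (ε
+ f²)^(-γ/2) |∂f|² independently of ε, because γ < 1 (`exists_lintegral_rpow_mul_sq_le`). Applied to
the components of dφ with ε = t², this gives the rate η = 2 - γ > 1.

All estimates are local. They transfer to the manifold because |τ_p|, defined in charts that move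
with the point, can be computed in any fixed charts (`pTensionNorm_sq_eq`). -/

noncomputable section

/-! ### Inner products on ℝ^m and invariance of the metric trace. -/

section LinearAlgebra

/-- The coordinate space `ℝ^m`. -/
abbrev Coord (m : ℕ) : Type := EuclideanSpace ℝ (Fin m)

/-- Continuous bilinear forms on `ℝ^m`. -/
abbrev Bilin (m : ℕ) : Type := Coord m →L[ℝ] Coord m →L[ℝ] ℝ

instance {m : ℕ} : NormedAddCommGroup (Bilin m) := inferInstance

instance {m : ℕ} : NormedSpace ℝ (Bilin m) := inferInstance

/-- A bilinear form is an inner product. -/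
structure IsInnerForm {m : ℕ} (G : Bilin m) : Prop where
  symm : ∀ v w, G v w = G w v
  pos : ∀ v, v ≠ 0 → 0 < G v v

variable {m n : ℕ}

theorem sum_coord_smul_stdVec (v : Coord m) : ∑ i, v i • stdVec i = v := by
  have h := (EuclideanSpace.basisFun (Fin m) ℝ).sum_repr v
  simpa [stdVec] using h

theorem IsInnerForm.nonneg {G : Bilin m} (hG : IsInnerForm G) (v : Coord m) : 0 ≤ G v v := by
  by_cases hv : v = 0
  · simp [hv]
  · exact (hG.pos v hv).le

theorem IsInnerForm.eq_of_forall {G : Bilin m} (hG : IsInnerForm G) {v w : Coord m}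
    (h : ∀ z, G v z = G w z) : v = w := by
  by_contra hne
  have h1 := hG.pos (v - w) (sub_ne_zero.2 hne)
  have h2 := h (v - w)
  simp only [map_sub, sub_apply] at h1 h2
  linarith

theorem apply_eq_sum_gramMatrix (G : Bilin m) (v w : Coord m) :
    G v w = ∑ i, ∑ j, v i * (w j * gramMatrix G i j) := by
  conv_lhs => rw [← sum_coord_smul_stdVec v, ← sum_coord_smul_stdVec w]
  simp only [map_sum, map_smul, sum_apply, smul_apply, smul_eq_mul, gramMatrix, Matrix.of_apply,
    Finset.mul_sum]
  rw [Finset.sum_comm]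
  exact Finset.sum_congr rfl fun i _ => Finset.sum_congr rfl fun j _ => by ring

theorem IsInnerForm.posDef_gramMatrix {G : Bilin m} (hG : IsInnerForm G) :
    (gramMatrix G).PosDef := by
  refine Matrix.PosDef.of_dotProduct_mulVec_pos ?_ ?_
  · ext i j
    simp [gramMatrix, hG.symm (stdVec j) (stdVec i)]
  · intro x hx
    have h := hG.pos (WithLp.toLp 2 x) (by simpa using hx)
    rw [apply_eq_sum_gramMatrix] at h
    refine h.trans_eq ?_
    simp only [dotProduct, Matrix.mulVec, Finset.mul_sum, star_trivial]
    exact Finset.sum_congr rfl fun i _ => Finset.sum_congr rfl fun j _ => by ring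

theorem IsInnerForm.isUnit_det {G : Bilin m} (hG : IsInnerForm G) :
    IsUnit (gramMatrix G).det :=
  (Matrix.isUnit_iff_isUnit_det _).1 hG.posDef_gramMatrix.isUnit

variable {F : Type*} [NormedAddCommGroup F] [NormedSpace ℝ F]

/-- The trace is unchanged under a linear change of coordinates. -/
theorem metricTrace_comp (G : Bilin m) (L : Coord m →L[ℝ] Coord m)
    (hL : Function.Injective L) (B : Coord m →ₗ[ℝ] Coord m →ₗ[ℝ] F) :
    metricTrace (G.bilinearComp L L) (fun v w => B (L v) (L w)) =
      metricTrace G fun v w => B v w := by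
  set P : Matrix (Fin m) (Fin m) ℝ := Matrix.of fun k i => L (stdVec i) k with hP
  have hLe : ∀ i, L (stdVec i) = ∑ k, P k i • stdVec k := fun i =>
    (sum_coord_smul_stdVec (L (stdVec i))).symm
  have hgram : gramMatrix (G.bilinearComp L L) = P.transpose * gramMatrix G * P := by
    ext i j
    have : gramMatrix (G.bilinearComp L L) i j = G (L (stdVec i)) (L (stdVec j)) := rfl
    rw [this, apply_eq_sum_gramMatrix, Finset.sum_comm]
    simp only [Matrix.mul_apply, Matrix.transpose_apply, Finset.sum_mul]
    exact Finset.sum_congr rfl fun l _ => Finset.sum_congr rfl fun k _ => by simp [hP]; ring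
  have hPinj : Function.Injective P.mulVec := by
    intro x y hxy
    have key : ∀ z : Fin m → ℝ, P.mulVec z = fun k => L (WithLp.toLp 2 z) k := by
      intro z
      funext k
      conv_rhs => rw [← sum_coord_smul_stdVec (WithLp.toLp 2 z)]
      simp [Matrix.mulVec, dotProduct, hP, mul_comm]
    rw [key, key] at hxy
    have h2 : L (WithLp.toLp 2 x) = L (WithLp.toLp 2 y) := by
      ext k
      exact congrFun hxy k
    simpa using hL h2
  have hPu : IsUnit P := Matrix.mulVec_injective_iff_isUnit.1 hPinj
  have hPd : IsUnit P.det := (Matrix.isUnit_iff_isUnit_det _).1 hPu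
  have hPd' : IsUnit P.transpose.det := by rwa [Matrix.det_transpose]
  -- The Gram matrix becomes Pᵀ G P, so its inverse transforms by P⁻¹ on both sides and absorbs the
  -- two factors P that come from B.
  have hinv : P * (gramMatrix (G.bilinearComp L L))⁻¹ * P.transpose = (gramMatrix G)⁻¹ := by
    rw [hgram, Matrix.mul_inv_rev, Matrix.mul_inv_rev]
    calc P * (P⁻¹ * ((gramMatrix G)⁻¹ * P.transpose⁻¹)) * P.transpose
        = (P * P⁻¹) * (gramMatrix G)⁻¹ * (P.transpose⁻¹ * P.transpose) := by
          simp only [Matrix.mul_assoc]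
      _ = _ := by
          rw [Matrix.mul_nonsing_inv _ hPd, Matrix.nonsing_inv_mul _ hPd']; simp
  set Q := (gramMatrix (G.bilinearComp L L))⁻¹ with hQ
  unfold metricTrace
  rw [← hinv, ← hQ]
  have h1 : ∀ i j, Q i j • B (L (stdVec i)) (L (stdVec j)) =
      ∑ k, ∑ l, (P k i * Q i j * P l j) • B (stdVec k) (stdVec l) := by
    intro i j
    rw [hLe i, hLe j]
    simp only [map_sum, map_smul, LinearMap.sum_apply, LinearMap.smul_apply, Finset.smul_sum,
      smul_smul]
    rw [Finset.sum_comm]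
    exact Finset.sum_congr rfl fun l _ => Finset.sum_congr rfl fun k _ => by ring_nf
  have h2 : ∀ k l, (P * Q * P.transpose) k l • B (stdVec k) (stdVec l) =
      ∑ i, ∑ j, (P k i * Q i j * P l j) • B (stdVec k) (stdVec l) := by
    intro k l
    simp only [Matrix.mul_apply, Finset.sum_mul, Finset.sum_smul, Matrix.transpose_apply]
    rw [Finset.sum_comm]
  simp only [h1, h2]
  calc _ = ∑ i, ∑ k, ∑ j, ∑ l, (P k i * Q i j * P l j) • B (stdVec k) (stdVec l) :=
        Finset.sum_congr rfl fun i _ => Finset.sum_comm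
    _ = ∑ k, ∑ i, ∑ j, ∑ l, (P k i * Q i j * P l j) • B (stdVec k) (stdVec l) := Finset.sum_comm
    _ = ∑ k, ∑ i, ∑ l, ∑ j, (P k i * Q i j * P l j) • B (stdVec k) (stdVec l) :=
        Finset.sum_congr rfl fun k _ => Finset.sum_congr rfl fun i _ => Finset.sum_comm
    _ = _ := Finset.sum_congr rfl fun k _ => Finset.sum_comm

open scoped MatrixOrder ComplexOrder in
/-- The trace of the pull-back of an inner product by a linear map is a sum of squares that
vanishes only for the zero map. -/
theorem metricTrace_inner_nonneg_and_eq_zero {G : Bilin m} {H : Bilin n} (hG : IsInnerForm G)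
    (hH : IsInnerForm H) (A : Coord m →L[ℝ] Coord n) :
    0 ≤ metricTrace G (fun v w => H (A v) (A w)) ∧
      (metricTrace G (fun v w => H (A v) (A w)) = 0 → A = 0) := by
  -- Factor G⁻¹ = Cᵀ C with C invertible. The rows of C play the part of an orthonormal basis: the
  -- trace is the sum of H(b_k, b_k), with b_k the image under A of the k-th row.
  obtain ⟨C, hC⟩ := CStarAlgebra.nonneg_iff_eq_star_mul_self.mp
    hG.posDef_gramMatrix.inv.posSemidef.nonneg
  have hCu : IsUnit C.det := by
    have h1 : IsUnit ((gramMatrix G)⁻¹).det :=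
      (Matrix.isUnit_iff_isUnit_det _).1 hG.posDef_gramMatrix.inv.isUnit
    rw [hC, Matrix.det_mul] at h1
    exact isUnit_of_mul_isUnit_right h1
  set b : Fin m → Coord n := fun k => ∑ i, C k i • A (stdVec i) with hb
  have key : metricTrace G (fun v w => H (A v) (A w)) = ∑ k, H (b k) (b k) := by
    unfold metricTrace
    have h1 : ∀ k, H (b k) (b k) =
        ∑ i, ∑ j, (C k i * C k j) * H (A (stdVec i)) (A (stdVec j)) := by
      intro k
      simp only [hb, map_sum, map_smul, sum_apply, smul_apply, Finset.mul_sum, smul_eq_mul]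
      rw [Finset.sum_comm]
      exact Finset.sum_congr rfl fun i _ => Finset.sum_congr rfl fun j _ => by ring
    simp only [h1]
    rw [hC]
    calc _ = ∑ i, ∑ j, ∑ k, (C k i * C k j) * H (A (stdVec i)) (A (stdVec j)) := by
          refine Finset.sum_congr rfl fun i _ => Finset.sum_congr rfl fun j _ => ?_
          simp [Matrix.mul_apply, Matrix.star_apply, Finset.sum_mul]
      _ = ∑ i, ∑ k, ∑ j, (C k i * C k j) * H (A (stdVec i)) (A (stdVec j)) :=
          Finset.sum_congr rfl fun i _ => Finset.sum_comm
      _ = _ := Finset.sum_comm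
  rw [key]
  refine ⟨Finset.sum_nonneg fun k _ => hH.nonneg _, fun h0 => ?_⟩
  have hbk : ∀ k, b k = 0 := by
    intro k
    by_contra hk
    exact (hH.pos _ hk).ne' ((Finset.sum_eq_zero_iff_of_nonneg fun k _ => hH.nonneg _).1 h0 k
      (Finset.mem_univ k))
  -- Applying C⁻¹ to the vectors b_k recovers the values of A on the standard basis.
  have hA : ∀ j, A (stdVec j) = 0 := by
    intro j
    have h1 : ∑ k, C⁻¹ j k • b k = A (stdVec j) := by
      simp only [hb, Finset.smul_sum, smul_smul]
      rw [Finset.sum_comm]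
      have h2 : ∀ i, ∑ k, (C⁻¹ j k * C k i) • A (stdVec i)
          = (1 : Matrix (Fin m) (Fin m) ℝ) j i • A (stdVec i) := by
        intro i
        rw [← Matrix.nonsing_inv_mul C hCu, Matrix.mul_apply, Finset.sum_smul]
      simp [h2, Matrix.one_apply]
    rw [← h1]
    simp [hbk]
  ext1 v
  rw [← sum_coord_smul_stdVec v]
  simp [hA]

end LinearAlgebra

/-! ### Christoffel symbols and covariant derivatives under changes of coordinates. -/

section CoordinateGeometry

variable {m n : ℕ}

/-- The Christoffel symbols of a metric on an open subset of `ℝ^m`, as a bilinear map. -/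
def coordChristoffel (G : Coord m → Bilin m) (u v w : Coord m) : Coord m :=
  ∑ k, ∑ l, ((gramMatrix (G u))⁻¹ k l *
    (1 / 2 * (fderiv ℝ G u v w (stdVec l)
      + fderiv ℝ G u w v (stdVec l)
      - fderiv ℝ G u (stdVec l) v w))) • stdVec k

/-- The covariant derivative of a form `σ` along the map `f`, in coordinates. -/
def coordCov (G : Coord m → Bilin m) (H : Coord n → Bilin n) (f : Coord m → Coord n)
    (σ : Coord m → Coord m →L[ℝ] Coord n) (u v w : Coord m) : Coord n :=
  fderiv ℝ σ u v w - σ u (coordChristoffel G u v w)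
    + coordChristoffel H (f u) (fderiv ℝ f u v) (σ u w)

/-- Lowering the index cancels the inverse Gram matrix and leaves the Koszul expression. By
nondegeneracy this characterises Γ, so bilinearity and the transformation law can be proved without
indices. -/
theorem apply_coordChristoffel {G : Coord m → Bilin m} {u : Coord m} (hG : IsInnerForm (G u))
    (v w z : Coord m) :
    G u (coordChristoffel G u v w) z =
      1 / 2 * (fderiv ℝ G u v w z + fderiv ℝ G u w v z - fderiv ℝ G u z v w) := by
  set K : Coord m →ₗ[ℝ] ℝ :=
    { toFun := fun z =>
        1 / 2 * (fderiv ℝ G u v w z + fderiv ℝ G u w v z - fderiv ℝ G u z v w)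
      map_add' := fun a b => by simp only [map_add, add_apply]; ring
      map_smul' := fun c a => by simp only [map_smul, smul_apply, smul_eq_mul, RingHom.id_apply]; ring } with hK
  have hbasis : ∀ j, G u (coordChristoffel G u v w) (stdVec j) = K (stdVec j) := by
    intro j
    have h1 : G u (coordChristoffel G u v w) (stdVec j) =
        ∑ k, ∑ l, (gramMatrix (G u))⁻¹ k l * K (stdVec l) * gramMatrix (G u) k j := by
      simp [coordChristoffel, hK, gramMatrix]
    have hs : ∀ k, gramMatrix (G u) k j = gramMatrix (G u) j k := fun k => hG.symm _ _
    have h2 : ∀ l, ∑ k, (gramMatrix (G u))⁻¹ k l * K (stdVec l) * gramMatrix (G u) k j =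
        (1 : Matrix (Fin m) (Fin m) ℝ) j l * K (stdVec l) := by
      intro l
      rw [← Matrix.mul_nonsing_inv _ hG.isUnit_det, Matrix.mul_apply, Finset.sum_mul]
      exact Finset.sum_congr rfl fun k _ => by rw [hs]; ring
    rw [h1, Finset.sum_comm]
    simp [h2, Matrix.one_apply]
  change _ = K z
  rw [← sum_coord_smul_stdVec z]
  simp only [map_sum, map_smul, hbasis]

theorem coordChristoffel_eq_of_forall {G : Coord m → Bilin m} {u : Coord m}
    (hG : IsInnerForm (G u)) {v w y : Coord m}
    (h : ∀ z, G u y z =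
      1 / 2 * (fderiv ℝ G u v w z + fderiv ℝ G u w v z - fderiv ℝ G u z v w)) :
    coordChristoffel G u v w = y :=
  hG.eq_of_forall fun z => by rw [apply_coordChristoffel hG, h]

theorem coordChristoffel_add_left {G : Coord m → Bilin m} {u : Coord m}
    (hG : IsInnerForm (G u)) (v v' w : Coord m) :
    coordChristoffel G u (v + v') w = coordChristoffel G u v w + coordChristoffel G u v' w :=
  coordChristoffel_eq_of_forall hG fun z => by
    simp only [map_add, add_apply, apply_coordChristoffel hG]; ring

theorem coordChristoffel_smul_left {G : Coord m → Bilin m} {u : Coord m}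
    (hG : IsInnerForm (G u)) (c : ℝ) (v w : Coord m) :
    coordChristoffel G u (c • v) w = c • coordChristoffel G u v w :=
  coordChristoffel_eq_of_forall hG fun z => by
    simp only [map_smul, smul_apply, apply_coordChristoffel hG, smul_eq_mul]; ring

theorem coordChristoffel_add_right {G : Coord m → Bilin m} {u : Coord m}
    (hG : IsInnerForm (G u)) (v w w' : Coord m) :
    coordChristoffel G u v (w + w') = coordChristoffel G u v w + coordChristoffel G u v w' :=
  coordChristoffel_eq_of_forall hG fun z => by
    simp only [map_add, add_apply, apply_coordChristoffel hG]; ring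

theorem coordChristoffel_smul_right {G : Coord m → Bilin m} {u : Coord m}
    (hG : IsInnerForm (G u)) (c : ℝ) (v w : Coord m) :
    coordChristoffel G u v (c • w) = c • coordChristoffel G u v w :=
  coordChristoffel_eq_of_forall hG fun z => by
    simp only [map_smul, smul_apply, apply_coordChristoffel hG, smul_eq_mul]; ring

/-- The pull-back of a metric by a map `ψ`. -/
def pullMetric (ψ : Coord m → Coord m) (G : Coord m → Bilin m) (u : Coord m) : Bilin m :=
  (G (ψ u)).bilinearComp (fderiv ℝ ψ u) (fderiv ℝ ψ u)

theorem isInnerForm_bilinearComp {G : Bilin m} (hG : IsInnerForm G) {L : Coord m →L[ℝ] Coord m}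
    (hL : Function.Injective L) : IsInnerForm (G.bilinearComp L L) :=
  ⟨fun v w => hG.symm _ _, fun v hv => hG.pos _ fun h => hv (hL (by simpa using h))⟩

theorem fderiv_pullMetric {ψ : Coord m → Coord m} {G : Coord m → Bilin m} {u : Coord m}
    (hψ : ContDiffAt ℝ 2 ψ u) (hG : DifferentiableAt ℝ G (ψ u)) (v w z : Coord m) :
    fderiv ℝ (pullMetric ψ G) u v w z =
      fderiv ℝ G (ψ u) (fderiv ℝ ψ u v) (fderiv ℝ ψ u w) (fderiv ℝ ψ u z)
        + G (ψ u) (fderiv ℝ (fderiv ℝ ψ) u v w) (fderiv ℝ ψ u z)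
        + G (ψ u) (fderiv ℝ ψ u w) (fderiv ℝ (fderiv ℝ ψ) u v z) := by
  have hψd : DifferentiableAt ℝ ψ u := hψ.differentiableAt (by norm_num)
  have hψ' : DifferentiableAt ℝ (fderiv ℝ ψ) u :=
    (hψ.fderiv_right (m := 1) (by norm_num)).differentiableAt (by norm_num)
  have hGψ : DifferentiableAt ℝ (fun u => G (ψ u)) u := hG.comp u hψd
  have hpm : DifferentiableAt ℝ (pullMetric ψ G) u := by
    have : pullMetric ψ G = fun u => (((ContinuousLinearMap.compL ℝ (Coord m) (Coord m) ℝ).flip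
        (fderiv ℝ ψ u)).comp ((G (ψ u)).comp (fderiv ℝ ψ u))) := by
      ext; rfl
    rw [this]
    fun_prop
  have e : fderiv ℝ (fun u => pullMetric ψ G u w z) u v = fderiv ℝ (pullMetric ψ G) u v w z := by
    have h1 : HasFDerivAt (fun u => pullMetric ψ G u w z) _ u :=
      (hpm.hasFDerivAt.clm_apply (hasFDerivAt_const w u)).clm_apply (hasFDerivAt_const z u)
    rw [h1.fderiv]
    simp
  rw [← e]
  have h2 := ((hGψ.hasFDerivAt).clm_apply
    (hψ'.hasFDerivAt.clm_apply (hasFDerivAt_const w u))).clm_apply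
    (hψ'.hasFDerivAt.clm_apply (hasFDerivAt_const z u))
  have h3 : fderiv ℝ (fun u => G (ψ u)) u = (fderiv ℝ G (ψ u)).comp (fderiv ℝ ψ u) :=
    fderiv_comp u hG hψd
  have h4 : HasFDerivAt (fun u => pullMetric ψ G u w z) _ u := h2
  rw [h4.fderiv, h3]
  simp
  ring

/-- The transformation law of the Christoffel symbols. -/
theorem fderiv_coordChristoffel_pullMetric {ψ : Coord m → Coord m} {G : Coord m → Bilin m}
    {u : Coord m} (hψ : ContDiffAt ℝ 2 ψ u) (hG : DifferentiableAt ℝ G (ψ u))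
    (hI : IsInnerForm (G (ψ u))) (hb : Function.Bijective (fderiv ℝ ψ u)) (v w : Coord m) :
    fderiv ℝ ψ u (coordChristoffel (pullMetric ψ G) u v w) =
      coordChristoffel G (ψ u) (fderiv ℝ ψ u v) (fderiv ℝ ψ u w)
        + fderiv ℝ (fderiv ℝ ψ) u v w := by
  have hI' : IsInnerForm (pullMetric ψ G u) := isInnerForm_bilinearComp hI hb.1
  have hsymm : ∀ a b, fderiv ℝ (fderiv ℝ ψ) u a b = fderiv ℝ (fderiv ℝ ψ) u b a :=
    fun a b => hψ.isSymmSndFDerivAt (by simp) a b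
  -- Test against vectors dψ(z), which are all vectors. The product rule gives six terms with D²ψ;
  -- by its symmetry four of them cancel and the other two add up to twice G(D²ψ(v, w), dψ z).
  refine hI.eq_of_forall fun z' => ?_
  obtain ⟨z, rfl⟩ := hb.2 z'
  have h1 : G (ψ u) (fderiv ℝ ψ u (coordChristoffel (pullMetric ψ G) u v w)) (fderiv ℝ ψ u z)
      = pullMetric ψ G u (coordChristoffel (pullMetric ψ G) u v w) z := rfl
  rw [h1, apply_coordChristoffel hI', fderiv_pullMetric hψ hG, fderiv_pullMetric hψ hG,
    fderiv_pullMetric hψ hG, map_add, add_apply, apply_coordChristoffel hI, hsymm w v,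
    hsymm z v, hsymm z w, hI.symm (fderiv ℝ (fderiv ℝ ψ) u v z)]
  ring

theorem coordChristoffel_congr {G G' : Coord m → Bilin m} {u : Coord m} (h : G =ᶠ[nhds u] G') :
    coordChristoffel G u = coordChristoffel G' u := by
  funext v w
  simp only [coordChristoffel, h.fderiv_eq, h.eq_of_nhds]

/-- Covariant derivatives in different coordinates of the source. -/
theorem coordCov_comp_source {G G' : Coord m → Bilin m} {H : Coord n → Bilin n}
    {f f' : Coord m → Coord n} {σ σ' : Coord m → Coord m →L[ℝ] Coord n} {ψ : Coord m → Coord m}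
    {u : Coord m} (hψ : ContDiffAt ℝ 2 ψ u) (hG : DifferentiableAt ℝ G (ψ u))
    (hI : IsInnerForm (G (ψ u))) (hb : Function.Bijective (fderiv ℝ ψ u))
    (hf : DifferentiableAt ℝ f (ψ u)) (hσ : DifferentiableAt ℝ σ (ψ u))
    (hG' : G' =ᶠ[nhds u] pullMetric ψ G) (hf' : f' =ᶠ[nhds u] f ∘ ψ)
    (hσ' : σ' =ᶠ[nhds u] fun x => (σ (ψ x)).comp (fderiv ℝ ψ x)) (v w : Coord m) :
    coordCov G' H f' σ' u v w = coordCov G H f σ (ψ u) (fderiv ℝ ψ u v) (fderiv ℝ ψ u w) := by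
  have hψd : DifferentiableAt ℝ ψ u := hψ.differentiableAt (by norm_num)
  have hψ' : DifferentiableAt ℝ (fderiv ℝ ψ) u :=
    (hψ.fderiv_right (m := 1) (by norm_num)).differentiableAt (by norm_num)
  have hd : HasFDerivAt (fun x => (σ (ψ x)).comp (fderiv ℝ ψ x)) _ u :=
    (hσ.hasFDerivAt.comp u hψd.hasFDerivAt).clm_comp hψ'.hasFDerivAt
  unfold coordCov
  rw [coordChristoffel_congr hG', hσ'.fderiv_eq, hf'.fderiv_eq, hσ'.eq_of_nhds, hf'.eq_of_nhds,
    fderiv_comp u hf hψd, hd.fderiv]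
  -- Differentiating σ ∘ dψ produces σ(D²ψ(v, w)), which cancels the inhomogeneous term of the
  -- Christoffel symbols.
  have e := fderiv_coordChristoffel_pullMetric hψ hG hI hb v w
  simp only [ContinuousLinearMap.comp_apply, e, map_add, Function.comp_apply]
  simp
  abel

/-- Covariant derivatives in different coordinates of the target. -/
theorem coordCov_comp_target {G : Coord m → Bilin m} {H H' : Coord n → Bilin n}
    {f f' : Coord m → Coord n} {σ σ' : Coord m → Coord m →L[ℝ] Coord n} {χ : Coord n → Coord n}
    {u : Coord m} (hχ : ContDiffAt ℝ 2 χ (f u)) (hH' : DifferentiableAt ℝ H' (χ (f u)))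
    (hI : IsInnerForm (H' (χ (f u)))) (hb : Function.Bijective (fderiv ℝ χ (f u)))
    (hf : DifferentiableAt ℝ f u) (hσ : DifferentiableAt ℝ σ u)
    (hH : H =ᶠ[nhds (f u)] pullMetric χ H') (hf' : f' =ᶠ[nhds u] χ ∘ f)
    (hσ' : σ' =ᶠ[nhds u] fun x => (fderiv ℝ χ (f x)).comp (σ x)) (v w : Coord m) :
    coordCov G H' f' σ' u v w = fderiv ℝ χ (f u) (coordCov G H f σ u v w) := by
  have hχd : DifferentiableAt ℝ χ (f u) := hχ.differentiableAt (by norm_num)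
  have hχ' : DifferentiableAt ℝ (fderiv ℝ χ) (f u) :=
    (hχ.fderiv_right (m := 1) (by norm_num)).differentiableAt (by norm_num)
  have hd : HasFDerivAt (fun x => (fderiv ℝ χ (f x)).comp (σ x)) _ u :=
    (hχ'.hasFDerivAt.comp u hf.hasFDerivAt).clm_comp hσ.hasFDerivAt
  unfold coordCov
  rw [coordChristoffel_congr hH, hσ'.fderiv_eq, hf'.fderiv_eq, hσ'.eq_of_nhds, hf'.eq_of_nhds,
    fderiv_comp u hχd hf, hd.fderiv]
  -- Differentiating dχ ∘ σ produces D²χ(df v, σ w), which is exactly the inhomogeneous term on the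
  -- other side.
  have e := fderiv_coordChristoffel_pullMetric hχ hH' hI hb (fderiv ℝ f u v) (σ u w)
  simp only [map_add, map_sub, e, Function.comp_apply, ContinuousLinearMap.comp_apply]
  simp
  abel

end CoordinateGeometry

end

noncomputable section

/-! ### Chart transitions and smoothness of the metric in charts. -/

section ChartGeometry

open Filter Topology

variable {m : ℕ} {M : Type*} [TopologicalSpace M] [ChartedSpace (EuclideanSpace ℝ (Fin m)) M]

/-- The change of coordinates from the chart centred at `b` to the chart centred at `a`. -/
def chartTransition (b a : M) (u : Coord m) : Coord m :=
  extChartAt (𝓡 m) a ((extChartAt (𝓡 m) b).symm u)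

/-- The differential of the inverse chart as a map of the model space. -/
def coordFrame (a : M) (u : Coord m) : Coord m →L[ℝ] Coord m := chartFrame a u

theorem chartTransition_mem {a b : M} {u : Coord m}
    (ha : (extChartAt (𝓡 m) b).symm u ∈ (extChartAt (𝓡 m) a).source) :
    chartTransition b a u ∈ (extChartAt (𝓡 m) a).target :=
  (extChartAt (𝓡 m) a).map_source ha

theorem extChartAt_symm_chartTransition {a b : M} {u : Coord m}
    (ha : (extChartAt (𝓡 m) b).symm u ∈ (extChartAt (𝓡 m) a).source) :
    (extChartAt (𝓡 m) a).symm (chartTransition b a u) = (extChartAt (𝓡 m) b).symm u :=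
  (extChartAt (𝓡 m) a).left_inv ha

theorem eventually_mem_chart {a b : M} {u : Coord m}
    (hu : u ∈ (extChartAt (𝓡 m) b).target)
    (ha : (extChartAt (𝓡 m) b).symm u ∈ (extChartAt (𝓡 m) a).source) :
    ∀ᶠ y in 𝓝 u, y ∈ (extChartAt (𝓡 m) b).target ∧
      (extChartAt (𝓡 m) b).symm y ∈ (extChartAt (𝓡 m) a).source :=
  Filter.Eventually.and (extChartAt_target_mem_nhds' hu)
    ((continuousAt_extChartAt_symm'' hu).eventually
      ((isOpen_extChartAt_source a).mem_nhds ha))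

variable [IsManifold (𝓡 m) ∞ M]

theorem contMDiffAt_extChartAt_symm {a : M} {u : Coord m}
    (hu : u ∈ (extChartAt (𝓡 m) a).target) :
    ContMDiffAt 𝓘(ℝ, Coord m) (𝓡 m) ∞ (extChartAt (𝓡 m) a).symm u :=
  (contMDiffOn_extChartAt_symm a).contMDiffAt (extChartAt_target_mem_nhds' hu)

theorem contMDiffAt_extChartAt_of_mem {a x : M} (hx : x ∈ (extChartAt (𝓡 m) a).source) :
    ContMDiffAt (𝓡 m) 𝓘(ℝ, Coord m) ∞ (extChartAt (𝓡 m) a) x :=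
  contMDiffAt_extChartAt' (by simpa using hx)

theorem isManifold_one : IsManifold (𝓡 m) 1 M :=
  IsManifold.of_le (n := ∞) (by exact_mod_cast le_top)

theorem bijective_coordFrame {a : M} {u : Coord m} (hu : u ∈ (extChartAt (𝓡 m) a).target) :
    Function.Bijective (coordFrame a u) := by
  have : IsManifold (𝓡 m) 1 M := isManifold_one
  have h := isInvertible_mfderivWithin_extChartAt_symm (I := 𝓡 m) (x := a) hu
  rw [ModelWithCorners.range_eq_univ, mfderivWithin_univ] at h
  exact h.bijective

/-- A tangent vector at a is, by convention, its coordinates in the chart centred at a. Hence at the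
centre the chart metric is the metric of the fibre itself. -/
theorem coordFrame_self (a : M) : coordFrame a (extChartAt (𝓡 m) a a) =
    ContinuousLinearMap.id ℝ (Coord m) := by
  have : IsManifold (𝓡 m) 1 M := isManifold_one
  have h := mfderivWithin_range_extChartAt_symm (I := 𝓡 m) (x := a)
  rw [ModelWithCorners.range_eq_univ, mfderivWithin_univ] at h
  exact h

theorem contDiffAt_chartTransition {a b : M} {u : Coord m}
    (hu : u ∈ (extChartAt (𝓡 m) b).target)
    (ha : (extChartAt (𝓡 m) b).symm u ∈ (extChartAt (𝓡 m) a).source) :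
    ContDiffAt ℝ ∞ (chartTransition b a) u :=
  ((contMDiffAt_extChartAt_of_mem ha).comp u (contMDiffAt_extChartAt_symm hu)).contDiffAt

theorem coordFrame_chartTransition {a b : M} {u : Coord m}
    (hu : u ∈ (extChartAt (𝓡 m) b).target)
    (ha : (extChartAt (𝓡 m) b).symm u ∈ (extChartAt (𝓡 m) a).source) :
    coordFrame b u =
      (coordFrame a (chartTransition b a u)).comp (fderiv ℝ (chartTransition b a) u) := by
  have h1 : (extChartAt (𝓡 m) b).symm =ᶠ[𝓝 u]
      (extChartAt (𝓡 m) a).symm ∘ chartTransition b a := by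
    filter_upwards [eventually_mem_chart hu ha] with y hy
    exact (extChartAt_symm_chartTransition hy.2).symm
  have h2 : MDifferentiableAt 𝓘(ℝ, Coord m) (𝓡 m) (extChartAt (𝓡 m) a).symm
      (chartTransition b a u) :=
    (contMDiffAt_extChartAt_symm (chartTransition_mem ha)).mdifferentiableAt (by simp)
  have h3 : MDifferentiableAt 𝓘(ℝ, Coord m) 𝓘(ℝ, Coord m) (chartTransition b a) u :=
    ((contDiffAt_chartTransition hu ha).differentiableAt (by simp)).mdifferentiableAt
  have h4 := h1.mfderiv_eq (I := 𝓘(ℝ, Coord m)) (I' := 𝓡 m)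
  rw [mfderiv_comp u h2 h3, mfderiv_eq_fderiv] at h4
  exact h4

theorem bijective_fderiv_chartTransition {a b : M} {u : Coord m}
    (hu : u ∈ (extChartAt (𝓡 m) b).target)
    (ha : (extChartAt (𝓡 m) b).symm u ∈ (extChartAt (𝓡 m) a).source) :
    Function.Bijective (fderiv ℝ (chartTransition b a) u) := by
  have h := bijective_coordFrame hu
  rw [coordFrame_chartTransition hu ha, ContinuousLinearMap.coe_comp] at h
  exact (Function.Bijective.of_comp_iff' (bijective_coordFrame (chartTransition_mem ha)) _).1 h

/-- A Riemannian metric at a point as a bilinear form on the model space. -/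
def metricForm (g : SmoothMetric m M) (x : M) : Bilin m := g.inner x

theorem isInnerForm_metricForm (g : SmoothMetric m M) (x : M) : IsInnerForm (metricForm g x) :=
  ⟨fun v w => g.symm x v w, fun v hv => g.pos x v hv⟩

theorem chartMetric_eq (g : SmoothMetric m M) (a : M) (u : Coord m) :
    chartMetric g a u = (metricForm g ((extChartAt (𝓡 m) a).symm u)).bilinearComp
      (coordFrame a u) (coordFrame a u) := rfl

theorem isInnerForm_chartMetric (g : SmoothMetric m M) {a : M} {u : Coord m}
    (hu : u ∈ (extChartAt (𝓡 m) a).target) : IsInnerForm (chartMetric g a u) :=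
  isInnerForm_bilinearComp (isInnerForm_metricForm g _) (bijective_coordFrame hu).1

theorem chartMetric_self (g : SmoothMetric m M) (a : M) :
    chartMetric g a (extChartAt (𝓡 m) a a) = metricForm g a := by
  rw [chartMetric_eq, coordFrame_self, extChartAt_to_inv]
  rfl

theorem chartMetric_eq_pullMetric (g : SmoothMetric m M) {a b : M} {u : Coord m}
    (hu : u ∈ (extChartAt (𝓡 m) b).target)
    (ha : (extChartAt (𝓡 m) b).symm u ∈ (extChartAt (𝓡 m) a).source) :
    chartMetric g b u = pullMetric (chartTransition b a) (chartMetric g a) u := by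
  rw [pullMetric, chartMetric_eq, chartMetric_eq, extChartAt_symm_chartTransition ha,
    coordFrame_chartTransition hu ha]
  rfl

theorem chartMetric_eventuallyEq (g : SmoothMetric m M) {a b : M} {u : Coord m}
    (hu : u ∈ (extChartAt (𝓡 m) b).target)
    (ha : (extChartAt (𝓡 m) b).symm u ∈ (extChartAt (𝓡 m) a).source) :
    chartMetric g b =ᶠ[𝓝 u] pullMetric (chartTransition b a) (chartMetric g a) := by
  filter_upwards [eventually_mem_chart hu ha] with y hy
  exact chartMetric_eq_pullMetric g hy.1 hy.2

/-- Linear maps depend smoothly on a parameter if their values on the basis do. -/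
theorem contDiffAt_of_apply_stdVec {X F : Type*} [NormedAddCommGroup X] [NormedSpace ℝ X]
    [NormedAddCommGroup F] [NormedSpace ℝ F] {k : ℕ∞ω} {A : X → Coord m →L[ℝ] F} {z : X}
    (h : ∀ i, ContDiffAt ℝ k (fun z => A z (stdVec i)) z) : ContDiffAt ℝ k A z := by
  have e : A = fun z => ∑ i, (ContinuousLinearMap.smulRightL ℝ (Coord m) F
      (EuclideanSpace.proj i)) (A z (stdVec i)) := by
    funext z
    ext1 v
    conv_lhs => rw [← sum_coord_smul_stdVec v]
    simp
  rw [e]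
  exact ContDiffAt.sum fun i _ => (ContinuousLinearMap.contDiff _).contDiffAt.comp z (h i)

/-- It suffices to treat the entries g(∂_i, ∂_j). Each ∂_i is the tangent map of the inverse chart
applied to a constant field, hence smooth, and g is a smooth section of the bundle of bilinear
forms. -/
theorem contDiffAt_chartMetric (g : SmoothMetric m M) {a : M} {u : Coord m}
    (hu : u ∈ (extChartAt (𝓡 m) a).target) : ContDiffAt ℝ ∞ (chartMetric g a) u := by
  have : IsManifold (𝓡 m) 1 M := isManifold_one
  refine contDiffAt_of_apply_stdVec fun i => contDiffAt_of_apply_stdVec fun j => ?_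
  have hop := isOpen_extChartAt_target (I := 𝓡 m) a
  have hT := (contMDiffOn_extChartAt_symm (I := 𝓡 m) (n := ∞) a).contMDiffOn_tangentMapWithin
    (m := ∞) (by simp) hop.uniqueMDiffOn
  have hv : ∀ e : Coord m, ContMDiffAt 𝓘(ℝ, Coord m) (𝓡 m).tangent ∞
      (fun u => (⟨(extChartAt (𝓡 m) a).symm u, chartFrame a u e⟩ : TangentBundle (𝓡 m) M)) u := by
    intro e
    have hs : ContMDiffAt 𝓘(ℝ, Coord m) 𝓘(ℝ, Coord m).tangent ∞
        (fun u => (⟨u, e⟩ : TangentBundle 𝓘(ℝ, Coord m) (Coord m))) u :=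
      contMDiffAt_vectorSpace_iff_contDiffAt.2 contDiffAt_const
    have h1 := (hT _ (show (⟨u, e⟩ : TangentBundle 𝓘(ℝ, Coord m) (Coord m)) ∈ _ from hu)).comp u
      (hs.contMDiffWithinAt (s := (extChartAt (𝓡 m) a).target)) (fun y hy => hy)
    have h2 := h1.contMDiffAt (hop.mem_nhds hu)
    refine h2.congr_of_eventuallyEq ?_
    filter_upwards [hop.mem_nhds hu] with y hy
    simp only [Function.comp, tangentMapWithin, mfderivWithin_of_isOpen hop hy]
    rfl
  have hg : ContMDiffAt 𝓘(ℝ, Coord m) ((𝓡 m).prod 𝓘(ℝ)) ∞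
      (fun u ↦ TotalSpace.mk' ℝ (E := Bundle.Trivial M ℝ) ((extChartAt (𝓡 m) a).symm u)
        (g.inner ((extChartAt (𝓡 m) a).symm u) (chartFrame a u (stdVec i))
          (chartFrame a u (stdVec j)))) u := by
    rw [← contMDiffWithinAt_univ]
    apply ContMDiffWithinAt.clm_bundle_apply₂ (F₁ := Coord m) (F₂ := Coord m)
    · exact g.contMDiff.contMDiffAt.comp_contMDiffWithinAt u
        (contMDiffAt_extChartAt_symm hu).contMDiffWithinAt
    · exact (hv (stdVec i)).contMDiffWithinAt
    · exact (hv (stdVec j)).contMDiffWithinAt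
  simp only [contMDiffAt_totalSpace] at hg
  exact hg.2.contDiffAt

end ChartGeometry

end

noncomputable section

/-! ### The form |df|^(p-2) df and the p-tension field in coordinates. -/

section CoordinateMaps

open Filter Topology

/-- The product rule for `e ^ s • A`, also where `e` vanishes provided `A` vanishes there too. -/
theorem hasFDerivAt_rpow_smul {X W : Type*} [NormedAddCommGroup X] [NormedSpace ℝ X]
    [NormedAddCommGroup W] [NormedSpace ℝ W] {e : X → ℝ} {A : X → W} {x : X} {s : ℝ}
    (hs : 0 ≤ s) (he : DifferentiableAt ℝ e x) (hA : DifferentiableAt ℝ A x)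
    (h0 : e x = 0 → A x = 0) :
    HasFDerivAt (fun y => e y ^ s • A y)
      (e x ^ s • fderiv ℝ A x + (s * e x ^ (s - 1)) • (fderiv ℝ e x).smulRight (A x)) x := by
  rcases hs.eq_or_lt with rfl | hs
  -- For s = 0 the power is 1 even at zeros of e, and the factor s removes the second term.
  · simpa using hA.hasFDerivAt
  by_cases hx : e x = 0
  -- At a zero of e, e^s = o(1) and A = O(y - x), so the product is o(y - x). The stated derivative
  -- is zero as well: the value of 0^(s-1) does not matter since it multiplies A x = 0.
  · have hAx := h0 hx
    have h1 : e x ^ s • fderiv ℝ A x +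
        (s * e x ^ (s - 1)) • (fderiv ℝ e x).smulRight (A x) = 0 := by
      rw [hx, hAx, Real.zero_rpow hs.ne']; simp
    rw [h1, hasFDerivAt_iff_isLittleO]
    have h2 : (fun y => e y ^ s) =o[𝓝 x] (fun _ => (1 : ℝ)) := by
      rw [Asymptotics.isLittleO_one_iff]
      have := he.continuousAt.rpow_const (p := s) (Or.inr hs.le)
      simpa [ContinuousAt, hx, Real.zero_rpow hs.ne'] using this
    have h3 : (fun y => A y) =O[𝓝 x] fun y => y - x := by
      simpa [hAx] using hA.isBigO_sub
    simpa [hAx] using h2.smul_isBigO h3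
  · have h1 := (he.hasFDerivAt.rpow_const (p := s) (Or.inl hx)).smul hA.hasFDerivAt
    refine h1.congr_fderiv ?_
    ext v
    simp [smul_smul]

variable {m n : ℕ}

/-- The energy density `|df|²` of a map in coordinates. -/
def coordDensity (G : Coord m → Bilin m) (H : Coord n → Bilin n) (f : Coord m → Coord n)
    (u : Coord m) : ℝ :=
  metricTrace (G u) fun v w => H (f u) (fderiv ℝ f u v) (fderiv ℝ f u w)

/-- The form `|df|^(p-2) df` in coordinates. -/
def coordPForm (G : Coord m → Bilin m) (H : Coord n → Bilin n) (p : ℝ) (f : Coord m → Coord n)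
    (u : Coord m) : Coord m →L[ℝ] Coord n :=
  Real.sqrt (coordDensity G H f u) ^ (p - 2) • fderiv ℝ f u

/-- Cramer's rule: the entries of the inverse are quotients of polynomials in the entries of G, with
nonzero denominator at z. -/
theorem ContDiffAt.gramMatrix_inv {X : Type*} [NormedAddCommGroup X] [NormedSpace ℝ X] {k : ℕ∞ω}
    {G : X → Bilin m} {z : X} (hG : ContDiffAt ℝ k G z) (hI : IsInnerForm (G z)) (i j : Fin m) :
    ContDiffAt ℝ k (fun z => (gramMatrix (G z))⁻¹ i j) z := by
  have hent : ∀ i j, ContDiffAt ℝ k (fun z => gramMatrix (G z) i j) z := fun i j =>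
    (hG.clm_apply contDiffAt_const).clm_apply contDiffAt_const
  have hdet : ∀ A : X → Matrix (Fin m) (Fin m) ℝ, (∀ i j, ContDiffAt ℝ k (fun z => A z i j) z) →
      ContDiffAt ℝ k (fun z => (A z).det) z := by
    intro A hA
    simp only [Matrix.det_apply]
    exact ContDiffAt.sum fun σ _ => (contDiffAt_prod fun i _ => hA _ _).const_smul (Equiv.Perm.sign σ)
  have e : (fun z => (gramMatrix (G z))⁻¹ i j) = fun z =>
      (gramMatrix (G z)).det⁻¹ * ((gramMatrix (G z)).updateRow j (Pi.single i 1)).det := by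
    funext z
    rw [Matrix.inv_def, Matrix.smul_apply, Matrix.adjugate_apply, Ring.inverse_eq_inv', smul_eq_mul]
  rw [e]
  refine ((hdet _ hent).inv hI.isUnit_det.ne_zero).mul (hdet _ fun a b => ?_)
  by_cases ha : a = j
  · subst ha
    simpa using contDiffAt_const
  · simpa [Matrix.updateRow_ne ha] using hent a b

theorem ContDiffAt.metricTrace {X F : Type*} [NormedAddCommGroup X] [NormedSpace ℝ X]
    [NormedAddCommGroup F] [NormedSpace ℝ F] {k : ℕ∞ω}
    {G : X → Bilin m} {z : X} (hG : ContDiffAt ℝ k G z) (hI : IsInnerForm (G z))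
    {B : X → Coord m → Coord m → F} (hB : ∀ v w, ContDiffAt ℝ k (fun z => B z v w) z) :
    ContDiffAt ℝ k (fun z => metricTrace (G z) (B z)) z :=
  ContDiffAt.sum fun i _ => ContDiffAt.sum fun j _ => (hG.gramMatrix_inv hI i j).smul (hB _ _)

theorem ContDiffAt.fderiv_infty {X Y : Type*} [NormedAddCommGroup X] [NormedSpace ℝ X]
    [NormedAddCommGroup Y] [NormedSpace ℝ Y] {f : X → Y} {x : X} (hf : ContDiffAt ℝ ∞ f x) :
    ContDiffAt ℝ ∞ (fderiv ℝ f) x :=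
  hf.fderiv_right (by simp)

theorem contDiffAt_coordDensity {G : Coord m → Bilin m} {H : Coord n → Bilin n}
    {f : Coord m → Coord n} {u : Coord m} (hG : ContDiffAt ℝ ∞ G u) (hH : ContDiffAt ℝ ∞ H (f u))
    (hf : ContDiffAt ℝ ∞ f u) (hI : IsInnerForm (G u)) :
    ContDiffAt ℝ ∞ (coordDensity G H f) u :=
  hG.metricTrace hI fun _ _ => ((hH.comp u hf).clm_apply
    (hf.fderiv_infty.clm_apply contDiffAt_const)).clm_apply
      (hf.fderiv_infty.clm_apply contDiffAt_const)

theorem coordPForm_eq_rpow {G : Coord m → Bilin m} {H : Coord n → Bilin n}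
    {f : Coord m → Coord n} {u : Coord m} (p : ℝ) (hI : IsInnerForm (G u))
    (hJ : IsInnerForm (H (f u))) :
    coordPForm G H p f u = coordDensity G H f u ^ ((p - 2) / 2) • fderiv ℝ f u := by
  have h0 : 0 ≤ coordDensity G H f u := (metricTrace_inner_nonneg_and_eq_zero hI hJ _).1
  rw [coordPForm, Real.sqrt_eq_rpow, ← Real.rpow_mul h0]
  ring_nf

/-- The density vanishes only where df does, so for p ≥ 2 the product rule survives at critical
points of f, even when the power of the density is not differentiable there. -/
theorem hasFDerivAt_coordPForm {G : Coord m → Bilin m} {H : Coord n → Bilin n}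
    {f : Coord m → Coord n} {u : Coord m} {p : ℝ} (hp : 2 ≤ p)
    (hG : ContDiffAt ℝ ∞ G u) (hH : ContDiffAt ℝ ∞ H (f u)) (hf : ContDiffAt ℝ ∞ f u)
    (hI : ∀ᶠ y in 𝓝 u, IsInnerForm (G y)) (hJ : ∀ᶠ y in 𝓝 (f u), IsInnerForm (H y)) :
    HasFDerivAt (coordPForm G H p f)
      (coordDensity G H f u ^ ((p - 2) / 2) • fderiv ℝ (fderiv ℝ f) u +
        ((p - 2) / 2 * coordDensity G H f u ^ ((p - 2) / 2 - 1)) •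
          (fderiv ℝ (coordDensity G H f) u).smulRight (fderiv ℝ f u)) u := by
  refine (hasFDerivAt_rpow_smul (by linarith)
    ((contDiffAt_coordDensity hG hH hf hI.self_of_nhds).differentiableAt (by simp))
    (hf.fderiv_infty.differentiableAt (by simp))
    (metricTrace_inner_nonneg_and_eq_zero hI.self_of_nhds hJ.self_of_nhds _).2).congr_of_eventuallyEq
    ?_
  filter_upwards [hI, hf.continuousAt.eventually hJ] with y h1 h2
  exact coordPForm_eq_rpow p h1 h2

/-- The `p`-tension field of a map in coordinates. -/
def coordTension (G : Coord m → Bilin m) (H : Coord n → Bilin n) (p : ℝ) (f : Coord m → Coord n)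
    (u : Coord m) : Coord n :=
  metricTrace (G u) (coordCov G H f (coordPForm G H p f) u)

/-- Trace invariance applies because the covariant derivative is bilinear in (v, w). -/
theorem metricTrace_coordCov_comp {G : Coord m → Bilin m} {H : Coord n → Bilin n}
    {f : Coord m → Coord n} {σ : Coord m → Coord m →L[ℝ] Coord n} {u : Coord m}
    (hI : IsInnerForm (G u)) (hJ : IsInnerForm (H (f u))) (L : Coord m →L[ℝ] Coord m)
    (hL : Function.Injective L) :
    metricTrace ((G u).bilinearComp L L) (fun v w => coordCov G H f σ u (L v) (L w)) =
      metricTrace (G u) (coordCov G H f σ u) :=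
  metricTrace_comp (G u) L hL (LinearMap.mk₂ ℝ (coordCov G H f σ u)
    (fun a b c => by
      simp only [coordCov, map_add, add_apply, coordChristoffel_add_left hI,
        coordChristoffel_add_left hJ]; abel)
    (fun r a c => by
      simp only [coordCov, map_smul, smul_apply, coordChristoffel_smul_left hI,
        coordChristoffel_smul_left hJ, smul_sub, smul_add])
    (fun a b c => by
      simp only [coordCov, map_add, coordChristoffel_add_right hI,
        coordChristoffel_add_right hJ]; abel)
    (fun r a c => by
      simp only [coordCov, map_smul, coordChristoffel_smul_right hI,
        coordChristoffel_smul_right hJ, smul_sub, smul_add]))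

end CoordinateMaps

/-! ### Independence of the p-tension field from the charts. -/

section ChartMaps

open Filter Topology

variable {m n : ℕ}
  {M : Type*} [TopologicalSpace M] [ChartedSpace (EuclideanSpace ℝ (Fin m)) M]
  {N : Type*} [TopologicalSpace N] [ChartedSpace (EuclideanSpace ℝ (Fin n)) N]

theorem eventually_chartMap_mem {φ : M → N} (hφ : Continuous φ) {a : M} {b : N} {u : Coord m}
    (hu : u ∈ (extChartAt (𝓡 m) a).target)
    (hb : φ ((extChartAt (𝓡 m) a).symm u) ∈ (extChartAt (𝓡 n) b).source) :
    ∀ᶠ y in 𝓝 u, y ∈ (extChartAt (𝓡 m) a).target ∧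
      φ ((extChartAt (𝓡 m) a).symm y) ∈ (extChartAt (𝓡 n) b).source :=
  Filter.Eventually.and (extChartAt_target_mem_nhds' hu)
    ((hφ.continuousAt.comp (continuousAt_extChartAt_symm'' hu)).eventually
      ((isOpen_extChartAt_source b).mem_nhds hb))

variable [IsManifold (𝓡 m) ∞ M] [IsManifold (𝓡 n) ∞ N]

theorem contDiffAt_chartMap {φ : M → N} (hφ : ContMDiff (𝓡 m) (𝓡 n) ∞ φ) {a : M} {b : N}
    {u : Coord m} (hu : u ∈ (extChartAt (𝓡 m) a).target)
    (hb : φ ((extChartAt (𝓡 m) a).symm u) ∈ (extChartAt (𝓡 n) b).source) :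
    ContDiffAt ℝ ∞ (chartMap (n := n) a b φ) u :=
  ((contMDiffAt_extChartAt_of_mem (m := n) hb).comp u
    (hφ.contMDiffAt.comp u (contMDiffAt_extChartAt_symm hu))).contDiffAt

/-- The left side is a trace in the coordinates of the fibre at x, the right side one in the chart
at a. The frame of that chart is an invertible linear map between them, so `metricTrace_comp` and
the chain rule identify the two. -/
theorem differentialNorm_eq_sqrt_coordDensity (g : SmoothMetric m M) (h : SmoothMetric n N)
    {φ : M → N} (hφ : ContMDiff (𝓡 m) (𝓡 n) ∞ φ) {a : M} {b : N}
    {u : Coord m} (hu : u ∈ (extChartAt (𝓡 m) a).target)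
    (hb : φ ((extChartAt (𝓡 m) a).symm u) ∈ (extChartAt (𝓡 n) b).source) :
    differentialNorm g h φ ((extChartAt (𝓡 m) a).symm u) =
      Real.sqrt (coordDensity (chartMetric g a) (chartMetric h b) (chartMap a b φ) u) := by
  set x := (extChartAt (𝓡 m) a).symm u with hx
  let D : Coord m →L[ℝ] Coord n := mfderiv (𝓡 m) (𝓡 n) φ x
  have hsymm : (extChartAt (𝓡 n) b).symm (chartMap a b φ u) = φ x :=
    (extChartAt (𝓡 n) b).left_inv hb
  have hchain : ∀ v, D (coordFrame a u v) =
      coordFrame b (chartMap a b φ u) (fderiv ℝ (chartMap a b φ) u v) := by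
    have h1 : φ ∘ (extChartAt (𝓡 m) a).symm =ᶠ[𝓝 u]
        (extChartAt (𝓡 n) b).symm ∘ chartMap a b φ := by
      filter_upwards [eventually_chartMap_mem hφ.continuous hu hb] with y hy
      exact ((extChartAt (𝓡 n) b).left_inv hy.2).symm
    have h2 := h1.mfderiv_eq (I := 𝓘(ℝ, Coord m)) (I' := 𝓡 n)
    rw [mfderiv_comp u (hφ.mdifferentiable (by simp) _)
        ((contMDiffAt_extChartAt_symm hu).mdifferentiableAt (by simp)),
      mfderiv_comp u ((contMDiffAt_extChartAt_symm
        ((extChartAt (𝓡 n) b).map_source hb)).mdifferentiableAt (by simp))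
        ((contDiffAt_chartMap hφ hu hb).differentiableAt (by simp)).mdifferentiableAt,
      mfderiv_eq_fderiv] at h2
    exact fun v => DFunLike.congr_fun h2 v
  let B : Coord m →ₗ[ℝ] Coord m →ₗ[ℝ] ℝ :=
    LinearMap.mk₂ ℝ (fun v w => metricForm h (φ x) (D v) (D w))
      (by simp) (by simp) (by simp) (by simp)
  have key := metricTrace_comp (metricForm g x) (coordFrame a u) (bijective_coordFrame hu).1 B
  have e1 : differentialNorm g h φ x =
      Real.sqrt (metricTrace (metricForm g x) fun v w => B v w) := rfl
  rw [e1, ← key, coordDensity]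
  congr 2
  funext v w
  rw [chartMetric_eq, hsymm]
  simp only [B, LinearMap.mk₂_apply, hchain]
  rfl

theorem chartPForm_eventuallyEq (g : SmoothMetric m M) (h : SmoothMetric n N) (p : ℝ)
    {φ : M → N} (hφ : ContMDiff (𝓡 m) (𝓡 n) ∞ φ) {a : M} {b : N}
    {u : Coord m} (hu : u ∈ (extChartAt (𝓡 m) a).target)
    (hb : φ ((extChartAt (𝓡 m) a).symm u) ∈ (extChartAt (𝓡 n) b).source) :
    chartPForm g h p a b φ =ᶠ[𝓝 u]
      coordPForm (chartMetric g a) (chartMetric h b) p (chartMap a b φ) := by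
  filter_upwards [eventually_chartMap_mem hφ.continuous hu hb] with y hy
  rw [chartPForm, coordPForm, differentialNorm_eq_sqrt_coordDensity g h hφ hy.1 hy.2]

theorem eventually_isInnerForm_chartMetric (g : SmoothMetric m M) {a : M} {u : Coord m}
    (hu : u ∈ (extChartAt (𝓡 m) a).target) : ∀ᶠ y in 𝓝 u, IsInnerForm (chartMetric g a y) := by
  filter_upwards [extChartAt_target_mem_nhds' hu] with y hy
  exact isInnerForm_chartMetric g hy

theorem differentiableAt_chartPForm (g : SmoothMetric m M) (h : SmoothMetric n N) {p : ℝ}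
    (hp : 2 ≤ p) {φ : M → N} (hφ : ContMDiff (𝓡 m) (𝓡 n) ∞ φ) {a : M} {b : N}
    {u : Coord m} (hu : u ∈ (extChartAt (𝓡 m) a).target)
    (hb : φ ((extChartAt (𝓡 m) a).symm u) ∈ (extChartAt (𝓡 n) b).source) :
    DifferentiableAt ℝ (chartPForm g h p a b φ) u :=
  (hasFDerivAt_coordPForm hp (contDiffAt_chartMetric g hu)
    (contDiffAt_chartMetric h ((extChartAt (𝓡 n) b).map_source hb))
    (contDiffAt_chartMap hφ hu hb) (eventually_isInnerForm_chartMetric g hu)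
    (eventually_isInnerForm_chartMetric h
      ((extChartAt (𝓡 n) b).map_source hb))).differentiableAt.congr_of_eventuallyEq
    (chartPForm_eventuallyEq g h p hφ hu hb)

theorem chartPTension_eq_coordTension (g : SmoothMetric m M) (h : SmoothMetric n N) (p : ℝ)
    {φ : M → N} (hφ : ContMDiff (𝓡 m) (𝓡 n) ∞ φ) {a : M} {b : N}
    {u : Coord m} (hu : u ∈ (extChartAt (𝓡 m) a).target)
    (hb : φ ((extChartAt (𝓡 m) a).symm u) ∈ (extChartAt (𝓡 n) b).source) :
    chartPTension g h p a b φ u =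
      coordTension (chartMetric g a) (chartMetric h b) p (chartMap a b φ) u := by
  have h1 := chartPForm_eventuallyEq g h p hφ hu hb
  have h2 : chartPTension g h p a b φ u = metricTrace (chartMetric g a u)
    (coordCov (chartMetric g a) (chartMetric h b) (chartMap a b φ) (chartPForm g h p a b φ) u) :=
    rfl
  rw [h2, coordTension]
  congr 1
  funext v w
  simp only [coordCov, h1.fderiv_eq, h1.eq_of_nhds]

/-- The `p`-tension field in different charts of the source. -/
theorem chartPTension_source (g : SmoothMetric m M) (h : SmoothMetric n N) {p : ℝ} (hp : 2 ≤ p)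
    {φ : M → N} (hφ : ContMDiff (𝓡 m) (𝓡 n) ∞ φ) {a a' : M} {b : N}
    {u : Coord m} (hu : u ∈ (extChartAt (𝓡 m) a').target)
    (ha : (extChartAt (𝓡 m) a').symm u ∈ (extChartAt (𝓡 m) a).source)
    (hb : φ ((extChartAt (𝓡 m) a').symm u) ∈ (extChartAt (𝓡 n) b).source) :
    chartPTension g h p a' b φ u = chartPTension g h p a b φ (chartTransition a' a u) := by
  set ψ := chartTransition (m := m) a' a with hψ
  have key : ∀ y, y ∈ (extChartAt (𝓡 m) a').target →
      (extChartAt (𝓡 m) a').symm y ∈ (extChartAt (𝓡 m) a).source →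
      φ ((extChartAt (𝓡 m) a').symm y) ∈ (extChartAt (𝓡 n) b).source →
      φ ((extChartAt (𝓡 m) a).symm (ψ y)) ∈ (extChartAt (𝓡 n) b).source := by
    intro y _ h2 h3
    rwa [extChartAt_symm_chartTransition h2]
  have hf : chartMap (n := n) a' b φ =ᶠ[𝓝 u] chartMap a b φ ∘ ψ := by
    filter_upwards [eventually_mem_chart hu ha] with y hy
    simp only [chartMap, Function.comp, hψ, extChartAt_symm_chartTransition hy.2]
  have hω : chartPForm g h p a' b φ =ᶠ[𝓝 u]
      fun x => (chartPForm g h p a b φ (ψ x)).comp (fderiv ℝ ψ x) := by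
    filter_upwards [hf.eventuallyEq_nhds, eventually_mem_chart hu ha,
      eventually_chartMap_mem hφ.continuous hu hb] with y hy hy2 hy3
    have h1 := key y hy2.1 hy2.2 hy3.2
    rw [chartPForm, chartPForm, hy.fderiv_eq, fderiv_comp y
      ((contDiffAt_chartMap hφ (chartTransition_mem hy2.2) h1).differentiableAt (by simp))
      ((contDiffAt_chartTransition hy2.1 hy2.2).differentiableAt (by simp)),
      extChartAt_symm_chartTransition hy2.2]
    rfl
  have hm := chartTransition_mem (m := m) ha
  have hb' := key u hu ha hb
  have hcov := coordCov_comp_source (H := chartMetric h b)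
    ((contDiffAt_chartTransition hu ha).of_le ENat.LEInfty.out)
    ((contDiffAt_chartMetric g hm).differentiableAt (by simp))
    (isInnerForm_chartMetric g hm) (bijective_fderiv_chartTransition hu ha)
    ((contDiffAt_chartMap hφ hm hb').differentiableAt (by simp))
    (differentiableAt_chartPForm g h hp hφ hm hb') (chartMetric_eventuallyEq g hu ha) hf hω
  have h2 : chartPTension g h p a' b φ u = metricTrace (chartMetric g a' u)
    (coordCov (chartMetric g a') (chartMetric h b) (chartMap a' b φ)
      (chartPForm g h p a' b φ) u) := rfl
  have h3 : coordCov (chartMetric g a') (chartMetric h b) (chartMap a' b φ)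
      (chartPForm g h p a' b φ) u = fun v w => coordCov (chartMetric g a) (chartMetric h b)
        (chartMap a b φ) (chartPForm g h p a b φ) (ψ u) (fderiv ℝ ψ u v) (fderiv ℝ ψ u w) := by
    funext v w
    exact hcov v w
  rw [h2, h3, chartMetric_eq_pullMetric g hu ha, pullMetric]
  exact metricTrace_coordCov_comp (isInnerForm_chartMetric g hm)
    (isInnerForm_chartMetric h ((extChartAt (𝓡 n) b).map_source hb')) _
    (bijective_fderiv_chartTransition hu ha).1

/-- The `p`-tension field in different charts of the target. -/
theorem chartPTension_target (g : SmoothMetric m M) (h : SmoothMetric n N) {p : ℝ} (hp : 2 ≤ p)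
    {φ : M → N} (hφ : ContMDiff (𝓡 m) (𝓡 n) ∞ φ) {a : M} {b b' : N}
    {u : Coord m} (hu : u ∈ (extChartAt (𝓡 m) a).target)
    (hb : φ ((extChartAt (𝓡 m) a).symm u) ∈ (extChartAt (𝓡 n) b).source)
    (hb' : φ ((extChartAt (𝓡 m) a).symm u) ∈ (extChartAt (𝓡 n) b').source) :
    chartPTension g h p a b' φ u =
      fderiv ℝ (chartTransition b b') (chartMap a b φ u) (chartPTension g h p a b φ u) := by
  set χ := chartTransition (m := n) b b' with hχ
  have hmem : ∀ {y}, φ ((extChartAt (𝓡 m) a).symm y) ∈ (extChartAt (𝓡 n) b).source →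
      φ ((extChartAt (𝓡 m) a).symm y) ∈ (extChartAt (𝓡 n) b').source →
      (extChartAt (𝓡 n) b).symm (chartMap a b φ y) ∈ (extChartAt (𝓡 n) b').source := by
    intro y h1 h2
    rwa [chartMap, (extChartAt (𝓡 n) b).left_inv h1]
  have hf : chartMap (m := m) a b' φ =ᶠ[𝓝 u] χ ∘ chartMap a b φ := by
    filter_upwards [eventually_chartMap_mem hφ.continuous hu hb] with y hy
    simp only [chartMap, Function.comp, hχ, chartTransition, (extChartAt (𝓡 n) b).left_inv hy.2]
  have hω : chartPForm g h p a b' φ =ᶠ[𝓝 u]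
      fun x => (fderiv ℝ χ (chartMap a b φ x)).comp (chartPForm g h p a b φ x) := by
    filter_upwards [hf.eventuallyEq_nhds, eventually_chartMap_mem hφ.continuous hu hb,
      eventually_chartMap_mem hφ.continuous hu hb'] with y hy hy2 hy3
    rw [chartPForm, chartPForm, hy.fderiv_eq, fderiv_comp y
      ((contDiffAt_chartTransition ((extChartAt (𝓡 n) b).map_source hy2.2)
        (hmem hy2.2 hy3.2)).differentiableAt (by simp))
      ((contDiffAt_chartMap hφ hy2.1 hy2.2).differentiableAt (by simp))]
    ext1 v
    simp [hχ]
  have hm := (extChartAt (𝓡 n) b).map_source hb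
  have hm' : (extChartAt (𝓡 n) b).symm (chartMap a b φ u) ∈ (extChartAt (𝓡 n) b').source :=
    hmem hb hb'
  have hcov := coordCov_comp_target (G := chartMetric g a)
    ((contDiffAt_chartTransition hm hm').of_le ENat.LEInfty.out)
    ((contDiffAt_chartMetric h (chartTransition_mem hm')).differentiableAt (by simp))
    (isInnerForm_chartMetric h (chartTransition_mem hm')) (bijective_fderiv_chartTransition hm hm')
    ((contDiffAt_chartMap hφ hu hb).differentiableAt (by simp))
    (differentiableAt_chartPForm g h hp hφ hu hb) (chartMetric_eventuallyEq h hm hm') hf hω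
  have h2 : ∀ c, chartPTension g h p a c φ u = metricTrace (chartMetric g a u)
    (coordCov (chartMetric g a) (chartMetric h c) (chartMap a c φ)
      (chartPForm g h p a c φ) u) := fun _ => rfl
  rw [h2 b, h2 b']
  simp only [metricTrace, map_sum, map_smul]
  exact Finset.sum_congr rfl fun i _ => Finset.sum_congr rfl fun j _ => by rw [hcov]

/-- The squared norm of the `p`-tension field in arbitrary charts. -/
theorem pTensionNorm_sq_eq (g : SmoothMetric m M) (h : SmoothMetric n N) {p : ℝ} (hp : 2 ≤ p)
    {φ : M → N} (hφ : ContMDiff (𝓡 m) (𝓡 n) ∞ φ) {a : M} {b : N}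
    {u : Coord m} (hu : u ∈ (extChartAt (𝓡 m) a).target)
    (hb : φ ((extChartAt (𝓡 m) a).symm u) ∈ (extChartAt (𝓡 n) b).source) :
    pTensionNorm g h p φ ((extChartAt (𝓡 m) a).symm u) ^ 2 =
      chartMetric h b (chartMap a b φ u)
        (coordTension (chartMetric g a) (chartMetric h b) p (chartMap a b φ) u)
        (coordTension (chartMetric g a) (chartMetric h b) p (chartMap a b φ) u) := by
  set x := (extChartAt (𝓡 m) a).symm u with hx
  have hxa : x ∈ (extChartAt (𝓡 m) a).source := (extChartAt (𝓡 m) a).map_target hu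
  have hxx : (extChartAt (𝓡 m) x).symm (extChartAt (𝓡 m) x x) = x := extChartAt_to_inv x
  have hmx : extChartAt (𝓡 m) x x ∈ (extChartAt (𝓡 m) x).target := mem_extChartAt_target x
  have htr : chartTransition (m := m) x a (extChartAt (𝓡 m) x x) = u := by
    rw [chartTransition, hxx, hx, (extChartAt (𝓡 m) a).right_inv hu]
  rw [← chartPTension_eq_coordTension g h p hφ hu hb]
  -- The norm is defined in the charts centred at x and φ x, which move with x. Change the source
  -- chart to a, then the target chart to b; the second change is an isometry from the metric of
  -- chart b to that of the fibre.
  have h1 := chartPTension_source g h hp hφ (a := a) (b := b) hmx (by rwa [hxx]) (by rwa [hxx])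
  rw [htr] at h1
  have hc : chartMap (m := m) (n := n) a b φ u = chartMap x b φ (extChartAt (𝓡 m) x x) := by
    rw [chartMap, chartMap, hxx]
  rw [hc, ← h1]
  set T := chartPTension g h p x b φ (extChartAt (𝓡 m) x x) with hT
  have h2 := chartPTension_target g h hp hφ (b := b) (b' := φ x) hmx (by rwa [hxx])
    (by rw [hxx]; exact mem_extChartAt_source _)
  rw [← hT] at h2
  have hy : (extChartAt (𝓡 n) b).symm (chartMap x b φ (extChartAt (𝓡 m) x x)) = φ x := by
    rw [chartMap, hxx, (extChartAt (𝓡 n) b).left_inv hb]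
  have hm : chartMap x b φ (extChartAt (𝓡 m) x x) ∈ (extChartAt (𝓡 n) b).target := by
    rw [chartMap, hxx]; exact (extChartAt (𝓡 n) b).map_source hb
  have e1 : pTensionNorm g h p φ x = Real.sqrt (metricForm h (φ x)
      (chartPTension g h p x (φ x) φ (extChartAt (𝓡 m) x x))
      (chartPTension g h p x (φ x) φ (extChartAt (𝓡 m) x x))) := rfl
  rw [e1, Real.sq_sqrt ((isInnerForm_metricForm h _).nonneg _), h2,
    chartMetric_eq_pullMetric h (a := φ x) hm (by rw [hy]; exact mem_extChartAt_source _),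
    pullMetric]
  have hz : chartTransition b (φ x) (chartMap x b φ (extChartAt (𝓡 m) x x)) =
      extChartAt (𝓡 n) (φ x) (φ x) := by
    rw [chartTransition, hy]
  rw [hz, chartMetric_self]
  rfl

end ChartMaps

end

noncomputable section

/-! ### Orders of magnitude of functions together with their derivatives. -/

section Orders

open Filter Topology Asymptotics

variable {Z : Type*} [NormedAddCommGroup Z] [NormedSpace ℝ Z]
  {V W : Type*} [NormedAddCommGroup V] [NormedSpace ℝ V] [NormedAddCommGroup W] [NormedSpace ℝ W]
  {z₀ : Z} {w w' w₁ w₁' w₂ w₂' : Z → ℝ}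

/-- Near `z₀`, the function `X` is differentiable, `X = O(w)` and `DX = O(w')`. -/
structure HasOrder (z₀ : Z) (X : Z → W) (w w' : Z → ℝ) : Prop where
  diff : ∀ᶠ z in 𝓝 z₀, DifferentiableAt ℝ X z
  val : X =O[𝓝 z₀] w
  der : fderiv ℝ X =O[𝓝 z₀] w'

theorem HasOrder.mono {X : Z → W} (h : HasOrder z₀ X w₁ w₁') (hw : w₁ =O[𝓝 z₀] w)
    (hw' : w₁' =O[𝓝 z₀] w') : HasOrder z₀ X w w' :=
  ⟨h.diff, h.val.trans hw, h.der.trans hw'⟩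

theorem HasOrder.congr {X Y : Z → W} (h : HasOrder z₀ X w w') (hXY : Y =ᶠ[𝓝 z₀] X) :
    HasOrder z₀ Y w w' := by
  refine ⟨?_, h.val.congr' hXY.symm EventuallyEq.rfl, h.der.congr' ?_ EventuallyEq.rfl⟩
  · filter_upwards [h.diff, hXY.eventuallyEq_nhds] with z h1 h2
    exact h1.congr_of_eventuallyEq h2
  · filter_upwards [hXY.eventuallyEq_nhds] with z h2
    exact h2.fderiv_eq.symm

theorem ContDiffAt.hasOrder_one {X : Z → W} (h : ContDiffAt ℝ ∞ X z₀) :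
    HasOrder z₀ X (fun _ => 1) (fun _ => 1) := by
  refine ⟨?_, h.continuousAt.isBigO_one ℝ, h.fderiv_infty.continuousAt.isBigO_one ℝ⟩
  filter_upwards [(h.of_le (m := 1) ENat.LEInfty.out).eventually (by simp)] with z hz
  exact hz.differentiableAt (by simp)

theorem HasOrder.add {X Y : Z → W} (hX : HasOrder z₀ X w w') (hY : HasOrder z₀ Y w w') :
    HasOrder z₀ (fun z => X z + Y z) w w' := by
  refine ⟨?_, hX.val.add hY.val, (hX.der.add hY.der).congr' ?_ EventuallyEq.rfl⟩
  · filter_upwards [hX.diff, hY.diff] with z h1 h2 using h1.add h2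
  · filter_upwards [hX.diff, hY.diff] with z h1 h2 using (fderiv_fun_add h1 h2).symm

theorem HasOrder.sum {ι : Type*} (s : Finset ι) {X : ι → Z → W}
    (hX : ∀ i ∈ s, HasOrder z₀ (X i) w w') : HasOrder z₀ (fun z => ∑ i ∈ s, X i z) w w' := by
  classical
  induction s using Finset.induction_on with
  | empty =>
    refine ⟨Eventually.of_forall fun z => by simp, by simpa using isBigO_zero w _, ?_⟩
    simp only [Finset.sum_empty, fderiv_fun_const]
    exact isBigO_zero w' (𝓝 z₀)
  | insert a s ha ih =>
    simp only [Finset.sum_insert ha]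
    exact (hX a (Finset.mem_insert_self _ _)).add
      (ih fun i hi => hX i (Finset.mem_insert_of_mem hi))

theorem HasOrder.clm_apply {L : Z → V →L[ℝ] W} {X : Z → V} (hL : HasOrder z₀ L w₁ w₁')
    (hX : HasOrder z₀ X w₂ w₂') :
    HasOrder z₀ (fun z => L z (X z)) (fun z => w₁ z * w₂ z)
      (fun z => ‖w₁' z‖ * ‖w₂ z‖ + ‖w₁ z‖ * ‖w₂' z‖) := by
  have key : ∀ (a b : Z → ℝ), (fun z => ‖a z‖ * ‖b z‖) =O[𝓝 z₀] fun z => ‖a z‖ * ‖b z‖ :=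
    fun a b => isBigO_refl _ _
  refine ⟨?_, ?_, ?_⟩
  · filter_upwards [hL.diff, hX.diff] with z h1 h2 using h1.clm_apply h2
  · refine IsBigO.trans ?_ (hL.val.norm_left.mul hX.val.norm_left)
    exact IsBigO.of_bound 1 (Eventually.of_forall fun z => by
      simpa using (L z).le_opNorm (X z))
  · have h1 := (hL.der.norm_norm.mul hX.val.norm_norm)
    have h2 := (hL.val.norm_norm.mul hX.der.norm_norm)
    have h3 : (fun z => ‖w₁' z‖ * ‖w₂ z‖) =O[𝓝 z₀]
        fun z => ‖w₁' z‖ * ‖w₂ z‖ + ‖w₁ z‖ * ‖w₂' z‖ :=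
      IsBigO.of_bound 1 (Eventually.of_forall fun z => by
        have a1 : 0 ≤ ‖w₁' z‖ * ‖w₂ z‖ := by positivity
        have a2 : 0 ≤ ‖w₁ z‖ * ‖w₂' z‖ := by positivity
        rw [one_mul, Real.norm_of_nonneg a1, Real.norm_of_nonneg (add_nonneg a1 a2)]
        exact le_add_of_nonneg_right a2)
    have h4 : (fun z => ‖w₁ z‖ * ‖w₂' z‖) =O[𝓝 z₀]
        fun z => ‖w₁' z‖ * ‖w₂ z‖ + ‖w₁ z‖ * ‖w₂' z‖ :=
      IsBigO.of_bound 1 (Eventually.of_forall fun z => by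
        have a1 : 0 ≤ ‖w₁' z‖ * ‖w₂ z‖ := by positivity
        have a2 : 0 ≤ ‖w₁ z‖ * ‖w₂' z‖ := by positivity
        rw [one_mul, Real.norm_of_nonneg a2, Real.norm_of_nonneg (add_nonneg a1 a2)]
        exact le_add_of_nonneg_left a1)
    refine IsBigO.trans ?_ ((h1.trans h3).add (h2.trans h4))
    refine IsBigO.of_bound 1 ?_
    filter_upwards [hL.diff, hX.diff] with z hd1 hd2
    rw [fderiv_clm_apply hd1 hd2, one_mul, Real.norm_of_nonneg (by positivity)]
    refine (norm_add_le _ _).trans ?_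
    rw [add_comm]
    refine add_le_add ?_ (ContinuousLinearMap.opNorm_comp_le _ _)
    exact ((fderiv ℝ L z).flip.le_opNorm (X z)).trans (by rw [ContinuousLinearMap.opNorm_flip])

theorem HasOrder.smul {c : Z → ℝ} {X : Z → W} (hc : HasOrder z₀ c w₁ w₁')
    (hX : HasOrder z₀ X w₂ w₂') :
    HasOrder z₀ (fun z => c z • X z) (fun z => w₁ z * w₂ z)
      (fun z => ‖w₁' z‖ * ‖w₂ z‖ + ‖w₁ z‖ * ‖w₂' z‖) := by
  have hL : HasOrder z₀ (fun z => ContinuousLinearMap.lsmul ℝ ℝ (c z) : Z → W →L[ℝ] W) w₁ w₁' := by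
    have hb : ∀ x : ℝ, ‖(ContinuousLinearMap.lsmul ℝ ℝ x : W →L[ℝ] W)‖ ≤ 1 * ‖x‖ := fun x => by
      refine ContinuousLinearMap.opNorm_le_bound _ (by positivity) fun v => ?_
      simp [norm_smul]
    refine ⟨?_, (IsBigO.of_bound 1 (Eventually.of_forall fun z => hb _)).trans hc.val, ?_⟩
    · filter_upwards [hc.diff] with z hz
      exact (ContinuousLinearMap.lsmul ℝ ℝ : ℝ →L[ℝ] W →L[ℝ] W).differentiableAt.comp z hz
    · refine (IsBigO.of_bound ‖(ContinuousLinearMap.lsmul ℝ ℝ : ℝ →L[ℝ] W →L[ℝ] W)‖ ?_).trans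
        hc.der
      filter_upwards [hc.diff] with z hz
      have : HasFDerivAt (fun z => (ContinuousLinearMap.lsmul ℝ ℝ (c z) : W →L[ℝ] W)) _ z :=
        (ContinuousLinearMap.lsmul ℝ ℝ : ℝ →L[ℝ] W →L[ℝ] W).hasFDerivAt.comp z hz.hasFDerivAt
      rw [this.fderiv]
      exact ContinuousLinearMap.opNorm_comp_le _ _
  exact hL.clm_apply hX

end Orders

/-! ### Smooth families of maps and the splitting of the p-tension field. -/

section Families

open Filter Topology Asymptotics

variable {m n : ℕ}

/-- Near `z₀`, the map `f` is a smooth family of maps between coordinate domains with smooth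
metrics `G` and `H`. -/
structure IsSmoothFamily (G : Coord m → Bilin m) (H : Coord n → Bilin n)
    (f : ℝ × Coord m → Coord n) (z₀ : ℝ × Coord m) : Prop where
  map : ∀ᶠ z in 𝓝 z₀, ContDiffAt ℝ ∞ f z
  source : ∀ᶠ u in 𝓝 z₀.2, ContDiffAt ℝ ∞ G u ∧ IsInnerForm (G u)
  target : ∀ᶠ y in 𝓝 (f z₀), ContDiffAt ℝ ∞ H y ∧ IsInnerForm (H y)

/-- The differential of a family of maps in the space directions. -/
def spaceDeriv {W : Type*} [NormedAddCommGroup W] [NormedSpace ℝ W] (f : ℝ × Coord m → W)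
    (z : ℝ × Coord m) : Coord m →L[ℝ] W :=
  (fderiv ℝ f z).comp (ContinuousLinearMap.inr ℝ ℝ (Coord m))

/-- The energy density of a family of maps. -/
def familyDensity (G : Coord m → Bilin m) (H : Coord n → Bilin n) (f : ℝ × Coord m → Coord n)
    (z : ℝ × Coord m) : ℝ :=
  metricTrace (G z.2) fun v w => H (f z) (spaceDeriv f z v) (spaceDeriv f z w)

/-- The tension field of a family of maps. -/
def familyTension (G : Coord m → Bilin m) (H : Coord n → Bilin n) (f : ℝ × Coord m → Coord n)
    (z : ℝ × Coord m) : Coord n :=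
  metricTrace (G z.2) fun v w => spaceDeriv (spaceDeriv f) z v w
    - spaceDeriv f z (coordChristoffel G z.2 v w)
    + coordChristoffel H (f z) (spaceDeriv f z v) (spaceDeriv f z w)

/-- The image of the gradient of the energy density under the differential. -/
def familyGradient (G : Coord m → Bilin m) (H : Coord n → Bilin n) (f : ℝ × Coord m → Coord n)
    (z : ℝ × Coord m) : Coord n :=
  metricTrace (G z.2) fun v w => spaceDeriv (familyDensity G H f) z v • spaceDeriv f z w

theorem fderiv_slice {W : Type*} [NormedAddCommGroup W] [NormedSpace ℝ W] {f : ℝ × Coord m → W}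
    {z : ℝ × Coord m} (hf : DifferentiableAt ℝ f z) :
    fderiv ℝ (fun u => f (z.1, u)) z.2 = spaceDeriv f z := by
  have h1 : HasFDerivAt (fun u : Coord m => (z.1, u)) (ContinuousLinearMap.inr ℝ ℝ (Coord m)) z.2 :=
    hasFDerivAt_prodMk_right _ _
  exact (HasFDerivAt.comp z.2 (f := fun u : Coord m => (z.1, u)) hf.hasFDerivAt h1).fderiv

theorem ContDiffAt.spaceDeriv {W : Type*} [NormedAddCommGroup W] [NormedSpace ℝ W]
    {f : ℝ × Coord m → W} {z : ℝ × Coord m} (hf : ContDiffAt ℝ ∞ f z) :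
    ContDiffAt ℝ ∞ (spaceDeriv f) z :=
  hf.fderiv_infty.clm_comp contDiffAt_const

variable {G : Coord m → Bilin m} {H : Coord n → Bilin n} {f : ℝ × Coord m → Coord n}
  {z : ℝ × Coord m}

theorem IsSmoothFamily.eventually (h : IsSmoothFamily G H f z) :
    ∀ᶠ y in 𝓝 z, IsSmoothFamily G H f y := by
  filter_upwards [h.map.eventually_nhds, continuousAt_snd.eventually h.source.eventually_nhds,
    h.map.self_of_nhds.continuousAt.eventually h.target.eventually_nhds] with y h1 h2 h3
  exact ⟨h1, h2, h3⟩

theorem tendsto_slice (z : ℝ × Coord m) : Tendsto (fun u : Coord m => (z.1, u)) (𝓝 z.2) (𝓝 z) :=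
  (Continuous.prodMk_right z.1).tendsto z.2

theorem fderiv_slice_eventuallyEq (h : ∀ᶠ y in 𝓝 z, ContDiffAt ℝ ∞ f y) :
    fderiv ℝ (fun u => f (z.1, u)) =ᶠ[𝓝 z.2] fun u => spaceDeriv f (z.1, u) := by
  filter_upwards [(tendsto_slice z).eventually h] with u hu
  exact fderiv_slice (z := (z.1, u)) (hu.differentiableAt (by simp))

theorem coordDensity_slice (h : ContDiffAt ℝ ∞ f z) :
    coordDensity G H (fun u => f (z.1, u)) z.2 = familyDensity G H f z := by
  simp only [coordDensity, fderiv_slice (h.differentiableAt (by simp)), familyDensity]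

theorem contDiffAt_coordChristoffel {X : Type*} [NormedAddCommGroup X] [NormedSpace ℝ X]
    {y a b : X → Coord m} {x : X} (hG : ContDiffAt ℝ ∞ G (y x)) (hI : IsInnerForm (G (y x)))
    (hy : ContDiffAt ℝ ∞ y x) (ha : ContDiffAt ℝ ∞ a x) (hb : ContDiffAt ℝ ∞ b x) :
    ContDiffAt ℝ ∞ (fun x => coordChristoffel G (y x) (a x) (b x)) x := by
  have h1 : ContDiffAt ℝ ∞ (fun x => fderiv ℝ G (y x)) x := hG.fderiv_infty.comp x hy
  have hc : ∀ e : Coord m, ContDiffAt ℝ ∞ (fun _ : X => e) x := fun e => contDiffAt_const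
  exact ContDiffAt.sum fun k _ => ContDiffAt.sum fun l _ =>
    ((ContDiffAt.gramMatrix_inv (G := fun x => G (y x)) (hG.comp x hy) hI k l).mul
      (contDiffAt_const.mul
      (((((h1.clm_apply ha).clm_apply hb).clm_apply (hc _)).add
        (((h1.clm_apply hb).clm_apply ha).clm_apply (hc _))).sub
        (((h1.clm_apply (hc _)).clm_apply ha).clm_apply hb)))).smul contDiffAt_const

namespace IsSmoothFamily

variable (h : IsSmoothFamily G H f z)

include h

theorem contDiffAt_source : ContDiffAt ℝ ∞ (fun z : ℝ × Coord m => G z.2) z :=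
  h.source.self_of_nhds.1.comp z contDiffAt_snd

theorem contDiffAt_target : ContDiffAt ℝ ∞ (fun z => H (f z)) z :=
  h.target.self_of_nhds.1.comp z h.map.self_of_nhds

theorem contDiffAt_familyDensity : ContDiffAt ℝ ∞ (familyDensity G H f) z :=
  h.contDiffAt_source.metricTrace h.source.self_of_nhds.2 fun _ _ =>
    (h.contDiffAt_target.clm_apply (h.map.self_of_nhds.spaceDeriv.clm_apply
      contDiffAt_const)).clm_apply (h.map.self_of_nhds.spaceDeriv.clm_apply contDiffAt_const)

theorem contDiffAt_familyTension : ContDiffAt ℝ ∞ (familyTension G H f) z := by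
  have hA := h.map.self_of_nhds.spaceDeriv
  refine h.contDiffAt_source.metricTrace h.source.self_of_nhds.2 fun v w => ?_
  refine (((hA.spaceDeriv.clm_apply contDiffAt_const).clm_apply contDiffAt_const).sub
    (hA.clm_apply ?_)).add ?_
  · exact contDiffAt_coordChristoffel h.source.self_of_nhds.1 h.source.self_of_nhds.2
      contDiffAt_snd contDiffAt_const contDiffAt_const
  · exact contDiffAt_coordChristoffel h.target.self_of_nhds.1 h.target.self_of_nhds.2
      h.map.self_of_nhds (hA.clm_apply contDiffAt_const) (hA.clm_apply contDiffAt_const)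

theorem contDiffAt_familyGradient : ContDiffAt ℝ ∞ (familyGradient G H f) z :=
  h.contDiffAt_source.metricTrace h.source.self_of_nhds.2 fun _ _ =>
    (h.contDiffAt_familyDensity.spaceDeriv.clm_apply contDiffAt_const).smul
      (h.map.self_of_nhds.spaceDeriv.clm_apply contDiffAt_const)

theorem familyDensity_nonneg : 0 ≤ familyDensity G H f z :=
  (metricTrace_inner_nonneg_and_eq_zero h.source.self_of_nhds.2 h.target.self_of_nhds.2 _).1

theorem spaceDeriv_eq_zero (h0 : familyDensity G H f z = 0) : spaceDeriv f z = 0 :=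
  (metricTrace_inner_nonneg_and_eq_zero h.source.self_of_nhds.2 h.target.self_of_nhds.2 _).2 h0

/-- The `p`-tension field in terms of the tension field and the gradient of the energy density. -/
theorem coordTension_eq {p : ℝ} (hp : 2 ≤ p) :
    coordTension G H p (fun u => f (z.1, u)) z.2 =
      familyDensity G H f z ^ ((p - 2) / 2) • familyTension G H f z +
        ((p - 2) / 2 * familyDensity G H f z ^ ((p - 2) / 2 - 1)) • familyGradient G H f z := by
  have hf := h.map.self_of_nhds
  have hslice : ContDiffAt ℝ ∞ (fun u => f (z.1, u)) z.2 :=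
    ContDiffAt.comp z.2 (f := fun u : Coord m => (z.1, u)) hf
      (contDiffAt_const.prodMk contDiffAt_id)
  have hI : ∀ᶠ y in 𝓝 z.2, IsInnerForm (G y) := h.source.mono fun _ h => h.2
  have hJ : ∀ᶠ y in 𝓝 (f z), IsInnerForm (H y) := h.target.mono fun _ h => h.2
  have hσ := (hasFDerivAt_coordPForm (f := fun u => f (z.1, u)) hp h.source.self_of_nhds.1
    h.target.self_of_nhds.1 hslice hI hJ).fderiv
  have e1 : fderiv ℝ (fderiv ℝ (fun u => f (z.1, u))) z.2 = spaceDeriv (spaceDeriv f) z := by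
    rw [(fderiv_slice_eventuallyEq h.map).fderiv_eq]
    exact fderiv_slice (hf.spaceDeriv.differentiableAt (by simp))
  have e2 : fderiv ℝ (coordDensity G H (fun u => f (z.1, u))) z.2 =
      spaceDeriv (familyDensity G H f) z := by
    have : coordDensity G H (fun u => f (z.1, u)) =ᶠ[𝓝 z.2]
        fun u => familyDensity G H f (z.1, u) := by
      filter_upwards [(tendsto_slice z).eventually h.map] with u hu
      exact coordDensity_slice (z := (z.1, u)) hu
    rw [this.fderiv_eq]
    exact fderiv_slice (h.contDiffAt_familyDensity.differentiableAt (by simp))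
  have e3 := fderiv_slice (hf.differentiableAt (by simp))
  rw [e1, e2, coordDensity_slice hf, e3] at hσ
  have e4 : coordPForm G H p (fun u => f (z.1, u)) z.2 =
      familyDensity G H f z ^ ((p - 2) / 2) • spaceDeriv f z := by
    rw [coordPForm_eq_rpow (f := fun u => f (z.1, u)) p hI.self_of_nhds hJ.self_of_nhds,
      coordDensity_slice hf, e3]
  rw [coordTension, familyTension, familyGradient]
  simp only [metricTrace, coordCov, hσ, e3, e4, Finset.smul_sum, ← Finset.sum_add_distrib]
  refine Finset.sum_congr rfl fun i _ => Finset.sum_congr rfl fun j _ => ?_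
  simp only [add_apply, smul_apply, ContinuousLinearMap.smulRight_apply,
    coordChristoffel_smul_right hJ.self_of_nhds]
  module

end IsSmoothFamily

end Families

end

noncomputable section

/-! ### Orders of products with a bounded factor. -/

section OrderCalculus

open Filter Topology Asymptotics

variable {Z : Type*} [NormedAddCommGroup Z] [NormedSpace ℝ Z]
  {V W : Type*} [NormedAddCommGroup V] [NormedSpace ℝ V] [NormedAddCommGroup W] [NormedSpace ℝ W]
  {z₀ : Z} {w w' w₁ w₁' w₂ w₂' : Z → ℝ}

theorem HasOrder.one_clm_apply {L : Z → V →L[ℝ] W} {X : Z → V}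
    (hL : HasOrder z₀ L (fun _ => 1) (fun _ => 1)) (hX : HasOrder z₀ X w w')
    (hw : w =O[𝓝 z₀] w') : HasOrder z₀ (fun z => L z (X z)) w w' := by
  refine (hL.clm_apply hX).mono (by simpa using isBigO_refl w _) ?_
  simpa using hw.norm_left.add (isBigO_refl w' _).norm_left

theorem HasOrder.clm_apply_one {L : Z → V →L[ℝ] W} {X : Z → V}
    (hL : HasOrder z₀ L w w') (hX : HasOrder z₀ X (fun _ => 1) (fun _ => 1))
    (hw : w =O[𝓝 z₀] w') : HasOrder z₀ (fun z => L z (X z)) w w' := by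
  refine (hL.clm_apply hX).mono (by simpa using isBigO_refl w _) ?_
  simpa using (isBigO_refl w' _).norm_left.add hw.norm_left

theorem HasOrder.one_smul {c : Z → ℝ} {X : Z → W}
    (hc : HasOrder z₀ c (fun _ => 1) (fun _ => 1)) (hX : HasOrder z₀ X w w')
    (hw : w =O[𝓝 z₀] w') : HasOrder z₀ (fun z => c z • X z) w w' := by
  refine (hc.smul hX).mono (by simpa using isBigO_refl w _) ?_
  simpa using hw.norm_left.add (isBigO_refl w' _).norm_left

end OrderCalculus

/-! ### Orders of the density, tension field and gradient term in R = |df| and J = |df| + |D²f|. -/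

namespace IsSmoothFamily

open Filter Topology Asymptotics

variable {m n : ℕ} {G : Coord m → Bilin m} {H : Coord n → Bilin n} {f : ℝ × Coord m → Coord n}
  {z₀ : ℝ × Coord m}

/-- Near a point, the energy density controls the differential. -/
theorem exists_sq_le_familyDensity (h : IsSmoothFamily G H f z₀) :
    ∃ c > 0, ∀ᶠ z in 𝓝 z₀, c * ‖spaceDeriv f z‖ ^ 2 ≤ familyDensity G H f z := by
  let q : (ℝ × Coord m) → (Coord m →L[ℝ] Coord n) → ℝ := fun z B =>
    metricTrace (G z.2) fun v w => H (f z) (B v) (B w)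
  have hsmul : ∀ z (r : ℝ) B, q z (r • B) = r ^ 2 * q z B := by
    intro z r B
    simp only [q, metricTrace, smul_apply, map_smul, smul_eq_mul, Finset.mul_sum]
    exact Finset.sum_congr rfl fun i _ => Finset.sum_congr rfl fun j _ => by ring
  have hcont : ∀ B, ContDiffAt ℝ ∞
      (fun y : (ℝ × Coord m) × (Coord m →L[ℝ] Coord n) => q y.1 y.2) (z₀, B) := by
    intro B
    have h1 : ContDiffAt ℝ ∞ (fun y : (ℝ × Coord m) × (Coord m →L[ℝ] Coord n) => G y.1.2)
        (z₀, B) := h.source.self_of_nhds.1.comp (z₀, B) (contDiffAt_snd.comp _ contDiffAt_fst)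
    have h2 : ContDiffAt ℝ ∞ (fun y : (ℝ × Coord m) × (Coord m →L[ℝ] Coord n) => H (f y.1))
        (z₀, B) := ContDiffAt.comp (z₀, B) (g := fun z => H (f z))
          (f := Prod.fst) h.contDiffAt_target contDiffAt_fst
    exact h1.metricTrace h.source.self_of_nhds.2 fun v w =>
      (h2.clm_apply (contDiffAt_snd.clm_apply contDiffAt_const)).clm_apply
        (contDiffAt_snd.clm_apply contDiffAt_const)
  -- By homogeneity only unit linear maps matter. On their compact sphere q z₀ has a positive
  -- minimum, and half of it remains a lower bound for all z near z₀.
  have hK : IsCompact (Metric.sphere (0 : Coord m →L[ℝ] Coord n) 1) := isCompact_sphere _ _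
  obtain ⟨c, hc, hmin⟩ : ∃ c > 0, ∀ B ∈ Metric.sphere (0 : Coord m →L[ℝ] Coord n) 1,
      c < q z₀ B := by
    rcases (Metric.sphere (0 : Coord m →L[ℝ] Coord n) 1).eq_empty_or_nonempty with he | hne
    · exact ⟨1, one_pos, by simp [he]⟩
    · obtain ⟨B₀, hB₀, hm⟩ := hK.exists_isMinOn hne (f := q z₀) (fun B _ =>
        (ContinuousAt.comp (f := fun B => (z₀, B)) (x := B) (hcont B).continuousAt
          (by fun_prop)).continuousWithinAt)
      have hpos : 0 < q z₀ B₀ := by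
        have hp := metricTrace_inner_nonneg_and_eq_zero h.source.self_of_nhds.2
          h.target.self_of_nhds.2 B₀
        refine lt_of_le_of_ne hp.1 fun h0 => ?_
        have := hp.2 h0.symm
        simp [this] at hB₀
      exact ⟨q z₀ B₀ / 2, by positivity, fun B hB => by
        have : q z₀ B₀ ≤ q z₀ B := hm hB
        linarith⟩
  refine ⟨c, hc, ?_⟩
  filter_upwards [hK.eventually_forall_of_forall_eventually (x₀ := z₀) (P := fun z B => c < q z B)
    fun B hB => (hcont B).continuousAt.eventually (lt_mem_nhds (hmin B hB))] with z hz
  by_cases h0 : spaceDeriv f z = 0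
  · have : familyDensity G H f z = 0 := by
      simp [familyDensity, metricTrace, h0]
    simp [h0, this]
  · have hne : ‖spaceDeriv f z‖ ≠ 0 := by simpa using h0
    have h1 := hz (‖spaceDeriv f z‖⁻¹ • spaceDeriv f z) (by simp [norm_smul, hne])
    rw [hsmul] at h1
    have h2 : familyDensity G H f z = q z (spaceDeriv f z) := rfl
    rw [h2]
    have h3 : 0 < ‖spaceDeriv f z‖ := (norm_nonneg _).lt_of_ne' hne
    rw [inv_pow, inv_mul_eq_div, lt_div_iff₀ (by positivity)] at h1
    exact h1.le

/-- The norm of the differential in a family of maps. -/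
def root (G : Coord m → Bilin m) (H : Coord n → Bilin n) (f : ℝ × Coord m → Coord n)
    (z : ℝ × Coord m) : ℝ := Real.sqrt (familyDensity G H f z)

/-- The size of the first and second space derivatives in a family of maps. -/
def jetSize (G : Coord m → Bilin m) (H : Coord n → Bilin n) (f : ℝ × Coord m → Coord n)
    (z : ℝ × Coord m) : ℝ := root G H f z + ‖spaceDeriv (spaceDeriv f) z‖

theorem root_nonneg (z : ℝ × Coord m) : 0 ≤ root G H f z := Real.sqrt_nonneg _

theorem jetSize_nonneg (z : ℝ × Coord m) : 0 ≤ jetSize G H f z :=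
  add_nonneg (root_nonneg z) (norm_nonneg _)

theorem root_le_jetSize (z : ℝ × Coord m) : root G H f z ≤ jetSize G H f z :=
  le_add_of_nonneg_right (norm_nonneg _)

theorem root_isBigO_jetSize : root G H f =O[𝓝 z₀] jetSize G H f :=
  IsBigO.of_bound 1 (Eventually.of_forall fun z => by
    rw [Real.norm_of_nonneg (root_nonneg z), Real.norm_of_nonneg (jetSize_nonneg z), one_mul]
    exact root_le_jetSize z)

theorem _root_.HasOrder.smul_inner {c : ℝ × Coord m → ℝ} {B : ℝ × Coord m → Bilin n}
    {x y : ℝ × Coord m → Coord n} {w₁ w₁' w₂ w₂' w w' : ℝ × Coord m → ℝ}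
    (hc : ContDiffAt ℝ ∞ c z₀) (hB : ContDiffAt ℝ ∞ B z₀) (hx : HasOrder z₀ x w₁ w₁')
    (hy : HasOrder z₀ y w₂ w₂') (h₁ : w₁ =O[𝓝 z₀] w₁')
    (hw : (fun z => w₁ z * w₂ z) =O[𝓝 z₀] w)
    (hw' : (fun z => ‖w₁' z‖ * ‖w₂ z‖ + ‖w₁ z‖ * ‖w₂' z‖) =O[𝓝 z₀] w') (hww : w =O[𝓝 z₀] w') :
    HasOrder z₀ (fun z => c z • B z (x z) (y z)) w w' :=
  hc.hasOrder_one.one_smul (((hB.hasOrder_one.one_clm_apply hx h₁).clm_apply hy).mono hw hw') hww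

variable (h : IsSmoothFamily G H f z₀)

include h

theorem root_isBigO_one : root G H f =O[𝓝 z₀] (fun _ => (1 : ℝ)) :=
  h.contDiffAt_familyDensity.continuousAt.sqrt.isBigO_one ℝ

theorem jetSize_isBigO_one : jetSize G H f =O[𝓝 z₀] (fun _ => (1 : ℝ)) :=
  h.root_isBigO_one.add
    (h.map.self_of_nhds.spaceDeriv.spaceDeriv.continuousAt.norm.isBigO_one ℝ)

theorem spaceDeriv_isBigO_root : spaceDeriv f =O[𝓝 z₀] root G H f := by
  obtain ⟨c, hc, hE⟩ := h.exists_sq_le_familyDensity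
  refine IsBigO.of_bound (Real.sqrt c)⁻¹ ?_
  filter_upwards [hE] with z hz
  rw [Real.norm_of_nonneg (root_nonneg z), inv_mul_eq_div,
    le_div_iff₀ (Real.sqrt_pos.2 hc), root]
  refine Real.le_sqrt_of_sq_le ?_
  rw [mul_pow, Real.sq_sqrt hc.le]
  linarith

theorem hasOrder_spaceDeriv : HasOrder z₀ (spaceDeriv f) (root G H f) (fun _ => 1) :=
  ⟨h.map.self_of_nhds.spaceDeriv.hasOrder_one.diff, h.spaceDeriv_isBigO_root,
    h.map.self_of_nhds.spaceDeriv.hasOrder_one.der⟩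

theorem hasOrder_spaceDeriv_apply (v : Coord m) :
    HasOrder z₀ (fun z => spaceDeriv f z v) (root G H f) (fun _ => 1) :=
  h.hasOrder_spaceDeriv.clm_apply_one contDiffAt_const.hasOrder_one h.root_isBigO_one

theorem hasOrder_spaceDeriv_spaceDeriv :
    HasOrder z₀ (spaceDeriv (spaceDeriv f)) (jetSize G H f) (fun _ => 1) := by
  have h1 := h.map.self_of_nhds.spaceDeriv.spaceDeriv.hasOrder_one
  refine ⟨h1.diff, IsBigO.of_bound 1 (Eventually.of_forall fun z => ?_), h1.der⟩
  rw [Real.norm_of_nonneg (jetSize_nonneg z), one_mul, jetSize]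
  exact le_add_of_nonneg_left (root_nonneg z)

theorem hasOrder_spaceDeriv_spaceDeriv_apply (v w : Coord m) :
    HasOrder z₀ (fun z => spaceDeriv (spaceDeriv f) z v w) (jetSize G H f) (fun _ => 1) :=
  (h.hasOrder_spaceDeriv_spaceDeriv.clm_apply_one contDiffAt_const.hasOrder_one
    h.jetSize_isBigO_one).clm_apply_one contDiffAt_const.hasOrder_one h.jetSize_isBigO_one

theorem hasOrder_gramMatrix_inv (i j : Fin m) :
    HasOrder z₀ (fun z : ℝ × Coord m => (gramMatrix (G z.2))⁻¹ i j) (fun _ => 1) (fun _ => 1) :=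
  (h.contDiffAt_source.gramMatrix_inv h.source.self_of_nhds.2 i j).hasOrder_one

theorem hasOrder_metricTrace {F : Type*} [NormedAddCommGroup F] [NormedSpace ℝ F]
    {w w' : ℝ × Coord m → ℝ} {B : ℝ × Coord m → Coord m → Coord m → F}
    (hw : w =O[𝓝 z₀] w') (hB : ∀ a b, HasOrder z₀ (fun z => B z a b) w w') :
    HasOrder z₀ (fun z => metricTrace (G z.2) (B z)) w w' :=
  HasOrder.sum _ fun i _ => HasOrder.sum _ fun j _ =>
    (h.hasOrder_gramMatrix_inv i j).one_smul (hB _ _) hw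

/-- The tension field is D²f plus terms of first order, hence O(J). The quadratic term Γ^N(df, df)
is O(R) because one of its factors df is bounded. -/
theorem hasOrder_familyTension :
    HasOrder z₀ (familyTension G H f) (jetSize G H f) (fun _ => 1) := by
  have hA := h.map.self_of_nhds.spaceDeriv
  refine h.hasOrder_metricTrace h.jetSize_isBigO_one fun a b => ?_
  have h1 := h.hasOrder_spaceDeriv_spaceDeriv_apply a b
  have h2 : HasOrder z₀ (fun z => (-1 : ℝ) • spaceDeriv f z (coordChristoffel G z.2 a b))
      (jetSize G H f) (fun _ => 1) := by
    refine contDiffAt_const.hasOrder_one.one_smul ?_ h.jetSize_isBigO_one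
    refine (h.hasOrder_spaceDeriv.mono root_isBigO_jetSize (isBigO_refl _ _)).clm_apply_one
      (ContDiffAt.hasOrder_one ?_) h.jetSize_isBigO_one
    exact contDiffAt_coordChristoffel h.source.self_of_nhds.1 h.source.self_of_nhds.2
      contDiffAt_snd contDiffAt_const contDiffAt_const
  have h3 : HasOrder z₀ (fun z => coordChristoffel H (f z) (spaceDeriv f z a) (spaceDeriv f z b))
      (jetSize G H f) (fun _ => 1) := by
    have hs := h.map.self_of_nhds
    have hH := h.target.self_of_nhds
    have hsm : ContDiffAt ℝ ∞
        (fun z => coordChristoffel H (f z) (spaceDeriv f z a) (spaceDeriv f z b)) z₀ :=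
      contDiffAt_coordChristoffel hH.1 hH.2 hs (hA.clm_apply contDiffAt_const)
        (hA.clm_apply contDiffAt_const)
    refine ⟨hsm.hasOrder_one.diff, ?_, hsm.hasOrder_one.der⟩
    -- expand the first argument in the standard basis
    have e : ∀ᶠ z in 𝓝 z₀, coordChristoffel H (f z) (spaceDeriv f z a) (spaceDeriv f z b) =
        ∑ i, (spaceDeriv f z a) i • coordChristoffel H (f z) (stdVec i) (spaceDeriv f z b) := by
      filter_upwards [hs.continuousAt.eventually h.target] with z hz
      let L : Coord n →ₗ[ℝ] Coord n :=
        { toFun := fun v => coordChristoffel H (f z) v (spaceDeriv f z b)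
          map_add' := fun v w => coordChristoffel_add_left hz.2 v w _
          map_smul' := fun c v => coordChristoffel_smul_left hz.2 c v _ }
      change L _ = ∑ i, (spaceDeriv f z a) i • L (stdVec i)
      conv_lhs => rw [← sum_coord_smul_stdVec (spaceDeriv f z a)]
      simp only [map_sum, map_smul]
    refine IsBigO.congr' (f₁ := fun z => ∑ i, (spaceDeriv f z a) i •
      coordChristoffel H (f z) (stdVec i) (spaceDeriv f z b)) (g₁ := jetSize G H f) ?_
      (e.mono fun z hz => hz.symm) EventuallyEq.rfl
    refine IsBigO.fun_sum (A := fun i z => (spaceDeriv f z a) i •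
      coordChristoffel H (f z) (stdVec i) (spaceDeriv f z b)) fun i _ => ?_
    have k1 : (fun z => (spaceDeriv f z a) i) =O[𝓝 z₀] jetSize G H f := by
      refine IsBigO.trans (F' := Coord n) ?_
        ((h.hasOrder_spaceDeriv_apply a).val.trans root_isBigO_jetSize)
      exact IsBigO.of_bound 1 (Eventually.of_forall fun z => (one_mul ‖spaceDeriv f z a‖).symm ▸
        PiLp.norm_apply_le (spaceDeriv f z a) i)
    have k2 : (fun z => coordChristoffel H (f z) (stdVec i) (spaceDeriv f z b)) =O[𝓝 z₀]
        (fun _ => (1 : ℝ)) :=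
      (contDiffAt_coordChristoffel hH.1 hH.2 hs contDiffAt_const
        (hA.clm_apply contDiffAt_const)).continuousAt.isBigO_one ℝ
    simpa using k1.smul k2
  refine ((h1.add h2).add h3).congr (Eventually.of_forall fun z => ?_)
  simp [sub_eq_add_neg]

theorem root_mul_root_isBigO_root :
    (fun z => root G H f z * root G H f z) =O[𝓝 z₀] root G H f := by
  simpa using (isBigO_refl (root G H f) (𝓝 z₀)).mul h.root_isBigO_one

theorem root_mul_jetSize_isBigO_jetSize :
    (fun z => root G H f z * jetSize G H f z) =O[𝓝 z₀] jetSize G H f := by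
  simpa using h.root_isBigO_one.mul (isBigO_refl (jetSize G H f) (𝓝 z₀))

/-- The density is quadratic in df, so one derivative leaves a factor df. This makes R = √e
Lipschitz in time, also through its zeros. -/
theorem hasOrder_familyDensity :
    HasOrder z₀ (familyDensity G H f) (fun z => root G H f z * root G H f z) (root G H f) :=
  HasOrder.sum (X := fun i z => ∑ j, (gramMatrix (G z.2))⁻¹ i j •
    H (f z) (spaceDeriv f z (stdVec i)) (spaceDeriv f z (stdVec j))) Finset.univ
    fun i _ => HasOrder.sum _ fun j _ =>
    HasOrder.smul_inner (h.contDiffAt_source.gramMatrix_inv h.source.self_of_nhds.2 i j)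
      h.contDiffAt_target (h.hasOrder_spaceDeriv_apply _) (h.hasOrder_spaceDeriv_apply _)
      h.root_isBigO_one (isBigO_refl _ _)
      (by simpa using ((isBigO_refl (root G H f) _).norm_left.add
            (isBigO_refl (root G H f) _).norm_left)) h.root_mul_root_isBigO_root

/-- Every term of the derivative of a quadratic expression in df keeps a factor df beside a factor
df or D²f, giving R J. A further derivative turns one of these two into a bounded factor, and what
remains is O(J). -/
theorem hasOrder_spaceDeriv_familyDensity (v : Coord m) :
    HasOrder z₀ (fun z => spaceDeriv (familyDensity G H f) z v)
      (fun z => root G H f z * jetSize G H f z) (jetSize G H f) := by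
  set c : Fin m → Fin m → ℝ × Coord m → ℝ := fun i j z => (gramMatrix (G z.2))⁻¹ i j with hc
  set B : ℝ × Coord m → Bilin n := fun z => H (f z) with hB
  set a : Fin m → ℝ × Coord m → Coord n := fun i z => spaceDeriv f z (stdVec i) with ha
  have hcs : ∀ᶠ z in 𝓝 z₀, ∀ i j, ContDiffAt ℝ ∞ (c i j) z := by
    filter_upwards [h.eventually] with z hz
    exact fun i j => hz.contDiffAt_source.gramMatrix_inv hz.source.self_of_nhds.2 i j
  have hBs : ∀ᶠ z in 𝓝 z₀, ContDiffAt ℝ ∞ B z := by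
    filter_upwards [h.eventually] with z hz using hz.contDiffAt_target
  have has : ∀ᶠ z in 𝓝 z₀, ∀ i, ContDiffAt ℝ ∞ (a i) z := by
    filter_upwards [h.map] with z hz
    exact fun i => hz.spaceDeriv.clm_apply contDiffAt_const
  have hformula : (fun z => spaceDeriv (familyDensity G H f) z v) =ᶠ[𝓝 z₀] fun z =>
      ∑ i, ∑ j, (fderiv ℝ (c i j) z (0, v) • B z (a i z) (a j z)
        + c i j z • (fderiv ℝ B z (0, v)) (a i z) (a j z)
        + c i j z • B z (spaceDeriv (spaceDeriv f) z v (stdVec i)) (a j z)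
        + c i j z • B z (a i z) (spaceDeriv (spaceDeriv f) z v (stdVec j))) := by
    filter_upwards [hcs, hBs, has, h.map] with z h1 h2 h3 h4
    have da : ∀ i, fderiv ℝ (a i) z (0, v) = spaceDeriv (spaceDeriv f) z v (stdVec i) := by
      intro i
      have : HasFDerivAt (a i) _ z :=
        (h4.spaceDeriv.differentiableAt (by simp)).hasFDerivAt.clm_apply
          (hasFDerivAt_const (stdVec i) z)
      rw [this.fderiv]
      simp [spaceDeriv]
    have dterm : ∀ i j, HasFDerivAt (fun z => c i j z • B z (a i z) (a j z)) _ z := fun i j =>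
      ((h1 i j).differentiableAt (by simp)).hasFDerivAt.smul
        (((h2.differentiableAt (by simp)).hasFDerivAt.clm_apply
          ((h3 i).differentiableAt (by simp)).hasFDerivAt).clm_apply
          ((h3 j).differentiableAt (by simp)).hasFDerivAt)
    have dsum : HasFDerivAt (fun z => ∑ i, ∑ j, c i j z • B z (a i z) (a j z)) _ z :=
      HasFDerivAt.fun_sum fun i _ => HasFDerivAt.fun_sum fun j _ => dterm i j
    have e : familyDensity G H f = fun z => ∑ i, ∑ j, c i j z • B z (a i z) (a j z) := rfl
    rw [e, spaceDeriv, dsum.fderiv]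
    simp only [ContinuousLinearMap.comp_apply, ContinuousLinearMap.inr_apply, sum_apply, add_apply,
      smul_apply, ContinuousLinearMap.flip_apply, da, ContinuousLinearMap.smulRight_apply]
    refine Finset.sum_congr rfl fun i _ => Finset.sum_congr rfl fun j _ => ?_
    simp only [smul_eq_mul]
    ring
  refine HasOrder.congr ?_ hformula
  have hRJ := h.root_mul_jetSize_isBigO_jetSize
  have hRR : (fun z => root G H f z * root G H f z) =O[𝓝 z₀]
      fun z => root G H f z * jetSize G H f z :=
    (isBigO_refl _ _).mul root_isBigO_jetSize
  have hR' : (fun z => ‖(1 : ℝ)‖ * ‖root G H f z‖ + ‖root G H f z‖ * ‖(1 : ℝ)‖) =O[𝓝 z₀]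
      jetSize G H f := by
    simpa using (root_isBigO_jetSize (G := G) (H := H) (f := f)).norm_left.add
      (root_isBigO_jetSize (G := G) (H := H) (f := f)).norm_left
  have hRJ' : (fun z => ‖(1 : ℝ)‖ * ‖root G H f z‖ + ‖jetSize G H f z‖ * ‖(1 : ℝ)‖) =O[𝓝 z₀]
      jetSize G H f := by
    simpa using (root_isBigO_jetSize (G := G) (H := H) (f := f)).norm_left.add
      (isBigO_refl (jetSize G H f) _).norm_left
  have hJR' : (fun z => ‖(1 : ℝ)‖ * ‖jetSize G H f z‖ + ‖root G H f z‖ * ‖(1 : ℝ)‖) =O[𝓝 z₀]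
      jetSize G H f := by
    simpa using (isBigO_refl (jetSize G H f) _).norm_left.add
      (root_isBigO_jetSize (G := G) (H := H) (f := f)).norm_left
  refine HasOrder.sum _ fun i _ => HasOrder.sum _ fun j _ => ((HasOrder.add ?_ ?_).add ?_).add ?_
  · exact HasOrder.smul_inner ((hcs.self_of_nhds i j).fderiv_infty.clm_apply contDiffAt_const)
      hBs.self_of_nhds (h.hasOrder_spaceDeriv_apply _) (h.hasOrder_spaceDeriv_apply _)
      h.root_isBigO_one hRR hR' hRJ
  · exact HasOrder.smul_inner (hcs.self_of_nhds i j)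
      (hBs.self_of_nhds.fderiv_infty.clm_apply contDiffAt_const) (h.hasOrder_spaceDeriv_apply _)
      (h.hasOrder_spaceDeriv_apply _) h.root_isBigO_one hRR hR' hRJ
  · exact HasOrder.smul_inner (hcs.self_of_nhds i j) hBs.self_of_nhds
      (h.hasOrder_spaceDeriv_spaceDeriv_apply _ _) (h.hasOrder_spaceDeriv_apply _)
      h.jetSize_isBigO_one (by simpa [mul_comm] using isBigO_refl _ _) hRJ' hRJ
  · exact HasOrder.smul_inner (hcs.self_of_nhds i j) hBs.self_of_nhds
      (h.hasOrder_spaceDeriv_apply _) (h.hasOrder_spaceDeriv_spaceDeriv_apply _ _)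
      h.root_isBigO_one (isBigO_refl _ _) hJR' hRJ

/-- The gradient term has one more factor df than the derivative of the density. The two factors R
in its value compensate e^(s-1) = R^(2s-2) in the p-tension field. -/
theorem hasOrder_familyGradient :
    HasOrder z₀ (familyGradient G H f)
      (fun z => root G H f z * root G H f z * jetSize G H f z)
      (fun z => root G H f z * jetSize G H f z) := by
  refine h.hasOrder_metricTrace ?_ fun a b => ?_
  · simpa [mul_assoc] using h.root_mul_root_isBigO_root.mul (isBigO_refl (jetSize G H f) _)
  · refine ((h.hasOrder_spaceDeriv_familyDensity a).smul (h.hasOrder_spaceDeriv_apply b)).mono ?_ ?_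
    · refine (isBigO_refl _ _).congr_right fun z => ?_
      ring
    · refine IsBigO.add ?_ ?_
      · refine (isBigO_refl _ _).norm_left.congr (fun z => ?_) (fun z => rfl)
        rw [norm_mul, mul_comm]
      · simpa using (isBigO_refl (fun z => root G H f z * jetSize G H f z) (𝓝 z₀)).norm_left

end IsSmoothFamily

end

noncomputable section

/-! ### Bounds for the p-tension field and its time derivative at a fixed point. -/

section Paths

open Filter Topology

/-- The square root of a nonnegative function is Lipschitz if the derivative is controlled by it. -/
theorem abs_sqrt_sub_sqrt_le {e : ℝ → ℝ} {K δ t : ℝ} (hK : 0 ≤ K) (ht : t ∈ Ioo (-δ) δ)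
    (h0 : ∀ r ∈ Ioo (-δ) δ, 0 ≤ e r) (hd : ∀ r ∈ Ioo (-δ) δ, DifferentiableAt ℝ e r)
    (he : ∀ r ∈ Ioo (-δ) δ, |deriv e r| ≤ K * Real.sqrt (e r)) :
    |Real.sqrt (e t) - Real.sqrt (e 0)| ≤ K * |t| := by
  have hz : (0 : ℝ) ∈ Ioo (-δ) δ := ⟨by linarith [ht.1, ht.2], by linarith [ht.1, ht.2]⟩
  -- Adding η > 0 makes the root differentiable at zeros of e, with a bound on its derivative
  -- independent of η; then η tends to 0.
  have key : ∀ η > 0, |Real.sqrt (e t + η) - Real.sqrt (e 0 + η)| ≤ K * |t| := by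
    intro η hη
    have hder : ∀ r ∈ Ioo (-δ) δ, HasDerivWithinAt (fun r => Real.sqrt (e r + η))
        (deriv e r / (2 * Real.sqrt (e r + η))) (Ioo (-δ) δ) r := fun r hr =>
      (((hd r hr).hasDerivAt.add_const η).sqrt (by linarith [h0 r hr])).hasDerivWithinAt
    have hb : ∀ r ∈ Ioo (-δ) δ, ‖deriv e r / (2 * Real.sqrt (e r + η))‖ ≤ K := by
      intro r hr
      have hpos : 0 < Real.sqrt (e r + η) := Real.sqrt_pos.2 (by linarith [h0 r hr])
      rw [Real.norm_eq_abs, abs_div, abs_of_pos (by positivity : 0 < 2 * Real.sqrt (e r + η)),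
        div_le_iff₀ (by positivity)]
      have h1 : Real.sqrt (e r) ≤ Real.sqrt (e r + η) := Real.sqrt_le_sqrt (by linarith)
      calc |deriv e r| ≤ K * Real.sqrt (e r) := he r hr
        _ ≤ K * (2 * Real.sqrt (e r + η)) := by gcongr; linarith
    have := (convex_Ioo (-δ) δ).norm_image_sub_le_of_norm_hasDerivWithin_le hder hb hz ht
    simpa using this
  have hc : Continuous fun η : ℝ => |Real.sqrt (e t + η) - Real.sqrt (e 0 + η)| := by fun_prop
  have hlim : Tendsto (fun η : ℝ => |Real.sqrt (e t + η) - Real.sqrt (e 0 + η)|) (𝓝[>] 0)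
      (𝓝 |Real.sqrt (e t) - Real.sqrt (e 0)|) := by
    have := (hc.tendsto 0).mono_left (nhdsWithin_le_nhds (s := Ioi 0))
    simpa using this
  exact le_of_tendsto hlim (by filter_upwards [self_mem_nhdsWithin] with η hη using key η hη)

variable {F : Type*} [NormedAddCommGroup F] [NormedSpace ℝ F]

/-- Bounds for the energy density `e`, the tension field `τ`, the gradient term `Y` and the size
`b` of the second derivatives along a path of maps. -/
structure PathBounds (K δ : ℝ) (e b : ℝ → ℝ) (τ Y : ℝ → F) : Prop where
  nonneg : ∀ t ∈ Ioo (-δ) δ, 0 ≤ e t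
  le : ∀ t ∈ Ioo (-δ) δ, Real.sqrt (e t) ≤ K
  diff : ∀ t ∈ Ioo (-δ) δ, DifferentiableAt ℝ e t
  der : ∀ t ∈ Ioo (-δ) δ, |deriv e t| ≤ K * Real.sqrt (e t)
  diff_tension : ∀ t ∈ Ioo (-δ) δ, DifferentiableAt ℝ τ t
  tension : ∀ t ∈ Ioo (-δ) δ, ‖τ t‖ ≤ K * (Real.sqrt (e t) + b t)
  der_tension : ∀ t ∈ Ioo (-δ) δ, ‖deriv τ t‖ ≤ K
  diff_grad : ∀ t ∈ Ioo (-δ) δ, DifferentiableAt ℝ Y t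
  grad : ∀ t ∈ Ioo (-δ) δ, ‖Y t‖ ≤ K * (Real.sqrt (e t) * Real.sqrt (e t) *
    (Real.sqrt (e t) + b t))
  der_grad : ∀ t ∈ Ioo (-δ) δ, ‖deriv Y t‖ ≤ K * (Real.sqrt (e t) * (Real.sqrt (e t) + b t))
  nonneg_snd : ∀ t ∈ Ioo (-δ) δ, 0 ≤ b t
  snd : ∀ t ∈ Ioo (-δ) δ, b t ≤ b 0 + K * |t|

theorem rpow_sq {R : ℝ} (hR : 0 ≤ R) (s : ℝ) : (R * R) ^ s = R ^ (2 * s) := by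
  rw [two_mul, ← pow_two, ← Real.rpow_natCast, ← Real.rpow_mul hR]
  norm_num [two_mul]

namespace PathBounds

variable {K δ s : ℝ} {e b : ℝ → ℝ} {τ Y : ℝ → F}

/-- Both terms have order R^(2s) (R + b): in the second one the factor R² in the bound for Y cancels
the loss in e^(s-1). -/
theorem norm_le (h : PathBounds K δ e b τ Y) (hs : 0 < s) {t : ℝ}
    (ht : t ∈ Ioo (-δ) δ) :
    ‖e t ^ s • τ t + (s * e t ^ (s - 1)) • Y t‖ ≤
      K * (1 + s) * (Real.sqrt (e t) ^ (2 * s) * (Real.sqrt (e t) + b t)) := by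
  set R := Real.sqrt (e t) with hR
  have hR0 : 0 ≤ R := Real.sqrt_nonneg _
  have hb := h.nonneg_snd t ht
  have heR : e t = R * R := (Real.mul_self_sqrt (h.nonneg t ht)).symm
  have h1 := h.tension t ht
  have h2 := h.grad t ht
  rw [← hR] at h1 h2
  rw [heR]
  rcases hR0.eq_or_lt with h0 | hpos
  -- At a zero of e the power e^(s-1) carries no information, but Y vanishes there.
  · have hY : Y t = 0 := by
      rw [← norm_le_zero_iff]
      simpa [← h0] using h2
    rw [hY, ← h0]
    simp [Real.zero_rpow hs.ne', Real.zero_rpow (by linarith : 2 * s ≠ 0)]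
  · have e1 : (R * R) ^ s = R ^ (2 * s) := rpow_sq hR0 s
    have e2 : (R * R) ^ (s - 1) * (R * R) = R ^ (2 * s) := by
      rw [← e1, Real.rpow_sub_one (by positivity)]
      field_simp
    refine (norm_add_le _ _).trans ?_
    rw [norm_smul, norm_smul, Real.norm_of_nonneg (by positivity),
      Real.norm_of_nonneg (by positivity)]
    calc (R * R) ^ s * ‖τ t‖ + s * (R * R) ^ (s - 1) * ‖Y t‖
        ≤ (R * R) ^ s * (K * (R + b t)) + s * (R * R) ^ (s - 1) * (K * (R * R * (R + b t))) := by
          gcongr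
      _ = (R * R) ^ s * (K * (R + b t)) + s * K * (R + b t) * ((R * R) ^ (s - 1) * (R * R)) := by
          ring
      _ = _ := by rw [e2, e1]; ring

/-- Each of the four Leibniz terms has one power of R less than the bound of `norm_le`; in e^s τ' a
factor R is replaced by the larger R + b. The exponent 2s - 1 = p - 3 is negative for p < 3, so this
bound degenerates at zeros of df. -/
theorem norm_deriv_le (h : PathBounds K δ e b τ Y) (hK : 0 ≤ K) (hs : 0 < s) {t : ℝ}
    (ht : t ∈ Ioo (-δ) δ) (hpos : 0 < e t) :
    ∃ T', HasDerivAt (fun t => e t ^ s • τ t + (s * e t ^ (s - 1)) • Y t) T' t ∧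
      ‖T'‖ ≤ (s * K ^ 2 + K + s * |s - 1| * K ^ 2 + s * K) *
        (Real.sqrt (e t) ^ (2 * s - 1) * (Real.sqrt (e t) + b t)) := by
  set R := Real.sqrt (e t) with hR
  have hR0 : 0 < R := Real.sqrt_pos.2 hpos
  have hb := h.nonneg_snd t ht
  have heR : e t = R * R := (Real.mul_self_sqrt (h.nonneg t ht)).symm
  have h1 := (h.diff t ht).hasDerivAt.rpow_const (p := s) (Or.inl hpos.ne')
  have h2 := ((h.diff t ht).hasDerivAt.rpow_const (p := s - 1) (Or.inl hpos.ne')).const_mul s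
  refine ⟨_, (h1.smul (h.diff_tension t ht).hasDerivAt).add
    (h2.smul (h.diff_grad t ht).hasDerivAt), ?_⟩
  have b1 := h.tension t ht
  have b2 := h.der_tension t ht
  have b3 := h.grad t ht
  have b4 := h.der_grad t ht
  have b5 := h.der t ht
  rw [← hR] at b1 b3 b4 b5
  have p1 : (R * R) ^ s = R ^ (2 * s - 1) * R := by
    rw [rpow_sq hR0.le, Real.rpow_sub_one hR0.ne']; field_simp
  have p2 : (R * R) ^ (s - 1) * R = R ^ (2 * s - 1) := by
    rw [rpow_sq hR0.le, Real.rpow_sub_one hR0.ne', mul_sub, mul_one,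
      Real.rpow_sub hR0]
    norm_num
    field_simp
  have p3 : (R * R) ^ (s - 1 - 1) * (R * R) = (R * R) ^ (s - 1) := by
    rw [Real.rpow_sub_one (by positivity) (s - 1)]; field_simp
  rw [heR]
  set J := R + b t with hJ
  have hJ0 : 0 ≤ J := by positivity
  have q0 : 0 ≤ (R * R) ^ (s - 1) := by positivity
  have q1 : 0 ≤ (R * R) ^ (s - 1 - 1) := by positivity
  have q2 : 0 ≤ (R * R) ^ s := by positivity
  have n1 : ‖(R * R) ^ s • deriv τ t‖ ≤ K * (R ^ (2 * s - 1) * J) := by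
    rw [norm_smul, Real.norm_of_nonneg q2, p1]
    calc R ^ (2 * s - 1) * R * ‖deriv τ t‖ ≤ R ^ (2 * s - 1) * J * K := by
          gcongr; linarith
      _ = _ := by ring
  have n2 : ‖(deriv e t * s * (R * R) ^ (s - 1)) • τ t‖ ≤ s * K ^ 2 * (R ^ (2 * s - 1) * J) := by
    rw [norm_smul, norm_mul, norm_mul, Real.norm_of_nonneg q0, Real.norm_of_nonneg hs.le,
      Real.norm_eq_abs]
    calc |deriv e t| * s * (R * R) ^ (s - 1) * ‖τ t‖
        ≤ (K * R) * s * (R * R) ^ (s - 1) * (K * J) := by gcongr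
      _ = s * K ^ 2 * (((R * R) ^ (s - 1) * R) * J) := by ring
      _ = _ := by rw [p2]
  have n3 : ‖(s * (R * R) ^ (s - 1)) • deriv Y t‖ ≤ s * K * (R ^ (2 * s - 1) * J) := by
    rw [norm_smul, Real.norm_of_nonneg (by positivity)]
    calc s * (R * R) ^ (s - 1) * ‖deriv Y t‖ ≤ s * (R * R) ^ (s - 1) * (K * (R * J)) := by gcongr
      _ = s * K * (((R * R) ^ (s - 1) * R) * J) := by ring
      _ = _ := by rw [p2]
  have n4 : ‖(s * (deriv e t * (s - 1) * (R * R) ^ (s - 1 - 1))) • Y t‖ ≤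
      s * |s - 1| * K ^ 2 * (R ^ (2 * s - 1) * J) := by
    rw [norm_smul, norm_mul, norm_mul, norm_mul, Real.norm_of_nonneg q1, Real.norm_of_nonneg hs.le,
      Real.norm_eq_abs, Real.norm_eq_abs]
    calc s * (|deriv e t| * |s - 1| * (R * R) ^ (s - 1 - 1)) * ‖Y t‖
        ≤ s * ((K * R) * |s - 1| * (R * R) ^ (s - 1 - 1)) * (K * (R * R * J)) := by gcongr
      _ = s * |s - 1| * K ^ 2 * ((((R * R) ^ (s - 1 - 1) * (R * R)) * R) * J) := by ring
      _ = _ := by rw [p3, p2]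
  refine (norm_add_le _ _).trans ((add_le_add (norm_add_le _ _) (norm_add_le _ _)).trans ?_)
  linarith

theorem abs_root_sub_le (h : PathBounds K δ e b τ Y) (hK : 0 ≤ K) {t : ℝ} (ht : t ∈ Ioo (-δ) δ) :
    |Real.sqrt (e t) - Real.sqrt (e 0)| ≤ K * |t| :=
  abs_sqrt_sub_sqrt_le hK ht h.nonneg h.diff h.der

end PathBounds

end Paths

end

noncomputable section

/-! ### Pointwise decay of the p-tension field along a path. -/

namespace PathBounds

open Filter Topology

/-- Comparison of negative powers of `x` and `x ^ 2 + R ^ 2`. -/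
theorem rpow_neg_le_of_sq_le {γ x A y : ℝ} (hγ : 0 < γ) (hx : 0 < x) (hA : 0 ≤ A) (hy : 0 < y)
    (h : y ≤ A * x ^ 2) : x ^ (-γ) ≤ A ^ (γ / 2) * y ^ (-(γ / 2)) := by
  have h1 : x ^ γ = (x ^ 2) ^ (γ / 2) := by
    rw [← Real.rpow_natCast, ← Real.rpow_mul hx.le]
    congr 1
    push_cast
    ring
  have h2 : y ^ (γ / 2) ≤ A ^ (γ / 2) * x ^ γ := by
    rw [h1, ← Real.mul_rpow hA (by positivity)]
    exact Real.rpow_le_rpow hy.le h (by positivity)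
  rw [Real.rpow_neg hx.le, Real.rpow_neg hy.le, ← div_eq_mul_inv,
    le_div_iff₀ (by positivity), inv_mul_le_iff₀ (by positivity)]
  linarith

/-- With x = |t|, the case R₀ ≤ 2Kx: then R ≤ 3Kx at time t, and the size bound alone gives T =
O(x^(1-γ) (x + b₀)). In T² a factor x^(-γ) is traded for the weight, since x² + R₀² is at most a
multiple of x². -/
theorem decay_near {γ K s x R₀ R b₀ b T : ℝ} (hγ : 0 < γ) (hγ' : γ < 1) (hs : 1 - γ ≤ 2 * s)
    (hK : 1 ≤ K) (hx : 0 < x) (hx1 : x ≤ 1) (hR₀ : 0 ≤ R₀) (hR₀x : R₀ ≤ 2 * K * x) (hR : 0 ≤ R)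
    (hRK : R ≤ K) (hRx : R ≤ R₀ + K * x) (hb₀ : 0 ≤ b₀) (hb : 0 ≤ b) (hbx : b ≤ b₀ + K * x)
    (hT0 : 0 ≤ T) (hT : T ≤ K * (1 + s) * (R ^ (2 * s) * (R + b))) :
    T ^ 2 ≤ 2 * (K * (1 + s) * (K ^ (2 * s - 1 + γ) * (3 * K) ^ (1 - γ) * (4 * K))) ^ 2 *
      (1 + 4 * K ^ 2) ^ (γ / 2) *
      (x ^ (2 - γ) * (1 + (x ^ 2 + R₀ ^ 2) ^ (-(γ / 2)) * b₀ ^ 2)) := by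
  have hs0 : 0 < s := by linarith
  have hK0 : 0 < K := by linarith
  set D := K * (1 + s) * (K ^ (2 * s - 1 + γ) * (3 * K) ^ (1 - γ) * (4 * K)) with hD
  have hD0 : 0 ≤ D := by positivity
  set M := (1 + 4 * K ^ 2) ^ (γ / 2) with hM
  have hM1 : 1 ≤ M := Real.one_le_rpow (by nlinarith) (by positivity)
  set W := (x ^ 2 + R₀ ^ 2) ^ (-(γ / 2)) with hW
  have hW0 : 0 ≤ W := by positivity
  -- Split off R^(1-γ), which carries the decay; the remaining exponent 2s - 1 + γ is nonnegative,
  -- so that factor is bounded.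
  have hRs : R ^ (2 * s) ≤ K ^ (2 * s - 1 + γ) * ((3 * K) ^ (1 - γ) * x ^ (1 - γ)) := by
    have e1 : R ^ (2 * s) = R ^ (2 * s - 1 + γ) * R ^ (1 - γ) := by
      rw [← Real.rpow_add_of_nonneg hR (by linarith) (by linarith)]
      ring_nf
    rw [e1, ← Real.mul_rpow (by positivity) hx.le]
    gcongr
    all_goals linarith
  have hJ : R + b ≤ 4 * K * (x + b₀) := by nlinarith
  have h1 : T ≤ D * (x ^ (1 - γ) * (x + b₀)) := by
    refine hT.trans ?_
    calc K * (1 + s) * (R ^ (2 * s) * (R + b))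
        ≤ K * (1 + s) * ((K ^ (2 * s - 1 + γ) * ((3 * K) ^ (1 - γ) * x ^ (1 - γ))) *
          (4 * K * (x + b₀))) := by gcongr
      _ = _ := by rw [hD]; ring
  have h2 : T ^ 2 ≤ D ^ 2 * ((x ^ (1 - γ)) ^ 2 * (2 * (x ^ 2 + b₀ ^ 2))) := by
    calc T ^ 2 ≤ (D * (x ^ (1 - γ) * (x + b₀))) ^ 2 := by gcongr
      _ = D ^ 2 * ((x ^ (1 - γ)) ^ 2 * (x + b₀) ^ 2) := by ring
      _ ≤ _ := by gcongr; nlinarith [sq_nonneg (x - b₀)]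
  have e2 : (x ^ (1 - γ)) ^ 2 = x ^ (2 - γ) * x ^ (-γ) := by
    rw [pow_two, ← Real.rpow_add hx, ← Real.rpow_add hx]; ring_nf
  have e3 : x ^ (-γ) * x ^ 2 ≤ 1 := by
    rw [← Real.rpow_natCast, ← Real.rpow_add hx]
    exact Real.rpow_le_one hx.le hx1 (by push_cast; linarith)
  have e4 : x ^ (-γ) ≤ M * W := by
    refine rpow_neg_le_of_sq_le hγ hx (by positivity) (by positivity) ?_
    nlinarith [mul_self_le_mul_self hR₀ hR₀x]
  have hx2 : 0 ≤ x ^ (2 - γ) := by positivity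
  calc T ^ 2 ≤ D ^ 2 * ((x ^ (1 - γ)) ^ 2 * (2 * (x ^ 2 + b₀ ^ 2))) := h2
    _ = 2 * D ^ 2 * (x ^ (2 - γ) * (x ^ (-γ) * x ^ 2 + x ^ (-γ) * b₀ ^ 2)) := by rw [e2]; ring
    _ ≤ 2 * D ^ 2 * (x ^ (2 - γ) * (M + M * W * b₀ ^ 2)) := by
        gcongr
        exact e3.trans hM1
    _ = _ := by ring

/-- The case of large R₀, where the mean value inequality supplies the bound on T. Of the two
factors R₀^(-γ) in T², one is at most x^(-γ) and lowers x² to x^(2-γ); the other becomes the weight,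
since x² + R₀² ≤ 2 R₀². -/
theorem decay_far {γ K C x R₀ b₀ T : ℝ} (hγ : 0 < γ) (hγ' : γ < 1)
    (hx : 0 < x) (hx1 : x ≤ 1) (hR₀x : x ≤ R₀)
    (hRK : R₀ ≤ K) (hK : 1 ≤ K)
    (hT0 : 0 ≤ T) (hT : T ≤ C * x * (R₀ ^ (-γ) * (R₀ + b₀))) :
    T ^ 2 ≤ 2 * C ^ 2 * (K ^ 2 + 2 ^ (γ / 2)) *
      (x ^ (2 - γ) * (1 + (x ^ 2 + R₀ ^ 2) ^ (-(γ / 2)) * b₀ ^ 2)) := by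
  have hR₀ : 0 < R₀ := by linarith
  set W := (x ^ 2 + R₀ ^ 2) ^ (-(γ / 2)) with hW
  have hW0 : 0 ≤ W := by positivity
  have h2 : T ^ 2 ≤ C ^ 2 * (x ^ 2 * ((R₀ ^ (-γ)) ^ 2 * (2 * (R₀ ^ 2 + b₀ ^ 2)))) := by
    calc T ^ 2 ≤ (C * x * (R₀ ^ (-γ) * (R₀ + b₀))) ^ 2 := by gcongr
      _ = C ^ 2 * (x ^ 2 * ((R₀ ^ (-γ)) ^ 2 * (R₀ + b₀) ^ 2)) := by ring
      _ ≤ _ := by gcongr; nlinarith [sq_nonneg (R₀ - b₀)]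
  have e1 : x ^ 2 ≤ x ^ (2 - γ) := by
    rw [← Real.rpow_natCast]
    exact Real.rpow_le_rpow_of_exponent_ge hx hx1 (by push_cast; linarith)
  have e2 : (R₀ ^ (-γ)) ^ 2 * R₀ ^ 2 ≤ K ^ 2 := by
    have : (R₀ ^ (-γ)) ^ 2 * R₀ ^ 2 = (R₀ ^ (1 - γ)) ^ 2 := by
      rw [← mul_pow, ← Real.rpow_add_one hR₀.ne']; ring_nf
    rw [this]
    gcongr
    calc R₀ ^ (1 - γ) ≤ K ^ (1 - γ) := by gcongr
      _ ≤ K ^ (1 : ℝ) := Real.rpow_le_rpow_of_exponent_le hK (by linarith)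
      _ = K := Real.rpow_one K
  have e3 : x ^ 2 * R₀ ^ (-γ) ≤ x ^ (2 - γ) := by
    calc x ^ 2 * R₀ ^ (-γ) ≤ x ^ 2 * x ^ (-γ) := 
          mul_le_mul_of_nonneg_left (Real.rpow_le_rpow_of_nonpos hx hR₀x (by linarith))
            (by positivity)
      _ = x ^ (2 - γ) := by
          rw [← Real.rpow_natCast, ← Real.rpow_add hx]; norm_num [sub_eq_add_neg]
  have e4 : R₀ ^ (-γ) ≤ 2 ^ (γ / 2) * W := by
    refine rpow_neg_le_of_sq_le hγ hR₀ (by positivity) (by positivity) ?_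
    nlinarith
  have hx2 : 0 ≤ x ^ (2 - γ) := by positivity
  have hm : (0 : ℝ) ≤ 2 ^ (γ / 2) := by positivity
  calc T ^ 2 ≤ C ^ 2 * (x ^ 2 * ((R₀ ^ (-γ)) ^ 2 * (2 * (R₀ ^ 2 + b₀ ^ 2)))) := h2
    _ = 2 * C ^ 2 * (x ^ 2 * ((R₀ ^ (-γ)) ^ 2 * R₀ ^ 2)
        + (x ^ 2 * R₀ ^ (-γ)) * (R₀ ^ (-γ) * b₀ ^ 2)) := by ring
    _ ≤ 2 * C ^ 2 * (x ^ (2 - γ) * K ^ 2 + x ^ (2 - γ) * ((2 ^ (γ / 2) * W) * b₀ ^ 2)) := by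
        gcongr
    _ ≤ 2 * C ^ 2 * (K ^ 2 + 2 ^ (γ / 2)) * (x ^ (2 - γ) * (1 + W * b₀ ^ 2)) := by
        have a1 : 0 ≤ x ^ (2 - γ) * (K ^ 2 * (W * b₀ ^ 2)) := by positivity
        have a2 : 0 ≤ x ^ (2 - γ) * 2 ^ (γ / 2) := by positivity
        have : (K ^ 2 + 2 ^ (γ / 2)) * (x ^ (2 - γ) * (1 + W * b₀ ^ 2)) =
          (x ^ (2 - γ) * K ^ 2 + x ^ (2 - γ) * ((2 ^ (γ / 2) * W) * b₀ ^ 2)) +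
          (x ^ (2 - γ) * (K ^ 2 * (W * b₀ ^ 2)) + x ^ (2 - γ) * 2 ^ (γ / 2)) := by ring
        rw [mul_assoc (2 * C ^ 2), this]
        refine mul_le_mul_of_nonneg_left ?_ (by positivity)
        linarith

variable {F : Type*} [NormedAddCommGroup F] [NormedSpace ℝ F]

/-- Along a path of maps that starts at a `p`-harmonic map, the `p`-tension field decays. -/
theorem exists_decay {K δ γ s : ℝ} (hγ : 0 < γ) (hγ' : γ < 1) (hs : 1 - γ ≤ 2 * s)
    (hK : 1 ≤ K) (hδ : δ ≤ 1) : ∃ C ≥ 0, ∀ (e b : ℝ → ℝ) (τ Y : ℝ → F),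
      PathBounds K δ e b τ Y → e 0 ^ s • τ 0 + (s * e 0 ^ (s - 1)) • Y 0 = 0 →
      ∀ t ∈ Ioo (-δ) δ, ‖e t ^ s • τ t + (s * e t ^ (s - 1)) • Y t‖ ^ 2 ≤
        C * (|t| ^ (2 - γ) * (1 + (t ^ 2 + e 0) ^ (-(γ / 2)) * b 0 ^ 2)) := by
  have hs0 : 0 < s := by linarith
  have hK0 : 0 < K := by linarith
  set C₁ := 2 * (K * (1 + s) * (K ^ (2 * s - 1 + γ) * (3 * K) ^ (1 - γ) * (4 * K))) ^ 2 *
      (1 + 4 * K ^ 2) ^ (γ / 2) with hC₁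
  set A := (s * K ^ 2 + K + s * |s - 1| * K ^ 2 + s * K) with hA
  -- The factors 2^γ and 3 come from R₀/2 ≤ R ≤ 2 R₀ along the path: 2^γ from R^(-γ), 3 from R + b ≤
  -- 3 (R₀ + b₀).
  set B := A * (K ^ (2 * s - 1 + γ) * 2 ^ γ * 3) with hB
  set C₂ := 2 * B ^ 2 * (K ^ 2 + 2 ^ (γ / 2)) with hC₂
  have hC₁0 : 0 ≤ C₁ := by positivity
  have hC₂0 : 0 ≤ C₂ := by positivity
  have hA0 : 0 ≤ A := by positivity
  refine ⟨C₁ + C₂, by positivity, fun e b τ Y h h0 t ht => ?_⟩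
  have hz : (0 : ℝ) ∈ Ioo (-δ) δ := ⟨by linarith [ht.1, ht.2], by linarith [ht.1, ht.2]⟩
  have he0 := h.nonneg 0 hz
  have hb0 := h.nonneg_snd 0 hz
  have hpos : 0 ≤ |t| ^ (2 - γ) * (1 + (t ^ 2 + e 0) ^ (-(γ / 2)) * b 0 ^ 2) := by positivity
  have hC : ∀ C, C ≤ C₁ + C₂ → ∀ T : ℝ, T ^ 2 ≤ C * (|t| ^ (2 - γ) *
      (1 + (t ^ 2 + e 0) ^ (-(γ / 2)) * b 0 ^ 2)) → T ^ 2 ≤ (C₁ + C₂) * (|t| ^ (2 - γ) *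
      (1 + (t ^ 2 + e 0) ^ (-(γ / 2)) * b 0 ^ 2)) := fun C hle T hT =>
    hT.trans (mul_le_mul_of_nonneg_right hle hpos)
  by_cases ht0 : t = 0
  · rw [ht0, h0]
    rw [ht0] at hpos
    simpa using mul_nonneg (add_nonneg hC₁0 hC₂0) hpos
  have hx : 0 < |t| := abs_pos.2 ht0
  have hx1 : |t| ≤ 1 := (abs_lt.2 ht).le.trans hδ
  have hsq : t ^ 2 + e 0 = |t| ^ 2 + Real.sqrt (e 0) ^ 2 := by
    rw [sq_abs, Real.sq_sqrt he0]
  -- R is K-Lipschitz in time. Beyond the threshold 2K|t| it stays between R₀/2 and 2R₀ on the whole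
  -- segment from 0 to t, so the derivative exists there and can be integrated from the initial
  -- value 0.
  rcases le_or_gt (Real.sqrt (e 0)) (2 * K * |t|) with hcase | hcase
  · refine hC C₁ (by linarith) _ ?_
    rw [hsq]
    have := (abs_le.1 (h.abs_root_sub_le hK0.le ht)).2
    exact decay_near hγ hγ' hs hK hx hx1 (Real.sqrt_nonneg _) hcase (Real.sqrt_nonneg _) (h.le t ht)
      (by linarith) hb0 (h.nonneg_snd t ht) (h.snd t ht) (norm_nonneg _) (h.norm_le hs0 ht)
  · refine hC C₂ (by linarith) _ ?_
    rw [hsq]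
    set R₀ := Real.sqrt (e 0) with hR₀
    have hR₀x : |t| ≤ R₀ := by nlinarith
    have hR₀pos : 0 < R₀ := by linarith
    refine decay_far hγ hγ' hx hx1 hR₀x (h.le 0 hz) hK (norm_nonneg _) ?_
    have hsub : ∀ r ∈ uIcc 0 t, r ∈ Ioo (-δ) δ ∧ |r| ≤ |t| := by
      intro r hr
      have h1 : |r| ≤ |t| := by
        rcases le_total 0 t with h2 | h2
        · rw [uIcc_of_le h2] at hr
          rw [abs_of_nonneg hr.1, abs_of_nonneg h2]; exact hr.2
        · rw [uIcc_of_ge h2] at hr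
          rw [abs_of_nonpos hr.2, abs_of_nonpos h2]; linarith [hr.1]
      exact ⟨abs_lt.1 (h1.trans_lt (abs_lt.2 ht)), h1⟩
    have hR : ∀ r ∈ uIcc 0 t, R₀ / 2 ≤ Real.sqrt (e r) ∧ Real.sqrt (e r) ≤ 2 * R₀ := by
      intro r hr
      have h1 := abs_le.1 (h.abs_root_sub_le hK0.le (hsub r hr).1)
      have h2 : K * |r| ≤ K * |t| := 
          mul_le_mul_of_nonneg_left (hsub r hr).2 hK0.le
      constructor <;> linarith [h1.1, h1.2]
    have hder : ∀ r ∈ uIcc 0 t, ∃ T',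
        HasDerivAt (fun t => e t ^ s • τ t + (s * e t ^ (s - 1)) • Y t) T' r ∧
        ‖T'‖ ≤ B * (R₀ ^ (-γ) * (R₀ + b 0)) := by
      intro r hr
      have hRr := hR r hr
      have hr0 : 0 < Real.sqrt (e r) := by linarith [hRr.1]
      obtain ⟨T', h1, h2⟩ := h.norm_deriv_le hK0.le hs0 (hsub r hr).1 (Real.sqrt_pos.1 hr0)
      refine ⟨T', h1, h2.trans ?_⟩
      have hbr := h.nonneg_snd r (hsub r hr).1
      have e1 : Real.sqrt (e r) ^ (2 * s - 1) ≤ K ^ (2 * s - 1 + γ) * (2 ^ γ * R₀ ^ (-γ)) := by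
        have e2 : Real.sqrt (e r) ^ (2 * s - 1) =
            Real.sqrt (e r) ^ (2 * s - 1 + γ) * Real.sqrt (e r) ^ (-γ) := by
          rw [← Real.rpow_add hr0]; ring_nf
        have e3 : (2 : ℝ) ^ γ * R₀ ^ (-γ) = (R₀ / 2) ^ (-γ) := by
          rw [Real.div_rpow hR₀pos.le (by norm_num), Real.rpow_neg (by norm_num : (0 : ℝ) ≤ 2)]
          field_simp
        rw [e2, e3]
        refine mul_le_mul (Real.rpow_le_rpow hr0.le (h.le r (hsub r hr).1) (by linarith))
          (Real.rpow_le_rpow_of_nonpos (by linarith) hRr.1 (by linarith)) (by positivity)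
          (by positivity)
      have e4 : Real.sqrt (e r) + b r ≤ 3 * (R₀ + b 0) := by
        have h3 := h.snd r (hsub r hr).1
        have h4 : K * |r| ≤ K * |t| := 
          mul_le_mul_of_nonneg_left (hsub r hr).2 hK0.le
        linarith [hRr.2]
      calc A * (Real.sqrt (e r) ^ (2 * s - 1) * (Real.sqrt (e r) + b r))
          ≤ A * ((K ^ (2 * s - 1 + γ) * (2 ^ γ * R₀ ^ (-γ))) * (3 * (R₀ + b 0))) := by
            gcongr
        _ = _ := by rw [hB]; ring
    choose! T' hT' hbound using hder
    have := (convex_uIcc (0 : ℝ) t).norm_image_sub_le_of_norm_hasDerivWithin_le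
      (fun r hr => (hT' r hr).hasDerivWithinAt) hbound left_mem_uIcc right_mem_uIcc
    rw [h0, sub_zero, sub_zero, Real.norm_eq_abs] at this
    refine this.trans_eq ?_
    ring

end PathBounds

end

noncomputable section

/-! ### Uniform path bounds near a point. -/

namespace IsSmoothFamily

open Filter Topology Asymptotics

variable {m n : ℕ} {G : Coord m → Bilin m} {H : Coord n → Bilin n} {f : ℝ × Coord m → Coord n}

theorem hasDerivAt_slice {W : Type*} [NormedAddCommGroup W] [NormedSpace ℝ W]
    {X : ℝ × Coord m → W} {t : ℝ} {u : Coord m} (hX : DifferentiableAt ℝ X (t, u)) :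
    HasDerivAt (fun t => X (t, u)) (fderiv ℝ X (t, u) (1, 0)) t := by
  have h1 : HasFDerivAt (fun t : ℝ => (t, u)) (ContinuousLinearMap.inl ℝ ℝ (Coord m)) t :=
    hasFDerivAt_prodMk_left _ _
  have h2 : HasFDerivAt (fun t => X (t, u)) _ t :=
    HasFDerivAt.comp t (f := fun t : ℝ => (t, u)) hX.hasFDerivAt h1
  simpa using h2.hasDerivAt

theorem norm_deriv_slice_le {W : Type*} [NormedAddCommGroup W] [NormedSpace ℝ W]
    {X : ℝ × Coord m → W} {t : ℝ} {u : Coord m} (hX : DifferentiableAt ℝ X (t, u)) :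
    ‖deriv (fun t => X (t, u)) t‖ ≤ ‖fderiv ℝ X (t, u)‖ := by
  rw [(hasDerivAt_slice hX).deriv]
  simpa using (fderiv ℝ X (t, u)).le_opNorm ((1, 0) : ℝ × Coord m)

/-- An eventual bound near `(t, u₀)` on a box. -/
theorem exists_box {t₀ : ℝ} {u₀ : Coord m} {P : ℝ × Coord m → Prop}
    (h : ∀ᶠ z in 𝓝 (t₀, u₀), P z) :
    ∃ δ > 0, ∀ᶠ u in 𝓝 u₀, ∀ t ∈ Ioo (t₀ - δ) (t₀ + δ), P (t, u) := by
  rw [nhds_prod_eq, eventually_prod_iff] at h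
  obtain ⟨pa, ha, pb, hb, hP⟩ := h
  obtain ⟨δ, hδ, hball⟩ := Metric.eventually_nhds_iff_ball.1 ha
  refine ⟨δ, hδ, hb.mono fun u hu t ht => hP (hball t ?_) hu⟩
  rwa [Real.ball_eq_Ioo]

theorem exists_bound {W : Type*} [NormedAddCommGroup W] {X : ℝ × Coord m → W}
    {w : ℝ × Coord m → ℝ} {z₀ : ℝ × Coord m} (hw : ∀ z, 0 ≤ w z) (h : X =O[𝓝 z₀] w) :
    ∀ᶠ K in atTop, ∀ᶠ z in 𝓝 z₀, ‖X z‖ ≤ K * w z := by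
  obtain ⟨c, hc⟩ := h.bound
  filter_upwards [eventually_ge_atTop c] with K hK
  filter_upwards [hc] with z hz
  rw [Real.norm_of_nonneg (hw z)] at hz
  exact hz.trans (mul_le_mul_of_nonneg_right hK (hw z))

/-- Near a point the paths `t ↦ f (t, u)` satisfy uniform bounds. -/
theorem exists_pathBounds {u₀ : Coord m} (h : IsSmoothFamily G H f (0, u₀)) :
    ∃ K ≥ 1, ∃ δ > 0, δ ≤ 1 ∧ ∀ᶠ u in 𝓝 u₀,
      (∀ t ∈ Ioo (-δ) δ, IsSmoothFamily G H f (t, u)) ∧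
      PathBounds K δ (fun t => familyDensity G H f (t, u))
        (fun t => ‖spaceDeriv (spaceDeriv f) (t, u)‖) (fun t => familyTension G H f (t, u))
        (fun t => familyGradient G H f (t, u)) := by
  have hR := root_nonneg (G := G) (H := H) (f := f)
  have hJ := jetSize_nonneg (G := G) (H := H) (f := f)
  have hE := h.hasOrder_familyDensity
  have hτ := h.hasOrder_familyTension
  have hY := h.hasOrder_familyGradient
  have hB := h.hasOrder_spaceDeriv_spaceDeriv
  have h1 : ∀ z : ℝ × Coord m, (0 : ℝ) ≤ (fun _ => 1 : ℝ × Coord m → ℝ) z := fun _ => zero_le_one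
  -- Each bound holds for all large constants, so one K serves for all of them.
  obtain ⟨K, hK, k1, k2, k3, k4, k5, k6, k7⟩ := ((eventually_ge_atTop (1 : ℝ)).and <|
    (exists_bound h1 h.root_isBigO_one).and <| (exists_bound hR hE.der).and <|
    (exists_bound hJ hτ.val).and <| (exists_bound h1 hτ.der).and <|
    (exists_bound (fun z => mul_nonneg (mul_nonneg (hR z) (hR z)) (hJ z)) hY.val).and <|
    (exists_bound (fun z => mul_nonneg (hR z) (hJ z)) hY.der).and
    (exists_bound h1 hB.der)).exists
  obtain ⟨δ', hδ', hbox⟩ := exists_box (h.eventually.and <| hE.diff.and <| hτ.diff.and <|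
    hY.diff.and <| hB.diff.and <| k1.and <| k2.and <| k3.and <| k4.and <| k5.and <| k6.and k7)
  refine ⟨K, hK, min δ' 1, by positivity, min_le_right _ _, ?_⟩
  filter_upwards [hbox] with u hu
  set δ := min δ' 1 with hδ
  have hu' := fun t (ht : t ∈ Ioo (-δ) δ) => hu t (by
    have := min_le_left δ' 1
    exact ⟨by linarith [ht.1], by linarith [ht.2]⟩)
  refine ⟨fun t ht => (hu' t ht).1, ?_⟩
  have hdB : ∀ t ∈ Ioo (-δ) δ, HasDerivWithinAt (fun t => spaceDeriv (spaceDeriv f) (t, u))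
      (deriv (fun t => spaceDeriv (spaceDeriv f) (t, u)) t) (Ioo (-δ) δ) t := fun t ht =>
    (hasDerivAt_slice (hu' t ht).2.2.2.2.1).differentiableAt.hasDerivAt.hasDerivWithinAt
  exact
    { nonneg := fun t ht => (hu' t ht).1.familyDensity_nonneg
      le := fun t ht => by
        have := (hu' t ht).2.2.2.2.2.1
        rw [mul_one, Real.norm_of_nonneg (hR _)] at this
        exact this
      diff := fun t ht => (hasDerivAt_slice (hu' t ht).2.1).differentiableAt
      der := fun t ht => (norm_deriv_slice_le (hu' t ht).2.1).trans (hu' t ht).2.2.2.2.2.2.1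
      diff_tension := fun t ht => (hasDerivAt_slice (hu' t ht).2.2.1).differentiableAt
      tension := fun t ht => (hu' t ht).2.2.2.2.2.2.2.1
      der_tension := fun t ht => by
        simpa using (norm_deriv_slice_le (hu' t ht).2.2.1).trans (hu' t ht).2.2.2.2.2.2.2.2.1
      diff_grad := fun t ht => (hasDerivAt_slice (hu' t ht).2.2.2.1).differentiableAt
      grad := fun t ht => (hu' t ht).2.2.2.2.2.2.2.2.2.1
      der_grad := fun t ht =>
        (norm_deriv_slice_le (hu' t ht).2.2.2.1).trans (hu' t ht).2.2.2.2.2.2.2.2.2.2.1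
      nonneg_snd := fun t ht => norm_nonneg _
      snd := fun t ht => by
        have hz : (0 : ℝ) ∈ Ioo (-δ) δ := ⟨by linarith [ht.1, ht.2], by linarith [ht.1, ht.2]⟩
        have key := (convex_Ioo (-δ) δ).norm_image_sub_le_of_norm_hasDerivWithin_le (C := K) hdB
          (fun r hr => by
            simpa using (norm_deriv_slice_le (hu' r hr).2.2.2.2.1).trans
              (hu' r hr).2.2.2.2.2.2.2.2.2.2.2) hz ht
        rw [sub_zero, Real.norm_eq_abs] at key
        linarith [norm_sub_norm_le (spaceDeriv (spaceDeriv f) (t, u))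
          (spaceDeriv (spaceDeriv f) (0, u))] }

/-- Decay of the `p`-tension field in a family that starts at a `p`-harmonic map. -/
theorem exists_coordTension_decay {u₀ : Coord m} (h : IsSmoothFamily G H f (0, u₀)) {p γ : ℝ}
    (hγ : 0 < γ) (hγ' : γ < 1) (hp : 3 - γ ≤ p)
    (h0 : ∀ᶠ u in 𝓝 u₀, coordTension G H p (fun u => f (0, u)) u = 0) :
    ∃ C ≥ 0, ∃ δ > 0, ∀ᶠ u in 𝓝 u₀, ∀ t ∈ Ioo (-δ) δ,
      ‖coordTension G H p (fun u => f (t, u)) u‖ ^ 2 ≤ C * (|t| ^ (2 - γ) *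
        (1 + (t ^ 2 + familyDensity G H f (0, u)) ^ (-(γ / 2)) *
          ‖spaceDeriv (spaceDeriv f) (0, u)‖ ^ 2)) := by
  obtain ⟨K, hK, δ, hδ, hδ1, hb⟩ := h.exists_pathBounds
  -- With s = (p - 2)/2 the condition 1 - γ ≤ 2s reads 3 - γ ≤ p.
  obtain ⟨C, hC, hdecay⟩ := PathBounds.exists_decay (F := Coord n) (s := (p - 2) / 2) hγ hγ'
    (by linarith) hK hδ1
  refine ⟨C, hC, δ, hδ, ?_⟩
  filter_upwards [hb, h0] with u hu hu0 t ht
  have hz : (0 : ℝ) ∈ Ioo (-δ) δ := ⟨by linarith, hδ⟩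
  have e : ∀ t ∈ Ioo (-δ) δ, coordTension G H p (fun u => f (t, u)) u = _ := fun t ht =>
    (hu.1 t ht).coordTension_eq (p := p) (by linarith)
  rw [e t ht]
  rw [e 0 hz] at hu0
  exact hdecay _ _ _ _ hu.2 hu0 t ht

end IsSmoothFamily

end

noncomputable section

/-! ### Uniform integrability of the singular weight by integration by parts. -/

section IntegrationByParts

open Filter Topology

/-- A primitive-like function whose derivative is comparable to `(ε ^ 2 + x ^ 2) ^ (-γ / 2)`. -/
theorem hasDerivAt_mul_rpow {γ ε : ℝ} (hε : 0 < ε) (x : ℝ) :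
    HasDerivAt (fun x => x * (ε + x ^ 2) ^ (-(γ / 2)))
      ((ε + x ^ 2) ^ (-(γ / 2)) + x * (2 * x * (-(γ / 2)) * (ε + x ^ 2) ^ (-(γ / 2) - 1))) x := by
  have h1 : HasDerivAt (fun x : ℝ => ε + x ^ 2) (2 * x) x := by
    simpa using (hasDerivAt_pow 2 x).const_add ε
  have h2 := h1.rpow_const (p := -(γ / 2)) (Or.inl (by positivity))
  have h3 : HasDerivAt (fun x => x * (ε + x ^ 2) ^ (-(γ / 2))) _ x := (hasDerivAt_id x).mul h2
  simpa using h3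

/-- As x² ≤ ε + x², the negative term costs at most the fraction γ of the first. The remaining
factor 1 - γ is the reason for requiring γ < 1 later. -/
theorem deriv_mul_rpow_ge {γ ε : ℝ} (hγ : 0 < γ) (hε : 0 < ε) (x : ℝ) :
    (1 - γ) * (ε + x ^ 2) ^ (-(γ / 2)) ≤
      (ε + x ^ 2) ^ (-(γ / 2)) + x * (2 * x * (-(γ / 2)) * (ε + x ^ 2) ^ (-(γ / 2) - 1)) := by
  have hq : 0 < ε + x ^ 2 := by positivity
  have h1 : x ^ 2 * (ε + x ^ 2) ^ (-(γ / 2) - 1) ≤ (ε + x ^ 2) ^ (-(γ / 2)) := by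
    rw [Real.rpow_sub_one hq.ne', mul_div_assoc', div_le_iff₀ hq, mul_comm]
    gcongr
    linarith
  have h2 := mul_le_mul_of_nonneg_left h1 hγ.le
  linarith

theorem abs_mul_rpow_le {γ ε : ℝ} (hγ : 0 < γ) (hγ' : γ < 1) (hε : 0 < ε) (x : ℝ) :
    |x * (ε + x ^ 2) ^ (-(γ / 2))| ≤ 1 + |x| := by
  have hq : 0 < ε + x ^ 2 := by positivity
  rw [abs_mul, abs_of_pos (Real.rpow_pos_of_pos hq _)]
  rcases le_total 1 (ε + x ^ 2) with h1 | h1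
  · have : (ε + x ^ 2) ^ (-(γ / 2)) ≤ 1 := Real.rpow_le_one_of_one_le_of_nonpos h1 (by linarith)
    nlinarith [abs_nonneg x]
  · have h2 : |x| ≤ (ε + x ^ 2) ^ (1 / 2 : ℝ) := by
      rw [← Real.sqrt_eq_rpow]
      exact Real.abs_le_sqrt (by linarith)
    have h3 : (ε + x ^ 2) ^ (1 / 2 : ℝ) * (ε + x ^ 2) ^ (-(γ / 2)) ≤ 1 := by
      rw [← Real.rpow_add hq]
      exact Real.rpow_le_one hq.le h1 (by linarith)
    have h4 : |x| * (ε + x ^ 2) ^ (-(γ / 2)) ≤ 1 :=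
      (mul_le_mul_of_nonneg_right h2 (by positivity)).trans h3
    linarith [abs_nonneg x]

variable {m : ℕ}

/-- Put Γ = f w with w = (ε + f²)^(-γ/2). Then (1 - γ) ∫ w (∂_v f)² ≤ ∫ ∂_v Γ ∂_v f = -∫ Γ ∂_v² f ≤
∫ (1 + |f|) |∂_v² f|, and the last integral does not involve ε. -/
theorem exists_lintegral_rpow_mul_sq_le {f : Coord m → ℝ} (hf : ContDiff ℝ 2 f)
    (hc : HasCompactSupport f) (v : Coord m) {γ : ℝ} (hγ : 0 < γ) (hγ' : γ < 1) :
    ∃ C ≥ 0, ∀ ε > 0,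
      Continuous (fun u => (ε + f u ^ 2) ^ (-(γ / 2)) * (fderiv ℝ f u v) ^ 2) ∧
      ∫⁻ u, ENNReal.ofReal ((ε + f u ^ 2) ^ (-(γ / 2)) * (fderiv ℝ f u v) ^ 2) ≤
        ENNReal.ofReal C := by
  set g : Coord m → ℝ := fun u => fderiv ℝ f u v with hg
  have hg1 : ContDiff ℝ 1 g := (hf.fderiv_right (m := 1) (by norm_num)).clm_apply contDiff_const
  have hgc : HasCompactSupport g := hc.fderiv_apply ℝ v
  have hg'c : HasCompactSupport (fun u => fderiv ℝ g u v) := hgc.fderiv_apply ℝ v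
  have hg'cont : Continuous fun u => fderiv ℝ g u v :=
    (hg1.continuous_fderiv (by norm_num)).clm_apply continuous_const
  have hgcont := hg1.continuous
  have hfcont := hf.continuous
  have hM : Integrable fun u => (1 + |f u|) * |fderiv ℝ g u v| := by
    refine Continuous.integrable_of_hasCompactSupport (by fun_prop) ?_
    exact (hg'c.comp_left (g := fun x : ℝ => |x|) abs_zero).mul_left
  refine ⟨(1 - γ)⁻¹ * ∫ u, (1 + |f u|) * |fderiv ℝ g u v|, mul_nonneg
    (inv_nonneg.2 (by linarith)) (integral_nonneg fun u => by positivity), fun ε hε => ?_⟩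
  set w : Coord m → ℝ := fun u => (ε + f u ^ 2) ^ (-(γ / 2)) with hw
  set Γ : Coord m → ℝ := fun u => f u * w u with hΓ
  set k : Coord m → ℝ := fun u => (ε + f u ^ 2) ^ (-(γ / 2)) +
    f u * (2 * f u * (-(γ / 2)) * (ε + f u ^ 2) ^ (-(γ / 2) - 1)) with hk
  have hq : ∀ u, ε + f u ^ 2 ≠ 0 := fun u => by positivity
  have hwcont : Continuous w := Continuous.rpow_const (by fun_prop) fun u => Or.inl (hq u)
  have hkcont : Continuous k :=
    hwcont.add (hfcont.mul ((by fun_prop : Continuous fun u => 2 * f u * (-(γ / 2))).mul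
      (Continuous.rpow_const (by fun_prop) fun u => Or.inl (hq u))))
  have hΓd : ∀ u, HasFDerivAt Γ (k u • fderiv ℝ f u) u := fun u =>
    (hasDerivAt_mul_rpow hε (f u)).comp_hasFDerivAt u
      (hf.differentiable (by norm_num)).differentiableAt.hasFDerivAt
  have hΓ' : ∀ u, fderiv ℝ Γ u v = k u * g u := fun u => by rw [(hΓd u).fderiv]; rfl
  have i1 : Integrable fun u => fderiv ℝ Γ u v * g u := by
    simp only [hΓ']
    exact ((hkcont.mul hgcont).mul hgcont).integrable_of_hasCompactSupport hgc.mul_left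
  have i2 : Integrable fun u => Γ u * fderiv ℝ g u v :=
    ((hfcont.mul hwcont).mul hg'cont).integrable_of_hasCompactSupport hg'c.mul_left
  have i3 : Integrable fun u => Γ u * g u :=
    ((hfcont.mul hwcont).mul hgcont).integrable_of_hasCompactSupport hgc.mul_left
  have ibp := integral_mul_fderiv_eq_neg_fderiv_mul_of_integrable i1 i2 i3
    (fun u _ => (hΓd u).differentiableAt)
    (fun u _ => (hg1.differentiable (by norm_num)).differentiableAt)
  have hkge : ∀ u, (1 - γ) * w u ≤ k u := fun u => deriv_mul_rpow_ge hγ hε (f u)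
  have i4 : Integrable fun u => w u * g u ^ 2 := by
    have h1 : HasCompactSupport fun u => g u ^ 2 :=
      hgc.comp_left (g := fun x : ℝ => x ^ 2) (by simp)
    exact (hwcont.mul (hgcont.pow 2)).integrable_of_hasCompactSupport h1.mul_left
  have hw0 : ∀ u, 0 ≤ w u := fun u => Real.rpow_nonneg (by positivity) _
  have hpt : ∀ u, (1 - γ) * (w u * g u ^ 2) ≤ fderiv ℝ Γ u v * g u := fun u => by
    rw [hΓ', ← mul_assoc, pow_two, mul_assoc (k u)]
    exact mul_le_mul_of_nonneg_right (hkge u) (mul_self_nonneg _)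
  have hpt' : ∀ u, -(Γ u * fderiv ℝ g u v) ≤ (1 + |f u|) * |fderiv ℝ g u v| := fun u => by
    refine (neg_le_abs _).trans ?_
    rw [abs_mul]
    exact mul_le_mul_of_nonneg_right (abs_mul_rpow_le hγ hγ' hε (f u)) (abs_nonneg _)
  refine ⟨hwcont.mul (hgcont.pow 2), ?_⟩
  rw [← ofReal_integral_eq_lintegral_ofReal i4
    (Eventually.of_forall fun u => mul_nonneg (hw0 u) (sq_nonneg _))]
  refine ENNReal.ofReal_le_ofReal ?_
  rw [le_inv_mul_iff₀ (by linarith)]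
  calc (1 - γ) * ∫ u, w u * g u ^ 2 = ∫ u, (1 - γ) * (w u * g u ^ 2) :=
        (integral_const_mul _ _).symm
    _ ≤ ∫ u, fderiv ℝ Γ u v * g u := by
        exact integral_mono (i4.const_mul _) i1 hpt
    _ = ∫ u, -(Γ u * fderiv ℝ g u v) := by rw [integral_neg, ibp, neg_neg]
    _ ≤ ∫ u, (1 + |f u|) * |fderiv ℝ g u v| := by
        exact integral_mono i2.neg hM hpt'

/-- The local version of `exists_lintegral_rpow_mul_sq_le`. -/
theorem exists_nhds_lintegral_rpow_mul_sq_le {f : Coord m → ℝ} {u₀ : Coord m}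
    (hf : ∀ᶠ u in 𝓝 u₀, ContDiffAt ℝ 2 f u) (v : Coord m) {γ : ℝ} (hγ : 0 < γ) (hγ' : γ < 1) :
    ∃ C ≥ 0, ∀ᶠ U in (𝓝 u₀).smallSets, ∀ ε > 0,
      AEMeasurable (fun u => (ε + f u ^ 2) ^ (-(γ / 2)) * (fderiv ℝ f u v) ^ 2)
        (volume.restrict U) ∧
      ∫⁻ u in U, ENNReal.ofReal ((ε + f u ^ 2) ^ (-(γ / 2)) * (fderiv ℝ f u v) ^ 2) ≤
        ENNReal.ofReal C := by
  obtain ⟨r, hr, hball⟩ := Metric.eventually_nhds_iff_ball.1 hf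
  -- Multiply by a bump function that is 1 near u₀ and supported where f is C²; near u₀ neither f
  -- nor its derivative changes.
  let χ : ContDiffBump u₀ := ⟨r / 4, r / 2, by positivity, by linarith⟩
  have hts : tsupport χ ⊆ Metric.ball u₀ r := by
    rw [χ.tsupport_eq]
    exact Metric.closedBall_subset_ball (by simp only [χ]; linarith)
  have hg : ContDiff ℝ 2 fun u => χ u * f u := by
    refine (contMDiff_of_tsupport fun u hu => ContDiffAt.contMDiffAt ?_).contDiff
    exact χ.contDiffAt.mul (hball u (hts (tsupport_mul_subset_left hu)))
  obtain ⟨C, hC, hint⟩ := exists_lintegral_rpow_mul_sq_le hg χ.hasCompactSupport.mul_right v hγ hγ'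
  refine ⟨C, hC, ?_⟩
  have hU : ∀ᶠ u in 𝓝 u₀, (fun u => χ u * f u) =ᶠ[𝓝 u] f := by
    refine eventually_eventually_nhds.2 ?_
    filter_upwards [χ.eventuallyEq_one] with u hu
    simp [hu]
  have hopen : ∃ V ∈ 𝓝 u₀, MeasurableSet V ∧ ∀ u ∈ V, (fun u => χ u * f u) =ᶠ[𝓝 u] f := by
    obtain ⟨V, hV, hVo, hmem⟩ := eventually_nhds_iff.1 hU
    exact ⟨V, hVo.mem_nhds hmem, hVo.measurableSet, hV⟩
  obtain ⟨V, hV, hVm, hVe⟩ := hopen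
  filter_upwards [eventually_smallSets_subset.2 hV] with U hUV ε hε
  have he : ∀ u ∈ V, (ε + (χ u * f u) ^ 2) ^ (-(γ / 2)) *
      (fderiv ℝ (fun u => χ u * f u) u v) ^ 2 =
      (ε + f u ^ 2) ^ (-(γ / 2)) * (fderiv ℝ f u v) ^ 2 := fun u hu => by
    rw [(hVe u hu).fderiv_eq, (hVe u hu).eq_of_nhds]
  refine ⟨?_, ?_⟩
  · refine AEMeasurable.mono_measure ?_ (Measure.restrict_mono hUV le_rfl)
    exact (hint ε hε).1.aemeasurable.congr ((ae_restrict_mem hVm).mono fun u hu => he u hu)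
  · refine (lintegral_mono_set hUV).trans (le_trans ?_ (hint ε hε).2)
    refine le_trans (le_of_eq ?_) (setLIntegral_le_lintegral V _)
    exact setLIntegral_congr_fun hVm fun u hu => by simp only [he u hu]

end IntegrationByParts

end

noncomputable section

/-! ### The weighted integral of the second derivatives. -/

section LocalDecay

open Filter Topology Asymptotics

variable {m n : ℕ}

theorem abs_apply_le_norm (v : Coord m) (i : Fin m) : |v i| ≤ ‖v‖ := by
  simpa using PiLp.norm_apply_le v i

theorem norm_le_sum_abs (v : Coord m) : ‖v‖ ≤ ∑ i, |v i| := by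
  conv_lhs => rw [← sum_coord_smul_stdVec v]
  refine (norm_sum_le _ _).trans (Finset.sum_le_sum fun i _ => ?_)
  simp [norm_smul, stdVec]

theorem norm_clm_le_sum {F : Type*} [NormedAddCommGroup F] [NormedSpace ℝ F]
    (L : Coord m →L[ℝ] F) : ‖L‖ ≤ ∑ i, ‖L (stdVec i)‖ := by
  refine L.opNorm_le_bound (Finset.sum_nonneg fun i _ => norm_nonneg _) fun v => ?_
  conv_lhs => rw [← sum_coord_smul_stdVec v]
  rw [map_sum, Finset.sum_mul]
  refine (norm_sum_le _ _).trans (Finset.sum_le_sum fun i _ => ?_)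
  rw [map_smul, norm_smul, mul_comm]
  exact mul_le_mul_of_nonneg_left (abs_apply_le_norm v i) (norm_nonneg _)

theorem sq_norm_le_sum (B : Coord m →L[ℝ] Coord m →L[ℝ] Coord n) :
    ‖B‖ ^ 2 ≤ (Fintype.card (Fin m × Fin m × Fin n)) *
      ∑ x : Fin m × Fin m × Fin n, ((B (stdVec x.1) (stdVec x.2.1)) x.2.2) ^ 2 := by
  have h1 : ‖B‖ ≤ ∑ x : Fin m × Fin m × Fin n, |(B (stdVec x.1) (stdVec x.2.1)) x.2.2| := by
    simp only [Fintype.sum_prod_type]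
    refine (norm_clm_le_sum B).trans (Finset.sum_le_sum fun i _ => ?_)
    refine (norm_clm_le_sum _).trans (Finset.sum_le_sum fun j _ => ?_)
    exact norm_le_sum_abs _
  refine (pow_le_pow_left₀ B.opNorm_nonneg h1 2).trans ?_
  refine (sq_sum_le_card_mul_sum_sq).trans_eq ?_
  simp [sq_abs]

theorem rpow_neg_half_le {γ A y z : ℝ} (hγ : 0 < γ) (hA : 0 ≤ A) (hy : 0 < y) (hz : 0 < z)
    (h : z ≤ A * y) : y ^ (-(γ / 2)) ≤ A ^ (γ / 2) * z ^ (-(γ / 2)) := by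
  have h2 : z ^ (γ / 2) ≤ A ^ (γ / 2) * y ^ (γ / 2) := by
    rw [← Real.mul_rpow hA hy.le]
    exact Real.rpow_le_rpow hz.le h (by positivity)
  rw [Real.rpow_neg hy.le, Real.rpow_neg hz.le, ← div_eq_mul_inv,
    le_div_iff₀ (by positivity), inv_mul_le_iff₀ (by positivity)]
  linarith

variable {G : Coord m → Bilin m} {H : Coord n → Bilin n} {f : ℝ × Coord m → Coord n}

namespace IsSmoothFamily

/-- The weighted square of the second derivatives is uniformly integrable. -/
theorem exists_lintegral_weight_le {u₀ : Coord m} (h : IsSmoothFamily G H f (0, u₀)) {γ : ℝ}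
    (hγ : 0 < γ) (hγ' : γ < 1) :
    ∃ C ≥ 0, ∀ᶠ U in (𝓝 u₀).smallSets, MeasurableSet U → ∀ ε > 0,
      ∫⁻ u in U, ENNReal.ofReal ((ε + familyDensity G H f (0, u)) ^ (-(γ / 2)) *
          ‖spaceDeriv (spaceDeriv f) (0, u)‖ ^ 2) ≤ ENNReal.ofReal C := by
  -- The components of df at time 0. The first index is the direction in which the component is
  -- differentiated again, so these derivatives are all the entries of D²f.
  let a : Fin m × Fin m × Fin n → Coord m → ℝ := fun x u => (spaceDeriv f (0, u) (stdVec x.2.1)) x.2.2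
  have hslice : ∀ᶠ u in 𝓝 u₀, IsSmoothFamily G H f (0, u) :=
    (tendsto_slice (0, u₀)).eventually h.eventually
  have ha : ∀ x, ∀ᶠ u in 𝓝 u₀, ContDiffAt ℝ 2 (a x) u ∧ fderiv ℝ (a x) u (stdVec x.1) =
      (spaceDeriv (spaceDeriv f) (0, u) (stdVec x.1) (stdVec x.2.1)) x.2.2 := by
    intro x
    filter_upwards [hslice] with u hu
    have h1 := hu.map.self_of_nhds.spaceDeriv
    let P : Coord n →L[ℝ] ℝ := EuclideanSpace.proj x.2.2
    have h2 : ContDiffAt ℝ ∞ (fun u => spaceDeriv f (0, u)) u :=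
      ContDiffAt.comp u (f := fun u : Coord m => ((0 : ℝ), u)) h1
        (contDiffAt_const.prodMk contDiffAt_id)
    have h3 : ContDiffAt ℝ ∞ (a x) u :=
      P.contDiff.contDiffAt.comp u (h2.clm_apply contDiffAt_const)
    refine ⟨h3.of_le ENat.LEInfty.out, ?_⟩
    have h4 := fderiv_slice (z := (0, u)) (h1.differentiableAt (by simp))
    have h5 : HasFDerivAt (a x) _ u := P.hasFDerivAt.comp u
      ((h2.differentiableAt (by simp)).hasFDerivAt.clm_apply (hasFDerivAt_const (stdVec x.2.1) u))
    rw [h5.fderiv, h4]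
    simp [P]
  choose C hC hint using fun x => exists_nhds_lintegral_rpow_mul_sq_le
    ((ha x).mono fun u hu => hu.1) (stdVec x.1) hγ hγ'
  obtain ⟨c, hc, hlow⟩ := h.exists_sq_le_familyDensity
  -- Chosen so that ε + a² ≤ A (ε + e) for each component a of df. As the exponent is negative, the
  -- weight formed with e is bounded by that formed with any single component.
  set A := max 1 c⁻¹ with hA
  set N : ℝ := (Fintype.card (Fin m × Fin m × Fin n) : ℝ) with hN
  have hA0 : 0 ≤ A := by positivity
  refine ⟨A ^ (γ / 2) * N * ∑ x, C x,
    mul_nonneg (by positivity) (Finset.sum_nonneg fun x _ => hC x), ?_⟩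
  have hgood : ∀ᶠ u in 𝓝 u₀, (c * ‖spaceDeriv f (0, u)‖ ^ 2 ≤ familyDensity G H f (0, u)) ∧
      (0 ≤ familyDensity G H f (0, u)) ∧ ∀ x, fderiv ℝ (a x) u (stdVec x.1) =
      (spaceDeriv (spaceDeriv f) (0, u) (stdVec x.1) (stdVec x.2.1)) x.2.2 := by
    filter_upwards [(tendsto_slice (0, u₀)).eventually hlow, hslice,
      eventually_all.2 ha] with u h1 h2 h3
    exact ⟨h1, h2.familyDensity_nonneg, fun x => (h3 x).2⟩
  filter_upwards [eventually_all.2 hint, eventually_smallSets_subset.2 hgood] with U hU hUg hUm ε hε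
  have hpt : ∀ u ∈ U, (ε + familyDensity G H f (0, u)) ^ (-(γ / 2)) *
      ‖spaceDeriv (spaceDeriv f) (0, u)‖ ^ 2 ≤
      A ^ (γ / 2) * N * ∑ x, ((ε + a x u ^ 2) ^ (-(γ / 2)) *
        (fderiv ℝ (a x) u (stdVec x.1)) ^ 2) := by
    intro u hu
    obtain ⟨h1, h2, h3⟩ := hUg hu
    have hax : ∀ x, (ε + familyDensity G H f (0, u)) ^ (-(γ / 2)) ≤
        A ^ (γ / 2) * (ε + a x u ^ 2) ^ (-(γ / 2)) := by
      intro x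
      refine rpow_neg_half_le hγ hA0 (by positivity) (by positivity) ?_
      have k1 : |a x u| ≤ ‖spaceDeriv f (0, u)‖ := by
        refine (abs_apply_le_norm _ _).trans ?_
        have := (spaceDeriv f (0, u)).le_opNorm (stdVec x.2.1)
        simpa [stdVec] using this
      have k2 : a x u ^ 2 ≤ ‖spaceDeriv f (0, u)‖ ^ 2 := by
        rw [← sq_abs]; gcongr
      have k3 : ‖spaceDeriv f (0, u)‖ ^ 2 ≤ c⁻¹ * familyDensity G H f (0, u) := by
        rw [le_inv_mul_iff₀ hc]; exact h1
      have k4 : c⁻¹ * familyDensity G H f (0, u) ≤ A * familyDensity G H f (0, u) :=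
        mul_le_mul_of_nonneg_right (le_max_right _ _) h2
      have k5 : ε ≤ A * ε := le_mul_of_one_le_left hε.le (le_max_left _ _)
      linarith
    calc (ε + familyDensity G H f (0, u)) ^ (-(γ / 2)) * ‖spaceDeriv (spaceDeriv f) (0, u)‖ ^ 2
        ≤ (ε + familyDensity G H f (0, u)) ^ (-(γ / 2)) *
          (N * ∑ x : Fin m × Fin m × Fin n, (fderiv ℝ (a x) u (stdVec x.1)) ^ 2) := by
          refine mul_le_mul_of_nonneg_left ?_ (by positivity)
          simp only [h3]
          exact sq_norm_le_sum _
      _ = N * ∑ x, ((ε + familyDensity G H f (0, u)) ^ (-(γ / 2)) *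
          (fderiv ℝ (a x) u (stdVec x.1)) ^ 2) := by
          rw [Finset.mul_sum, Finset.mul_sum, Finset.mul_sum]
          exact Finset.sum_congr rfl fun x _ => by ring
      _ ≤ N * ∑ x, ((A ^ (γ / 2) * (ε + a x u ^ 2) ^ (-(γ / 2))) *
          (fderiv ℝ (a x) u (stdVec x.1)) ^ 2) := by
          refine mul_le_mul_of_nonneg_left (Finset.sum_le_sum fun x _ => ?_) (by positivity)
          exact mul_le_mul_of_nonneg_right (hax x) (sq_nonneg _)
      _ = _ := by
          rw [mul_comm _ N, mul_assoc N, Finset.mul_sum (a := A ^ (γ / 2))]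
          congr 1
          exact Finset.sum_congr rfl fun x _ => by ring
  have hnn : ∀ x u, 0 ≤ (ε + a x u ^ 2) ^ (-(γ / 2)) * (fderiv ℝ (a x) u (stdVec x.1)) ^ 2 :=
    fun x u => mul_nonneg (Real.rpow_nonneg (by positivity) _) (sq_nonneg _)
  have hAN : 0 ≤ A ^ (γ / 2) * N := by positivity
  calc _ ≤ ∫⁻ u in U, ENNReal.ofReal (A ^ (γ / 2) * N) * ∑ x, ENNReal.ofReal
        ((ε + a x u ^ 2) ^ (-(γ / 2)) * (fderiv ℝ (a x) u (stdVec x.1)) ^ 2) := by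
        refine setLIntegral_mono' hUm fun u hu => ?_
        rw [← ENNReal.ofReal_sum_of_nonneg fun x _ => hnn x u, ← ENNReal.ofReal_mul hAN]
        exact ENNReal.ofReal_le_ofReal (hpt u hu)
    _ = ENNReal.ofReal (A ^ (γ / 2) * N) * ∑ x, ∫⁻ u in U, ENNReal.ofReal
        ((ε + a x u ^ 2) ^ (-(γ / 2)) * (fderiv ℝ (a x) u (stdVec x.1)) ^ 2) := by
        rw [lintegral_const_mul' _ _ ENNReal.ofReal_ne_top,
          lintegral_finsetSum' _ fun x _ => (hU x ε hε).1.ennreal_ofReal]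
    _ ≤ ENNReal.ofReal (A ^ (γ / 2) * N) * ∑ x, ENNReal.ofReal (C x) := by
        gcongr with x
        exact (hU x ε hε).2
    _ = _ := by
        rw [← ENNReal.ofReal_sum_of_nonneg fun x _ => hC x, ← ENNReal.ofReal_mul hAN]

end IsSmoothFamily

end LocalDecay

end

noncomputable section

/-! ### Regularity and mean decay of the p-tension field of a family. -/

section FamilyPTension

open Filter Topology Asymptotics

variable {m n : ℕ}

/-- The `p`-tension field of a family of maps. -/
def familyPTension (G : Coord m → Bilin m) (H : Coord n → Bilin n) (p : ℝ)
    (f : ℝ × Coord m → Coord n) (z : ℝ × Coord m) : Coord n :=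
  coordTension G H p (fun u => f (z.1, u)) z.2

/-- The squared norm of the `p`-tension field of a family of maps. -/
def familyPTensionSq (G : Coord m → Bilin m) (H : Coord n → Bilin n) (p : ℝ)
    (f : ℝ × Coord m → Coord n) (z : ℝ × Coord m) : ℝ :=
  H (f z) (familyPTension G H p f z) (familyPTension G H p f z)

/-- A `C¹` function is locally Lipschitz in time, uniformly in space. -/
theorem ContDiffAt.exists_lipschitz_slice {W : Type*} [NormedAddCommGroup W] [NormedSpace ℝ W]
    {X : ℝ × Coord m → W} {t₀ : ℝ} {u₀ : Coord m} (hX : ContDiffAt ℝ ∞ X (t₀, u₀)) :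
    ∃ K ≥ 0, ∃ δ > 0, ∀ᶠ u in 𝓝 u₀, ∀ t ∈ Ioo (t₀ - δ) (t₀ + δ),
      ‖X (t, u) - X (t₀, u)‖ ≤ K * |t - t₀| := by
  obtain ⟨K, S, hS, hK⟩ := (hX.of_le (m := 1) ENat.LEInfty.out).exists_lipschitzOnWith
  obtain ⟨δ, hδ, hbox⟩ := IsSmoothFamily.exists_box hS
  refine ⟨K, K.2, δ, hδ, hbox.mono fun u hu t ht => ?_⟩
  have := hK.dist_le_mul _ (hu t ht) _ (hu t₀ ⟨by linarith, by linarith⟩)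
  rw [dist_eq_norm] at this
  simpa [Prod.dist_eq, Real.dist_eq] using this

variable {G : Coord m → Bilin m} {H : Coord n → Bilin n} {f : ℝ × Coord m → Coord n} {p : ℝ}

namespace IsSmoothFamily

section

variable {z : ℝ × Coord m}

theorem familyGradient_eq_zero (h : IsSmoothFamily G H f z)
    (h0 : familyDensity G H f z = 0) : familyGradient G H f z = 0 := by
  simp [familyGradient, metricTrace, h.spaceDeriv_eq_zero h0]

theorem familyPTension_eq_zero (h : IsSmoothFamily G H f z) (hp : 2 < p)
    (h0 : familyDensity G H f z = 0) : familyPTension G H p f z = 0 := by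
  rw [familyPTension, h.coordTension_eq hp.le, h.familyGradient_eq_zero h0, h0,
    Real.zero_rpow (by linarith)]
  simp

theorem contDiffAt_familyPTension (h : IsSmoothFamily G H f z) (hp : 2 ≤ p)
    (h0 : p = 2 ∨ 0 < familyDensity G H f z) : ContDiffAt ℝ ∞ (familyPTension G H p f) z := by
  have hev : familyPTension G H p f =ᶠ[𝓝 z] fun z =>
      familyDensity G H f z ^ ((p - 2) / 2) • familyTension G H f z +
        ((p - 2) / 2 * familyDensity G H f z ^ ((p - 2) / 2 - 1)) • familyGradient G H f z :=
    h.eventually.mono fun y hy => hy.coordTension_eq hp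
  refine ContDiffAt.congr_of_eventuallyEq ?_ hev
  rcases h0 with rfl | h0
  · simpa using h.contDiffAt_familyTension
  · have hE := h.contDiffAt_familyDensity
    exact ((hE.rpow_const_of_ne h0.ne').smul h.contDiffAt_familyTension).add
      ((contDiffAt_const.mul (hE.rpow_const_of_ne h0.ne')).smul h.contDiffAt_familyGradient)

/-- Only a zero of e with p > 2 needs an argument. There e^s tends to 0, and the gradient term is
O(e), so multiplied by e^(s-1) it is O(e^s). -/
theorem continuousAt_familyPTension (h : IsSmoothFamily G H f z) (hp : 2 ≤ p) :
    ContinuousAt (familyPTension G H p f) z := by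
  rcases eq_or_lt_of_le hp with rfl | hp'
  · exact (h.contDiffAt_familyPTension le_rfl (Or.inl rfl)).continuousAt
  rcases h.familyDensity_nonneg.eq_or_lt' with h0 | h0
  swap
  · exact (h.contDiffAt_familyPTension hp (Or.inr h0)).continuousAt
  have hev : familyPTension G H p f =ᶠ[𝓝 z] fun z =>
      familyDensity G H f z ^ ((p - 2) / 2) • familyTension G H f z +
        ((p - 2) / 2 * familyDensity G H f z ^ ((p - 2) / 2 - 1)) • familyGradient G H f z :=
    h.eventually.mono fun y hy => hy.coordTension_eq hp
  have hs : 0 < (p - 2) / 2 := by linarith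
  have hrp : Tendsto (fun z => familyDensity G H f z ^ ((p - 2) / 2)) (𝓝 z) (𝓝 0) := by
    have := h.contDiffAt_familyDensity.continuousAt.rpow_const (p := (p - 2) / 2) (Or.inr hs.le)
    rwa [ContinuousAt, h0, Real.zero_rpow hs.ne'] at this
  have h1 : Tendsto (fun z => familyDensity G H f z ^ ((p - 2) / 2) • familyTension G H f z)
      (𝓝 z) (𝓝 0) := by
    simpa using hrp.smul h.contDiffAt_familyTension.continuousAt
  have h2 : Tendsto (fun z => ((p - 2) / 2 * familyDensity G H f z ^ ((p - 2) / 2 - 1)) •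
      familyGradient G H f z) (𝓝 z) (𝓝 0) := by
    have hO : (fun z => ((p - 2) / 2 * familyDensity G H f z ^ ((p - 2) / 2 - 1)) •
        familyGradient G H f z) =O[𝓝 z] fun z => familyDensity G H f z ^ ((p - 2) / 2) := by
      have hY : familyGradient G H f =O[𝓝 z] familyDensity G H f := by
        have h3 := h.hasOrder_familyGradient.val.trans
          ((isBigO_refl (fun z => root G H f z * root G H f z) (𝓝 z)).mul h.jetSize_isBigO_one)
        refine h3.congr' EventuallyEq.rfl ?_
        filter_upwards [h.eventually] with y hy
        rw [mul_one, root, Real.mul_self_sqrt hy.familyDensity_nonneg]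
      have h4 := (isBigO_refl (fun z => (p - 2) / 2 * familyDensity G H f z ^ ((p - 2) / 2 - 1))
        (𝓝 z)).smul hY
      refine h4.trans (IsBigO.of_bound ((p - 2) / 2) ?_)
      filter_upwards [h.eventually] with y hy
      rw [smul_eq_mul, Real.norm_of_nonneg (Real.rpow_nonneg hy.familyDensity_nonneg _)]
      rcases hy.familyDensity_nonneg.eq_or_lt' with h5 | h5
      · simp only [h5, mul_zero, norm_zero]
        exact mul_nonneg hs.le (Real.rpow_nonneg le_rfl _)
      · rw [mul_assoc, ← Real.rpow_add_one h5.ne', sub_add_cancel, Real.norm_of_nonneg]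
        exact mul_nonneg hs.le (Real.rpow_nonneg h5.le _)
    exact hO.trans_tendsto hrp
  have h3 := (h1.add h2).congr' hev.symm
  rwa [ContinuousAt, h.familyPTension_eq_zero hp' h0, ← add_zero (0 : Coord n)]

theorem continuousAt_familyPTensionSq (h : IsSmoothFamily G H f z) (hp : 2 ≤ p) :
    ContinuousAt (familyPTensionSq G H p f) z :=
  (h.contDiffAt_target.continuousAt.clm_apply (h.continuousAt_familyPTension hp)).clm_apply
    (h.continuousAt_familyPTension hp)

/-- A nonzero p-tension forces p = 2 or df ≠ 0, and in both cases the powers of the density cause no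
loss of smoothness. -/
theorem contDiffAt_familyPTensionSq (h : IsSmoothFamily G H f z) (hp : 2 ≤ p)
    (h0 : familyPTensionSq G H p f z ≠ 0) : ContDiffAt ℝ ∞ (familyPTensionSq G H p f) z := by
  have h1 : p = 2 ∨ 0 < familyDensity G H f z := by
    rcases eq_or_lt_of_le hp with rfl | hp'
    · exact Or.inl rfl
    refine Or.inr (h.familyDensity_nonneg.lt_of_ne' fun h2 => h0 ?_)
    simp [familyPTensionSq, h.familyPTension_eq_zero hp' h2]
  have h2 := h.contDiffAt_familyPTension hp h1
  exact (h.contDiffAt_target.clm_apply h2).clm_apply h2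

end

/-- A power decay rate valid for families of maps starting from a `p`-harmonic map. -/
theorem exists_coordTension_weight_decay {u₀ : Coord m} {η : ℝ}
    (h : IsSmoothFamily G H f (0, u₀)) (hη : 1 < η) (hη' : η ≤ 3 / 2) (hp : p = 2 ∨ 1 + η ≤ p)
    (h0 : ∀ᶠ u in 𝓝 u₀, familyPTension G H p f (0, u) = 0) :
    ∃ C ≥ 0, ∃ δ > 0, ∀ᶠ u in 𝓝 u₀, ∀ t ∈ Ioo (-δ) δ, t ≠ 0 →
      ‖familyPTension G H p f (t, u)‖ ^ 2 ≤ C * |t| ^ η * (1 +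
        (t ^ 2 + familyDensity G H f (0, u)) ^ (-((2 - η) / 2)) *
          ‖spaceDeriv (spaceDeriv f) (0, u)‖ ^ 2) := by
  rcases hp with rfl | hp
  -- For p = 2 the tension field is smooth, so its square is O(t²), which is better than |t|^η for
  -- |t| ≤ 1.
  · obtain ⟨K, hK, δ, hδ, hbox⟩ :=
      (h.contDiffAt_familyPTension le_rfl (Or.inl rfl)).exists_lipschitz_slice
    refine ⟨K ^ 2, by positivity, min δ 1, by positivity, ?_⟩
    filter_upwards [hbox, h0, (tendsto_slice (0, u₀)).eventually h.eventually]
      with u h1 h2 h3 t ht ht0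
    have h4 := h1 t ⟨by linarith [ht.1, min_le_left δ 1], by linarith [ht.2, min_le_left δ 1]⟩
    rw [h2, sub_zero, sub_zero] at h4
    have ht1 : |t| ≤ 1 := abs_le.2 ⟨by linarith [ht.1, min_le_right δ 1],
      by linarith [ht.2, min_le_right δ 1]⟩
    have h5 : |t| ^ (2 : ℝ) ≤ |t| ^ η :=
      Real.rpow_le_rpow_of_exponent_ge (abs_pos.2 ht0) ht1 (by linarith)
    have h6 := h3.familyDensity_nonneg
    have h7 : 0 ≤ (t ^ 2 + familyDensity G H f (0, u)) ^ (-((2 - η) / 2)) *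
          ‖spaceDeriv (spaceDeriv f) (0, u)‖ ^ 2 :=
      mul_nonneg (Real.rpow_nonneg (by positivity) _) (sq_nonneg _)
    calc _ ≤ (K * |t|) ^ 2 := by gcongr
      _ = K ^ 2 * |t| ^ (2 : ℝ) := by rw [mul_pow, Real.rpow_two]
      _ ≤ K ^ 2 * |t| ^ η := by gcongr
      _ ≤ _ := le_mul_of_one_le_right (by positivity) (by linarith)
  -- The rate |t|^η is |t|^(2-γ), and p ≥ 1 + η is p ≥ 3 - γ.
  · obtain ⟨C, hC, δ, hδ, hbox⟩ := h.exists_coordTension_decay (p := p) (γ := 2 - η)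
      (by linarith) (by linarith) (by linarith) h0
    refine ⟨C, hC, δ, hδ, hbox.mono fun u hu t ht _ => (hu t ht).trans_eq ?_⟩
    rw [sub_sub_cancel, mul_assoc]

/-- The squared `p`-tension field of a family of maps starting from a `p`-harmonic map decays
faster than linearly in the mean. -/
theorem exists_lintegral_familyPTensionSq_le {u₀ : Coord m} {η : ℝ}
    (h : IsSmoothFamily G H f (0, u₀)) (hη : 1 < η) (hη' : η ≤ 3 / 2) (hp : p = 2 ∨ 1 + η ≤ p)
    (h0 : ∀ᶠ u in 𝓝 u₀, familyPTension G H p f (0, u) = 0) :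
    ∃ C ≥ 0, ∃ δ > 0, ∀ᶠ U in (𝓝 u₀).smallSets, MeasurableSet U → ∀ t ∈ Ioo (-δ) δ,
      ∫⁻ u in U, ENNReal.ofReal (familyPTensionSq G H p f (t, u)) ≤
        ENNReal.ofReal (C * |t| ^ η) := by
  obtain ⟨C₁, hC₁, δ₁, hδ₁, hdec⟩ := h.exists_coordTension_weight_decay hη hη' hp h0
  obtain ⟨C₂, hC₂, hint⟩ := h.exists_lintegral_weight_le (γ := 2 - η) (by linarith) (by linarith)
  have hH : ∀ᶠ z in 𝓝 ((0 : ℝ), u₀), ‖H (f z)‖ < ‖H (f (0, u₀))‖ + 1 :=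
    h.contDiffAt_target.continuousAt.norm.eventually_lt continuousAt_const (lt_add_one _)
  obtain ⟨δ₂, hδ₂, hHbox⟩ := IsSmoothFamily.exists_box hH
  set K := ‖H (f (0, u₀))‖ + 1 with hKdef
  have hK : 0 ≤ K := by positivity
  obtain ⟨V, hV⟩ : ∃ V : ℝ, volume (Metric.ball u₀ 1) = ENNReal.ofReal V :=
    ⟨_, (ENNReal.ofReal_toReal measure_ball_lt_top.ne).symm⟩
  have hslice : ∀ᶠ u in 𝓝 u₀, IsSmoothFamily G H f (0, u) :=
    (tendsto_slice (0, u₀)).eventually h.eventually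
  refine ⟨K * C₁ * (max V 0 + C₂), by positivity, min δ₁ δ₂, by positivity, ?_⟩
  filter_upwards [hint, eventually_smallSets_subset.2 hdec, eventually_smallSets_subset.2 hHbox,
    eventually_smallSets_subset.2 h0, eventually_smallSets_subset.2 hslice,
    eventually_smallSets_subset.2 (Metric.ball_mem_nhds u₀ one_pos)] with U h1 h2 h3 h4 h5 h6 hU t ht
  rcases eq_or_ne t 0 with rfl | ht0
  · have : ∀ u ∈ U, ENNReal.ofReal (familyPTensionSq G H p f (0, u)) = 0 := fun u hu => by
      have := h4 hu
      simp only [Set.mem_ofPred_eq] at this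
      simp [familyPTensionSq, this]
    rw [setLIntegral_congr_fun hU this]
    simp
  have hpt : ∀ u ∈ U, ENNReal.ofReal (familyPTensionSq G H p f (t, u)) ≤
      ENNReal.ofReal (K * C₁ * |t| ^ η) * (1 + ENNReal.ofReal
        ((t ^ 2 + familyDensity G H f (0, u)) ^ (-((2 - η) / 2)) *
          ‖spaceDeriv (spaceDeriv f) (0, u)‖ ^ 2)) := by
    intro u hu
    have k1 := h2 hu t ⟨by linarith [ht.1, min_le_left δ₁ δ₂],
      by linarith [ht.2, min_le_left δ₁ δ₂]⟩ ht0
    have k2 := h3 hu t ⟨by linarith [ht.1, min_le_right δ₁ δ₂],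
      by linarith [ht.2, min_le_right δ₁ δ₂]⟩
    have k3 := (h5 hu).familyDensity_nonneg
    have k4 : 0 ≤ (t ^ 2 + familyDensity G H f (0, u)) ^ (-((2 - η) / 2)) *
          ‖spaceDeriv (spaceDeriv f) (0, u)‖ ^ 2 :=
      mul_nonneg (Real.rpow_nonneg (by positivity) _) (sq_nonneg _)
    rw [← ENNReal.ofReal_one, ← ENNReal.ofReal_add zero_le_one k4,
      ← ENNReal.ofReal_mul (by positivity)]
    refine ENNReal.ofReal_le_ofReal ?_
    have k5 : familyPTensionSq G H p f (t, u) ≤ K * ‖familyPTension G H p f (t, u)‖ ^ 2 := by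
      refine (le_abs_self _).trans ?_
      have := (H (f (t, u))).le_opNorm₂ (familyPTension G H p f (t, u))
        (familyPTension G H p f (t, u))
      rw [Real.norm_eq_abs, mul_assoc, ← sq] at this
      exact this.trans (mul_le_mul_of_nonneg_right k2.le (sq_nonneg _))
    refine k5.trans ((mul_le_mul_of_nonneg_left k1 hK).trans_eq (by ring))
  calc _ ≤ ∫⁻ u in U, ENNReal.ofReal (K * C₁ * |t| ^ η) * (1 + ENNReal.ofReal
        ((t ^ 2 + familyDensity G H f (0, u)) ^ (-((2 - η) / 2)) *
          ‖spaceDeriv (spaceDeriv f) (0, u)‖ ^ 2)) := setLIntegral_mono' hU hpt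
    _ ≤ ENNReal.ofReal (K * C₁ * |t| ^ η) * (ENNReal.ofReal (max V 0) + ENNReal.ofReal C₂) := by
        rw [lintegral_const_mul' _ _ ENNReal.ofReal_ne_top, lintegral_add_left measurable_const]
        gcongr
        · rw [setLIntegral_const, one_mul]
          exact (measure_mono h6).trans (hV.le.trans (ENNReal.ofReal_le_ofReal (le_max_left _ _)))
        -- The weighted bound with ε = t²: its uniformity in ε keeps the rate |t|^η intact.
        · exact h1 hU (t ^ 2) (by positivity)
    _ = _ := by
        rw [← ENNReal.ofReal_add (le_max_right _ _) hC₂, ← ENNReal.ofReal_mul (by positivity)]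
        congr 1
        ring

end IsSmoothFamily

end FamilyPTension

end

noncomputable section

/-! ### Transfer of the local estimates to variations on the manifold. -/

section Variations

open Filter Topology

variable {m n : ℕ}
  {M : Type*} [TopologicalSpace M] [ChartedSpace (EuclideanSpace ℝ (Fin m)) M]
  {N : Type*} [TopologicalSpace N] [ChartedSpace (EuclideanSpace ℝ (Fin n)) N]
  {φ : M → N} {D : Set M} {ε : ℝ} {Φ : ℝ → M → N} {t₀ p : ℝ}

/-- A variation in the charts centred at `a` and `b`. -/
def chartFamily (m n : ℕ) {M : Type*} [TopologicalSpace M]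
    [ChartedSpace (EuclideanSpace ℝ (Fin m)) M] {N : Type*} [TopologicalSpace N]
    [ChartedSpace (EuclideanSpace ℝ (Fin n)) N] (a : M) (b : N) (Φ : ℝ → M → N)
    (z : ℝ × Coord m) : Coord n :=
  chartMap a b (Φ z.1) z.2

namespace IsVariation

theorem initial_eq (hΦ : IsVariation (m := m) (n := n) φ D ε Φ) : Φ 0 = φ := funext hΦ.initial

theorem contMDiffAt (hΦ : IsVariation (m := m) (n := n) φ D ε Φ) (ht : t₀ ∈ Ioo (-ε) ε) (x : M) :
    ContMDiffAt (𝓘(ℝ, ℝ).prod (𝓡 m)) (𝓡 n) ∞ (fun z : ℝ × M => Φ z.1 z.2) (t₀, x) :=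
  hΦ.smooth.contMDiffAt ((isOpen_Ioo.prod isOpen_univ).mem_nhds ⟨ht, mem_univ x⟩)

theorem contMDiff (hΦ : IsVariation (m := m) (n := n) φ D ε Φ) (ht : t₀ ∈ Ioo (-ε) ε) :
    ContMDiff (𝓡 m) (𝓡 n) ∞ (Φ t₀) := fun x =>
  ContMDiffAt.comp x (f := fun x : M => (t₀, x)) (hΦ.contMDiffAt ht x)
    (contMDiffAt_const.prodMk contMDiffAt_id)

theorem eventually_mem (hΦ : IsVariation (m := m) (n := n) φ D ε Φ) (ht : t₀ ∈ Ioo (-ε) ε)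
    {a : M} {b : N} {u₀ : Coord m} (hu : u₀ ∈ (extChartAt (𝓡 m) a).target)
    (hb : Φ t₀ ((extChartAt (𝓡 m) a).symm u₀) ∈ (extChartAt (𝓡 n) b).source) :
    ∀ᶠ z in 𝓝 (t₀, u₀), z.1 ∈ Ioo (-ε) ε ∧ z.2 ∈ (extChartAt (𝓡 m) a).target ∧
      Φ z.1 ((extChartAt (𝓡 m) a).symm z.2) ∈ (extChartAt (𝓡 n) b).source := by
  have h1 : ContinuousAt (fun z : ℝ × Coord m => (z.1, (extChartAt (𝓡 m) a).symm z.2)) (t₀, u₀) :=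
    continuousAt_fst.prodMk (ContinuousAt.comp (f := fun z : ℝ × Coord m => z.2) (x := (t₀, u₀))
      (continuousAt_extChartAt_symm'' hu) continuousAt_snd)
  have h2 : ContinuousAt (fun z : ℝ × Coord m => Φ z.1 ((extChartAt (𝓡 m) a).symm z.2)) (t₀, u₀) :=
    ContinuousAt.comp (g := fun z : ℝ × M => Φ z.1 z.2)
      (f := fun z : ℝ × Coord m => (z.1, (extChartAt (𝓡 m) a).symm z.2)) (x := (t₀, u₀))
      (hΦ.contMDiffAt ht ((extChartAt (𝓡 m) a).symm u₀)).continuousAt h1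
  exact (continuousAt_fst.eventually (isOpen_Ioo.mem_nhds ht)).and
    ((continuousAt_snd.eventually (extChartAt_target_mem_nhds' hu)).and
      (h2.eventually ((isOpen_extChartAt_source b).mem_nhds hb)))

end IsVariation

variable [IsManifold (𝓡 m) ∞ M] [IsManifold (𝓡 n) ∞ N]

/-- The squared norm of the `p`-tension field of the maps of a variation. -/
def variationPTensionSq (g : SmoothMetric m M) (h : SmoothMetric n N) (p : ℝ) (Φ : ℝ → M → N)
    (z : ℝ × M) : ℝ :=
  pTensionNorm g h p (Φ z.1) z.2 ^ 2

namespace IsVariation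

theorem contDiffAt_chartFamily (hΦ : IsVariation (m := m) (n := n) φ D ε Φ)
    (ht : t₀ ∈ Ioo (-ε) ε) {a : M} {b : N} {u₀ : Coord m}
    (hu : u₀ ∈ (extChartAt (𝓡 m) a).target)
    (hb : Φ t₀ ((extChartAt (𝓡 m) a).symm u₀) ∈ (extChartAt (𝓡 n) b).source) :
    ContDiffAt ℝ ∞ (chartFamily m n a b Φ) (t₀, u₀) := by
  have h1 : ContMDiffAt 𝓘(ℝ, ℝ × Coord m) (𝓘(ℝ, ℝ).prod (𝓡 m)) ∞
      (fun z : ℝ × Coord m => (z.1, (extChartAt (𝓡 m) a).symm z.2)) (t₀, u₀) :=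
    contDiffAt_fst.contMDiffAt.prodMk
      (ContMDiffAt.comp (t₀, u₀) (f := fun z : ℝ × Coord m => z.2)
        (contMDiffAt_extChartAt_symm hu) contDiffAt_snd.contMDiffAt)
  have h2 := ContMDiffAt.comp (t₀, u₀) (g := fun z : ℝ × M => Φ z.1 z.2)
    (hΦ.contMDiffAt ht ((extChartAt (𝓡 m) a).symm u₀)) h1
  exact ((contMDiffAt_extChartAt_of_mem hb).comp (t₀, u₀) h2).contDiffAt

theorem isSmoothFamily (g : SmoothMetric m M) (h : SmoothMetric n N)
    (hΦ : IsVariation (m := m) (n := n) φ D ε Φ)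
    (ht : t₀ ∈ Ioo (-ε) ε) {a : M} {b : N} {u₀ : Coord m}
    (hu : u₀ ∈ (extChartAt (𝓡 m) a).target)
    (hb : Φ t₀ ((extChartAt (𝓡 m) a).symm u₀) ∈ (extChartAt (𝓡 n) b).source) :
    IsSmoothFamily (chartMetric g a) (chartMetric h b) (chartFamily m n a b Φ) (t₀, u₀) where
  map := by
    filter_upwards [hΦ.eventually_mem ht hu hb] with z hz
    exact hΦ.contDiffAt_chartFamily hz.1 hz.2.1 hz.2.2
  source := by
    filter_upwards [extChartAt_target_mem_nhds' hu] with y hy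
    exact ⟨contDiffAt_chartMetric g hy, isInnerForm_chartMetric g hy⟩
  target := by
    filter_upwards [extChartAt_target_mem_nhds' ((extChartAt (𝓡 n) b).map_source hb)] with y hy
    exact ⟨contDiffAt_chartMetric h hy, isInnerForm_chartMetric h hy⟩

theorem variationPTensionSq_eq (g : SmoothMetric m M) (h : SmoothMetric n N) (hp : 2 ≤ p)
    (hΦ : IsVariation (m := m) (n := n) φ D ε Φ)
    (ht : t₀ ∈ Ioo (-ε) ε) {a : M} {b : N} {u₀ : Coord m}
    (hu : u₀ ∈ (extChartAt (𝓡 m) a).target)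
    (hb : Φ t₀ ((extChartAt (𝓡 m) a).symm u₀) ∈ (extChartAt (𝓡 n) b).source) :
    variationPTensionSq g h p Φ (t₀, (extChartAt (𝓡 m) a).symm u₀) =
      familyPTensionSq (chartMetric g a) (chartMetric h b) p (chartFamily m n a b Φ) (t₀, u₀) :=
  pTensionNorm_sq_eq g h hp (hΦ.contMDiff ht) hu hb

/-- Near a point, the squared `p`-tension is that of a smooth family in charts. -/
theorem eventually_variationPTensionSq_eq (g : SmoothMetric m M) (h : SmoothMetric n N)
    (hp : 2 ≤ p) (hΦ : IsVariation (m := m) (n := n) φ D ε Φ) (ht : t₀ ∈ Ioo (-ε) ε) (x₀ : M) :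
    ∀ᶠ z in 𝓝 (t₀, extChartAt (𝓡 m) x₀ x₀),
      variationPTensionSq g h p Φ (z.1, (extChartAt (𝓡 m) x₀).symm z.2) =
        familyPTensionSq (chartMetric g x₀) (chartMetric h (Φ t₀ x₀)) p
          (chartFamily m n x₀ (Φ t₀ x₀) Φ) z := by
  filter_upwards [hΦ.eventually_mem (b := Φ t₀ x₀) ht (mem_extChartAt_target x₀)
    (by rw [extChartAt_to_inv]; exact mem_extChartAt_source _)] with z hz
  exact hΦ.variationPTensionSq_eq g h hp hz.1 hz.2.1 hz.2.2

theorem isSmoothFamily_self (g : SmoothMetric m M) (h : SmoothMetric n N)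
    (hΦ : IsVariation (m := m) (n := n) φ D ε Φ) (ht : t₀ ∈ Ioo (-ε) ε) (x₀ : M) :
    IsSmoothFamily (chartMetric g x₀) (chartMetric h (Φ t₀ x₀))
      (chartFamily m n x₀ (Φ t₀ x₀) Φ) (t₀, extChartAt (𝓡 m) x₀ x₀) :=
  hΦ.isSmoothFamily g h ht (mem_extChartAt_target x₀)
    (by rw [extChartAt_to_inv]; exact mem_extChartAt_source _)

theorem continuousAt_variationPTensionSq (g : SmoothMetric m M) (h : SmoothMetric n N)
    (hp : 2 ≤ p) (hΦ : IsVariation (m := m) (n := n) φ D ε Φ) (ht : t₀ ∈ Ioo (-ε) ε) (x₀ : M) :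
    ContinuousAt (variationPTensionSq g h p Φ) (t₀, x₀) := by
  have h1 : ContinuousAt (fun z : ℝ × M => (z.1, extChartAt (𝓡 m) x₀ z.2)) (t₀, x₀) :=
    continuousAt_fst.prodMk
      (ContinuousAt.comp (f := fun z : ℝ × M => z.2) (continuousAt_extChartAt x₀) continuousAt_snd)
  have h2 := ContinuousAt.comp (f := fun z : ℝ × M => (z.1, extChartAt (𝓡 m) x₀ z.2))
    ((hΦ.isSmoothFamily_self g h ht x₀).continuousAt_familyPTensionSq hp) h1
  refine h2.congr ?_
  filter_upwards [h1.eventually (hΦ.eventually_variationPTensionSq_eq g h hp ht x₀),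
    (continuousAt_snd (p := (t₀, x₀))).eventually (extChartAt_source_mem_nhds (I := 𝓡 m) x₀)]
    with z h3 h4
  rw [Function.comp, ← h3, (extChartAt (𝓡 m) x₀).left_inv h4]

theorem continuous_pTensionNorm_sq (g : SmoothMetric m M) (h : SmoothMetric n N)
    (hp : 2 ≤ p) (hΦ : IsVariation (m := m) (n := n) φ D ε Φ) (ht : t₀ ∈ Ioo (-ε) ε) :
    Continuous fun x => pTensionNorm g h p (Φ t₀) x ^ 2 :=
  continuous_iff_continuousAt.2 fun x =>
    ContinuousAt.comp (f := fun x : M => (t₀, x)) (g := variationPTensionSq g h p Φ)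
      (hΦ.continuousAt_variationPTensionSq g h hp ht x)
      (continuousAt_const.prodMk continuousAt_id)

/-- The `p`-tension field of a variation is bounded on compact sets. -/
theorem exists_bound (g : SmoothMetric m M) (h : SmoothMetric n N)
    (hp : 2 ≤ p) (hΦ : IsVariation (m := m) (n := n) φ D ε Φ) (hε : 0 < ε) {K : Set M}
    (hK : IsCompact K) :
    ∃ B > 0, ∀ t ∈ Ioo (-(ε / 2)) (ε / 2), ∀ x ∈ K, pTensionNorm g h p (Φ t) x ^ 2 ≤ B := by
  have hc : ContinuousOn (variationPTensionSq g h p Φ) (Icc (-(ε / 2)) (ε / 2) ×ˢ K) := by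
    rintro ⟨t, x⟩ ⟨ht, -⟩
    exact (hΦ.continuousAt_variationPTensionSq g h hp
      ⟨by linarith [ht.1], by linarith [ht.2]⟩ x).continuousWithinAt
  obtain ⟨B, hB⟩ := ((isCompact_Icc.prod hK).image_of_continuousOn hc).bddAbove
  refine ⟨max B 1, by positivity, fun t ht x hx => ?_⟩
  exact (hB ⟨(t, x), ⟨Ioo_subset_Icc_self ht, hx⟩, rfl⟩).trans (le_max_left _ _)

/-- Where the `p`-tension field does not vanish, its squared norm is Lipschitz in time. -/
theorem exists_lipschitz (g : SmoothMetric m M) (h : SmoothMetric n N)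
    (hp : 2 ≤ p) (hΦ : IsVariation (m := m) (n := n) φ D ε Φ) (hε : 0 < ε) {K : Set M}
    (hK : IsCompact K) (h0 : ∀ x, pTensionNorm g h p φ x ≠ 0) :
    ∃ L ≥ 0, ∃ δ > 0, ∀ x ∈ K, ∀ t ∈ Ioo (-δ) δ,
      |pTensionNorm g h p (Φ t) x ^ 2 - pTensionNorm g h p φ x ^ 2| ≤ L * |t| := by
  have h00 : (0 : ℝ) ∈ Ioo (-ε) ε := ⟨by linarith, hε⟩
  -- The property passes to subsets and finite unions, so by compactness it is enough to have it
  -- near each point.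
  refine hK.induction_on ⟨0, le_rfl, 1, one_pos, fun x hx => hx.elim⟩ ?_ ?_ ?_
  · rintro s t hst ⟨L, hL, δ, hδ, h1⟩
    exact ⟨L, hL, δ, hδ, fun x hx => h1 x (hst hx)⟩
  · rintro s t ⟨L, hL, δ, hδ, h1⟩ ⟨L', hL', δ', hδ', h1'⟩
    refine ⟨max L L', le_max_of_le_left hL, min δ δ', lt_min hδ hδ', fun x hx t ht => ?_⟩
    rcases hx with hx | hx
    · refine (h1 x hx t ⟨by linarith [ht.1, min_le_left δ δ'],
        by linarith [ht.2, min_le_left δ δ']⟩).trans ?_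
      gcongr
      exact le_max_left _ _
    · refine (h1' x hx t ⟨by linarith [ht.1, min_le_right δ δ'],
        by linarith [ht.2, min_le_right δ δ']⟩).trans ?_
      gcongr
      exact le_max_right _ _
  · intro x₀ _
    have hF := hΦ.isSmoothFamily_self g h h00 x₀
    have heq := hΦ.eventually_variationPTensionSq_eq g h hp h00 x₀
    have hne : familyPTensionSq (chartMetric g x₀) (chartMetric h (Φ 0 x₀)) p
        (chartFamily m n x₀ (Φ 0 x₀) Φ) (0, extChartAt (𝓡 m) x₀ x₀) ≠ 0 := by
      rw [← heq.self_of_nhds, extChartAt_to_inv]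
      simpa [variationPTensionSq, hΦ.initial_eq] using h0 x₀
    obtain ⟨L, hL, δ₁, hδ₁, hbox₁⟩ :=
      (hF.contDiffAt_familyPTensionSq hp hne).exists_lipschitz_slice
    obtain ⟨δ₂, hδ₂, hbox₂⟩ := IsSmoothFamily.exists_box heq
    rw [zero_sub, zero_add] at hbox₁ hbox₂
    have hev := ((continuousAt_extChartAt (I := 𝓡 m) x₀).eventually (hbox₁.and hbox₂)).and
      (extChartAt_source_mem_nhds (I := 𝓡 m) x₀)
    refine ⟨_, mem_nhdsWithin_of_mem_nhds hev, L, hL, min δ₁ δ₂, lt_min hδ₁ hδ₂, ?_⟩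
    rintro x ⟨⟨hx₁, hx₂⟩, hxs⟩ t ht
    have ht₁ : t ∈ Ioo (-δ₁) δ₁ := ⟨by linarith [ht.1, min_le_left δ₁ δ₂],
        by linarith [ht.2, min_le_left δ₁ δ₂]⟩
    have ht₂ : t ∈ Ioo (-δ₂) δ₂ := ⟨by linarith [ht.1, min_le_right δ₁ δ₂],
        by linarith [ht.2, min_le_right δ₁ δ₂]⟩
    have e1 := hx₂ t ht₂
    have e2 := hx₂ 0 ⟨by linarith, hδ₂⟩
    have e3 := hx₁ t ht₁
    rw [← e1, ← e2, (extChartAt (𝓡 m) x₀).left_inv hxs, sub_zero] at e3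
    simpa [variationPTensionSq, hΦ.initial_eq] using e3

/-- The squared `p`-tension field of a variation of a `p`-harmonic map decays faster than linearly
in the mean, over compact sets of a chart. -/
theorem exists_lintegral_le (g : SmoothMetric m M) (h : SmoothMetric n N)
    (hp : 2 ≤ p) (hΦ : IsVariation (m := m) (n := n) φ D ε Φ) (hε : 0 < ε) {η : ℝ}
    (hη : 1 < η) (hη' : η ≤ 3 / 2) (hpη : p = 2 ∨ 1 + η ≤ p) {a : M} {K : Set (Coord m)}
    (hK : IsCompact K) (hKa : K ⊆ (extChartAt (𝓡 m) a).target)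
    (h0 : ∀ x, pTensionNorm g h p φ x = 0) :
    ∃ C ≥ 0, ∃ δ > 0, ∀ t ∈ Ioo (-δ) δ,
      ∫⁻ u in K, ENNReal.ofReal (pTensionNorm g h p (Φ t) ((extChartAt (𝓡 m) a).symm u) ^ 2) ≤
        ENNReal.ofReal (C * |t| ^ η) := by
  have h00 : (0 : ℝ) ∈ Ioo (-ε) ε := ⟨by linarith, hε⟩
  refine hK.induction_on ⟨0, le_rfl, 1, one_pos, fun t _ => by simp⟩ ?_ ?_ ?_
  · rintro s t hst ⟨C, hC, δ, hδ, h1⟩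
    exact ⟨C, hC, δ, hδ, fun r hr => (lintegral_mono_set hst).trans (h1 r hr)⟩
  · rintro s t ⟨C, hC, δ, hδ, h1⟩ ⟨C', hC', δ', hδ', h1'⟩
    refine ⟨C + C', add_nonneg hC hC', min δ δ', lt_min hδ hδ', fun r hr => ?_⟩
    refine (lintegral_union_le _ _ _).trans ?_
    rw [add_mul, ENNReal.ofReal_add (by positivity) (by positivity)]
    exact add_le_add (h1 r ⟨by linarith [hr.1, min_le_left δ δ'],
      by linarith [hr.2, min_le_left δ δ']⟩) (h1' r ⟨by linarith [hr.1, min_le_right δ δ'],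
        by linarith [hr.2, min_le_right δ δ']⟩)
  · intro u₀ hu₀
    have hu := hKa hu₀
    set b := Φ 0 ((extChartAt (𝓡 m) a).symm u₀) with hbdef
    have hb : Φ 0 ((extChartAt (𝓡 m) a).symm u₀) ∈ (extChartAt (𝓡 n) b).source :=
      mem_extChartAt_source _
    have hF := hΦ.isSmoothFamily g h h00 hu hb
    have heq : ∀ᶠ z in 𝓝 (0, u₀),
        variationPTensionSq g h p Φ (z.1, (extChartAt (𝓡 m) a).symm z.2) =
          familyPTensionSq (chartMetric g a) (chartMetric h b) p (chartFamily m n a b Φ) z := by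
      filter_upwards [hΦ.eventually_mem h00 hu hb] with z hz
      exact hΦ.variationPTensionSq_eq g h hp hz.1 hz.2.1 hz.2.2
    -- The vanishing norm at t = 0 gives a vanishing vector, as the target metric is positive
    -- definite.
    have hzero : ∀ᶠ u in 𝓝 u₀, familyPTension (chartMetric g a) (chartMetric h b) p
        (chartFamily m n a b Φ) (0, u) = 0 := by
      filter_upwards [(tendsto_slice (0, u₀)).eventually (heq.and hF.eventually)] with u hu
      have h1 := hu.1
      simp only [variationPTensionSq, hΦ.initial_eq, h0] at h1
      by_contra hne
      have := hu.2.target.self_of_nhds.2.pos _ hne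
      rw [familyPTensionSq] at h1
      simp only [ne_eq, OfNat.ofNat_ne_zero, not_false_eq_true, zero_pow] at h1
      exact this.ne h1
    obtain ⟨C, hC, δ₁, hδ₁, hint⟩ := hF.exists_lintegral_familyPTensionSq_le hη hη' hpη hzero
    obtain ⟨δ₂, hδ₂, hbox⟩ := IsSmoothFamily.exists_box heq
    rw [zero_sub, zero_add] at hbox
    obtain ⟨S, hS, hSint⟩ := eventually_smallSets.1 (hint.and (eventually_smallSets_subset.2 hbox))
    -- The interior is used because the local estimate requires a measurable set.
    refine ⟨interior S, mem_nhdsWithin_of_mem_nhds (interior_mem_nhds.2 hS), C, hC, min δ₁ δ₂,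
      lt_min hδ₁ hδ₂, fun t ht => ?_⟩
    obtain ⟨h1, h2⟩ := hSint _ interior_subset
    refine Eq.trans_le (setLIntegral_congr_fun isOpen_interior.measurableSet fun u hu => ?_)
      (h1 isOpen_interior.measurableSet t ⟨by linarith [ht.1, min_le_left δ₁ δ₂],
        by linarith [ht.2, min_le_left δ₁ δ₂]⟩)
    have h3 := h2 hu t ⟨by linarith [ht.1, min_le_right δ₁ δ₂],
      by linarith [ht.2, min_le_right δ₁ δ₂]⟩
    simp only [variationPTensionSq] at h3
    simp only [h3]

end IsVariation

end Variations

end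

noncomputable section

/-! ### Domination of the Riemannian measure on compact sets by Lebesgue measure in charts. -/

section Volume

open Filter Topology
open scoped ENNReal

variable {m : ℕ} {M : Type*} [TopologicalSpace M] [ChartedSpace (EuclideanSpace ℝ (Fin m)) M]
  [IsManifold (𝓡 m) ∞ M]

theorem continuousOn_volumeDensity (g : SmoothMetric m M) (a : M) :
    ContinuousOn (fun u => Real.sqrt (gramMatrix (chartMetric g a u)).det)
      (extChartAt (𝓡 m) a).target := by
  intro u hu
  have h1 := (contDiffAt_chartMetric g hu).continuousAt
  have h2 : ContinuousAt (fun u => gramMatrix (chartMetric g a u)) u :=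
    continuousAt_pi.2 fun i => continuousAt_pi.2 fun j =>
      (h1.clm_apply continuousAt_const).clm_apply continuousAt_const
  have h3 : ContinuousAt (fun u => (gramMatrix (chartMetric g a u)).det) u :=
    (Continuous.matrix_det continuous_id).continuousAt.comp h2
  exact h3.sqrt.continuousWithinAt

variable [MeasurableSpace M]

/-- Integrals over a compact set in the domain of a chart, in coordinates. -/
theorem exists_lintegral_chartVolume_le (g : SmoothMetric m M) (a : M) {K : Set (Coord m)}
    (hK : IsCompact K) (hKa : K ⊆ (extChartAt (𝓡 m) a).target) :
    ∃ C : ℝ, ∀ w : M → ℝ≥0∞,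
      (∀ u ∈ (extChartAt (𝓡 m) a).target, u ∉ K → w ((extChartAt (𝓡 m) a).symm u) = 0) →
      ∫⁻ x, w x ∂chartVolume g a ≤
        ENNReal.ofReal C * ∫⁻ u in K, w ((extChartAt (𝓡 m) a).symm u) := by
  have hJ := continuousOn_volumeDensity g a
  obtain ⟨C, hC⟩ := (hK.image_of_continuousOn (hJ.mono hKa)).bddAbove
  have hT : MeasurableSet (extChartAt (𝓡 m) a).target :=
    (isOpen_extChartAt_target (I := 𝓡 m) a).measurableSet
  -- Only an upper bound is needed; it holds for every w, measurable or not.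
  refine ⟨C, fun w hw => (lintegral_map_le _ _).trans ?_⟩
  rw [lintegral_withDensity_eq_lintegral_mul_non_measurable₀ _
    (hJ.aemeasurable hT).ennreal_ofReal (Eventually.of_forall fun u => ENNReal.ofReal_lt_top),
    ← lintegral_const_mul' _ _ ENNReal.ofReal_ne_top, ← lintegral_indicator hT,
    ← lintegral_indicator hK.measurableSet]
  refine lintegral_mono fun u => ?_
  by_cases hu : u ∈ K
  · rw [indicator_of_mem (hKa hu), indicator_of_mem hu]
    exact mul_le_mul_left (ENNReal.ofReal_le_ofReal (hC ⟨u, hu, rfl⟩)) _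
  · by_cases hu' : u ∈ (extChartAt (𝓡 m) a).target
    · rw [indicator_of_mem hu']
      exact (mul_eq_zero_of_right _ (hw u hu' hu)).trans_le zero_le
    · rw [indicator_of_notMem hu']
      exact zero_le

variable [T2Space M] [SigmaCompactSpace M] [BorelSpace M]

/-- Integrals over a compact set are dominated by finitely many integrals in coordinates. -/
theorem exists_lintegral_riemannianVolume_le (g : SmoothMetric m M) {D : Set M}
    (hD : IsCompact D) :
    ∃ (S : Finset M) (K : M → Set (Coord m)) (C : M → ℝ),
      (∀ a, IsCompact (K a) ∧ K a ⊆ (extChartAt (𝓡 m) a).target) ∧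
      ∀ w : M → ℝ≥0∞, ∫⁻ x in D, w x ∂riemannianVolume g ≤
        ∑ a ∈ S, ENNReal.ofReal (C a) * ∫⁻ u in K a, w ((extChartAt (𝓡 m) a).symm u) := by
  have hsub : (chartPartition m M).IsSubordinate fun x => (chartAt (Coord m) x).source :=
    (SmoothPartitionOfUnity.exists_isSubordinate_chartAt_source (𝓡 m) M).choose_spec
  have hfin := (chartPartition m M).locallyFinite.finite_nonempty_inter_compact hD
  -- By local finiteness only finitely many partition functions meet D, and D intersected with each
  -- of their supports is a compact subset of a chart domain.
  let K : M → Set (Coord m) := fun a => extChartAt (𝓡 m) a '' (D ∩ tsupport (chartPartition m M a))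
  have hsrc : ∀ a, D ∩ tsupport (chartPartition m M a) ⊆ (extChartAt (𝓡 m) a).source :=
    fun a x hx => by
      rw [extChartAt_source]
      exact hsub a hx.2
  have hK : ∀ a, IsCompact (K a) ∧ K a ⊆ (extChartAt (𝓡 m) a).target := fun a =>
    ⟨(hD.inter_right (isClosed_tsupport _)).image_of_continuousOn
      ((continuousOn_extChartAt a).mono (hsrc a)),
      (image_mono (hsrc a)).trans_eq (extChartAt (𝓡 m) a).image_source_eq_target⟩
  choose C hC using fun a => exists_lintegral_chartVolume_le g a (hK a).1 (hK a).2
  refine ⟨hfin.toFinset, K, C, hK, fun w => ?_⟩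
  have hDm : MeasurableSet D := hD.measurableSet
  have hterm : ∀ a, ∫⁻ x in D, w x ∂((chartVolume g a).withDensity fun x =>
      ENNReal.ofReal (chartPartition m M a x)) =
      ∫⁻ x, D.indicator (fun x => ENNReal.ofReal (chartPartition m M a x) * w x) x
        ∂chartVolume g a := fun a => by
    rw [restrict_withDensity hDm, lintegral_withDensity_eq_lintegral_mul_non_measurable₀ _
      ((chartPartition m M a).contMDiff.continuous.measurable.ennreal_ofReal.aemeasurable)
      (Eventually.of_forall fun u => ENNReal.ofReal_lt_top), lintegral_indicator hDm]
    rfl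
  rw [riemannianVolume, Measure.restrict_sum _ hDm, lintegral_sum_measure, tsum_eq_sum]
  · refine Finset.sum_le_sum fun a _ => ?_
    rw [hterm]
    refine (hC a _ fun u hu huK => ?_).trans ?_
    · rw [indicator_apply_eq_zero]
      intro hx
      have : (chartPartition m M a) ((extChartAt (𝓡 m) a).symm u) = 0 := by
        by_contra hne
        exact huK ⟨_, ⟨hx, subset_tsupport _ hne⟩, (extChartAt (𝓡 m) a).right_inv hu⟩
      rw [this]
      simp
    · gcongr with u
      refine indicator_le_self' (fun _ _ => zero_le) _ |>.trans ?_
      refine mul_le_of_le_one_left (zero_le) ?_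
      exact ENNReal.ofReal_le_one.2 ((chartPartition m M).le_one a _)
  · intro a ha
    rw [hterm]
    have : D.indicator (fun x => ENNReal.ofReal (chartPartition m M a x) * w x) = 0 := by
      funext x
      rw [Pi.zero_apply, indicator_apply_eq_zero]
      intro hx
      have h0 : chartPartition m M a x = 0 := by
        by_contra hne
        exact ha (hfin.mem_toFinset.2 ⟨x, hne, hx⟩)
      rw [h0]
      simp
    rw [this]
    simp

theorem riemannianVolume_lt_top (g : SmoothMetric m M) {D : Set M} (hD : IsCompact D) :
    riemannianVolume g D < ⊤ := by
  obtain ⟨S, K, C, hK, hint⟩ := exists_lintegral_riemannianVolume_le g hD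
  have h1 := hint fun _ => 1
  simp only [lintegral_const, one_mul, Measure.restrict_apply MeasurableSet.univ, univ_inter] at h1
  refine h1.trans_lt (ENNReal.sum_lt_top.2 fun a _ => ?_)
  exact ENNReal.mul_lt_top ENNReal.ofReal_lt_top (hK a).1.measure_lt_top

end Volume

end

noncomputable section

/-! ### Derivatives from power bounds and a quadratic Taylor estimate. -/

section RealAnalysis

open Filter Topology Asymptotics

theorem hasDerivAt_zero_of_abs_sub_le {F : ℝ → ℝ} {C η : ℝ} (hη : 1 < η)
    (h : ∀ᶠ t in 𝓝 0, |F t - F 0| ≤ C * |t| ^ η) : HasDerivAt F 0 0 := by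
  rw [hasDerivAt_iff_isLittleO]
  have h1 : (fun t : ℝ => |t| ^ η) =o[𝓝 0] fun t => t := by
    have h2 : (fun t : ℝ => |t| ^ (η - 1)) =o[𝓝 0] fun _ => (1 : ℝ) := by
      rw [isLittleO_one_iff]
      have := (continuous_abs.tendsto (0 : ℝ)).rpow_const (p := η - 1) (Or.inr (by linarith))
      rwa [abs_zero, Real.zero_rpow (by linarith)] at this
    have h3 := h2.mul_isBigO (isBigO_refl (fun t : ℝ => |t|) (𝓝 0))
    simp only [one_mul] at h3
    refine (h3.congr_left fun t => ?_).of_abs_right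
    rcases eq_or_ne t 0 with rfl | ht
    · simp [Real.zero_rpow (by linarith : η ≠ 0)]
    · rw [← Real.rpow_add_one (abs_pos.2 ht).ne', sub_add_cancel]
  simp only [smul_zero, sub_zero]
  refine IsBigO.trans_isLittleO (IsBigO.of_bound C ?_) h1
  filter_upwards [h] with t ht
  rwa [Real.norm_eq_abs, Real.norm_of_nonneg (by positivity)]

/-- The first-order Taylor formula with a quadratic remainder. -/
theorem exists_abs_taylor_le {ψ ψ' : ℝ → ℝ} {y₀ d : ℝ} (h : ∀ᶠ y in 𝓝 y₀, HasDerivAt ψ (ψ' y) y)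
    (h' : HasDerivAt ψ' d y₀) :
    ∃ K ≥ 0, ∀ᶠ y in 𝓝 y₀, |ψ y - ψ y₀ - ψ' y₀ * (y - y₀)| ≤ K * (y - y₀) ^ 2 := by
  obtain ⟨K, hK, hbound⟩ := h'.differentiableAt.isBigO_sub.exists_nonneg
  obtain ⟨r, hr, hball⟩ := Metric.eventually_nhds_iff_ball.1 (hbound.bound.and h)
  refine ⟨K, hK, Metric.eventually_nhds_iff_ball.2 ⟨r, hr, fun y hy => ?_⟩⟩
  have hsub : Metric.closedBall y₀ |y - y₀| ⊆ Metric.ball y₀ r :=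
    Metric.closedBall_subset_ball (by simpa [Real.dist_eq] using hy)
  -- Mean value inequality for ψ minus its linear part, whose derivative is at most K |y - y₀| on
  -- the ball of radius |y - y₀|.
  have key := (convex_closedBall y₀ |y - y₀|).norm_image_sub_le_of_norm_hasDerivWithin_le
    (f := fun y => ψ y - ψ' y₀ * y) (f' := fun y => ψ' y - ψ' y₀ * 1) (C := K * |y - y₀|)
    (fun z hz => ((hball z (hsub hz)).2.sub
      ((hasDerivAt_id z).const_mul (ψ' y₀))).hasDerivWithinAt)
    (fun z hz => by
      have h1 := (hball z (hsub hz)).1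
      rw [mul_one]
      refine h1.trans (mul_le_mul_of_nonneg_left ?_ hK)
      simpa [Real.dist_eq] using hz)
    (Metric.mem_closedBall_self (abs_nonneg _))
    (show y ∈ Metric.closedBall y₀ |y - y₀| by simp [Real.dist_eq])
  rw [Real.norm_eq_abs, Real.norm_eq_abs, mul_assoc, abs_mul_abs_self, ← sq] at key
  convert key using 2
  ring

/-- The factor s^(q-2) is chosen so that the linear terms at y = s² cancel: the derivative of
y^(q/2)/q there is s^(q-2)/2. -/
theorem exists_abs_rpow_taylor_le {q s : ℝ} (hq : 2 ≤ q) (hs : 0 < s) :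
    ∃ K ≥ 0, ∀ᶠ y in 𝓝 (s ^ 2),
      |1 / q * y ^ (q / 2) - s ^ (q - 2) * (1 / 2 * y) -
        (1 / q * (s ^ 2) ^ (q / 2) - s ^ (q - 2) * (1 / 2 * s ^ 2))| ≤ K * (y - s ^ 2) ^ 2 := by
  have hs2 : 0 < s ^ 2 := by positivity
  have h1 : ∀ᶠ y in 𝓝 (s ^ 2), HasDerivAt (fun y : ℝ => 1 / q * y ^ (q / 2))
      (1 / q * (q / 2 * y ^ (q / 2 - 1))) y := by
    filter_upwards [eventually_gt_nhds hs2] with y hy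
    exact (Real.hasDerivAt_rpow_const (Or.inl hy.ne')).const_mul _
  obtain ⟨K, hK, hT⟩ := exists_abs_taylor_le h1
    (((Real.hasDerivAt_rpow_const (Or.inl hs2.ne')).const_mul (q / 2)).const_mul (1 / q))
  refine ⟨K, hK, hT.mono fun y hy => le_of_eq_of_le ?_ hy⟩
  have h2 : (s ^ 2) ^ (q / 2 - 1) = s ^ (q - 2) := by
    rw [← Real.rpow_natCast, ← Real.rpow_mul hs.le]
    congr 1
    push_cast
    ring
  have hq0 : q ≠ 0 := by linarith
  rw [h2]
  congr 1
  field_simp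
  ring

end RealAnalysis

/-! ### From the estimates to the two cases of the theorem. -/

section Harmonic

open Filter Topology
open scoped ENNReal

variable {m n : ℕ}
  {M : Type*} [TopologicalSpace M] [ChartedSpace (EuclideanSpace ℝ (Fin m)) M]
  [IsManifold (𝓡 m) ∞ M]
  {N : Type*} [TopologicalSpace N] [ChartedSpace (EuclideanSpace ℝ (Fin n)) N]
  [IsManifold (𝓡 n) ∞ N]
  {φ : M → N} {D : Set M} {ε : ℝ} {Φ : ℝ → M → N} {p q : ℝ}

theorem pTensionNorm_nonneg (g : SmoothMetric m M) (h : SmoothMetric n N) (p : ℝ) (φ : M → N)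
    (x : M) : 0 ≤ pTensionNorm g h p φ x := Real.sqrt_nonneg _

theorem pTensionNorm_rpow_eq (g : SmoothMetric m M) (h : SmoothMetric n N) (p q : ℝ) (φ : M → N)
    (x : M) : pTensionNorm g h p φ x ^ q = (pTensionNorm g h p φ x ^ 2) ^ (q / 2) := by
  rw [← Real.rpow_natCast, ← Real.rpow_mul (pTensionNorm_nonneg g h p φ x)]
  congr 1
  push_cast
  ring

variable [T2Space M] [SigmaCompactSpace M] [MeasurableSpace M]

theorem biPEnergy_eq_pqEnergy (g : SmoothMetric m M) (h : SmoothMetric n N) (p : ℝ) :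
    biPEnergy g h p = pqEnergy g h p 2 := by
  funext φ D
  simp only [biPEnergy, pqEnergy, Real.rpow_two]

variable [BorelSpace M]

theorem isFiniteMeasureOnCompacts_riemannianVolume (g : SmoothMetric m M) :
    IsFiniteMeasureOnCompacts (riemannianVolume g) :=
  ⟨fun _ hK => riemannianVolume_lt_top g hK⟩

/-- The squared `p`-tension field of a variation of a `p`-harmonic map decays faster than linearly
in the mean. -/
theorem IsVariation.exists_setLIntegral_le (g : SmoothMetric m M) (h : SmoothMetric n N)
    (hp : 2 ≤ p) (hΦ : IsVariation (m := m) (n := n) φ D ε Φ) (hε : 0 < ε) (hD : IsCompact D)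
    (h0 : ∀ x, pTensionNorm g h p φ x = 0) :
    ∃ η > (1 : ℝ), ∃ C ≥ 0, ∀ᶠ t in 𝓝 (0 : ℝ),
      ∫⁻ x in D, ENNReal.ofReal (pTensionNorm g h p (Φ t) x ^ 2) ∂riemannianVolume g ≤
        ENNReal.ofReal (C * |t| ^ η) := by
  -- For p > 2 the rate p - 1 exceeds 1. The cap 3/2 only serves to keep γ = 2 - η strictly between
  -- 0 and 1.
  obtain ⟨η, hη, hη', hpη⟩ : ∃ η : ℝ, 1 < η ∧ η ≤ 3 / 2 ∧ (p = 2 ∨ 1 + η ≤ p) := by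
    rcases eq_or_lt_of_le hp with rfl | hp
    · exact ⟨3 / 2, by norm_num, le_rfl, Or.inl rfl⟩
    · exact ⟨min (3 / 2) (p - 1), lt_min (by norm_num) (by linarith), min_le_left _ _,
        Or.inr (by linarith [min_le_right (3 / 2) (p - 1)])⟩
  obtain ⟨S, K, A, hK, hint⟩ := exists_lintegral_riemannianVolume_le g hD
  choose C hC δ hδ hCδ using fun a => hΦ.exists_lintegral_le g h hp hε hη hη' hpη (hK a).1
    (hK a).2 h0
  have hnn : ∀ a, 0 ≤ max (A a) 0 * C a := fun a => mul_nonneg (le_max_right _ _) (hC a)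
  refine ⟨η, hη, ∑ a ∈ S, max (A a) 0 * C a, Finset.sum_nonneg fun a _ => hnn a, ?_⟩
  have hev : ∀ᶠ t in 𝓝 (0 : ℝ), ∀ a ∈ S, t ∈ Ioo (-δ a) (δ a) :=
    (Finset.eventually_all S).2 fun a _ => Ioo_mem_nhds (neg_lt_zero.2 (hδ a)) (hδ a)
  filter_upwards [hev] with t ht
  refine (hint _).trans ?_
  rw [Finset.sum_mul, ENNReal.ofReal_sum_of_nonneg fun a _ =>
    mul_nonneg (hnn a) (Real.rpow_nonneg (abs_nonneg t) _)]
  refine Finset.sum_le_sum fun a ha => ?_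
  rw [mul_assoc, ENNReal.ofReal_mul (le_max_right _ _)]
  exact mul_le_mul' (ENNReal.ofReal_le_ofReal (le_max_left _ _)) (hCδ a t (ht a ha))

/-- A smooth `p`-harmonic map is `(p, q)`-harmonic. -/
theorem isPQHarmonic_of_pTensionNorm_eq_zero (g : SmoothMetric m M) (h : SmoothMetric n N)
    (hp : 2 ≤ p) (hq : 2 ≤ q) (h0 : ∀ x, pTensionNorm g h p φ x = 0) :
    IsPQHarmonic g h p q φ := by
  intro D hD ε hε Φ hΦ
  obtain ⟨η, hη, C, hC, hdecay⟩ := hΦ.exists_setLIntegral_le g h hp hε hD h0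
  obtain ⟨B, hB, hbound⟩ := hΦ.exists_bound g h hp hε hD
  have hzero : pqEnergy g h p q (Φ 0) D = 0 := by
    simp [pqEnergy, hΦ.initial_eq, h0, Real.zero_rpow (by linarith : q ≠ 0)]
  refine hasDerivAt_zero_of_abs_sub_le (C := 1 / q * (B ^ (q / 2 - 1) * C)) hη ?_
  filter_upwards [hdecay, Ioo_mem_nhds (show -(ε / 2) < 0 by linarith) (half_pos hε)] with t ht htI
  have hq0 : 0 ≤ 1 / q := by positivity
  rw [hzero, sub_zero, pqEnergy, abs_mul, abs_of_nonneg hq0, mul_assoc]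
  refine mul_le_mul_of_nonneg_left ?_ hq0
  rw [← Real.norm_eq_abs]
  refine (norm_integral_le_lintegral_norm _).trans ?_
  refine ENNReal.toReal_le_of_le_ofReal (by positivity) ?_
  -- As q ≥ 2, the bound |τ_p|² ≤ B on D gives |τ_p|^q ≤ B^(q/2-1) |τ_p|².
  calc _ ≤ ∫⁻ x in D, ENNReal.ofReal (B ^ (q / 2 - 1)) *
        ENNReal.ofReal (pTensionNorm g h p (Φ t) x ^ 2) ∂riemannianVolume g := by
        refine setLIntegral_mono' hD.measurableSet fun x hx => ?_
        rw [← ENNReal.ofReal_mul (by positivity)]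
        refine ENNReal.ofReal_le_ofReal ?_
        rw [Real.norm_of_nonneg (Real.rpow_nonneg (pTensionNorm_nonneg g h p _ x) _),
          pTensionNorm_rpow_eq]
        have h1 : (pTensionNorm g h p (Φ t) x ^ 2) ^ (q / 2) =
            (pTensionNorm g h p (Φ t) x ^ 2) ^ (q / 2 - 1) * pTensionNorm g h p (Φ t) x ^ 2 := by
          rcases (sq_nonneg (pTensionNorm g h p (Φ t) x)).eq_or_lt' with h2 | h2
          · rw [h2, mul_zero, Real.zero_rpow (by linarith)]
          · rw [← Real.rpow_add_one h2.ne', sub_add_cancel]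
        rw [h1]
        refine mul_le_mul_of_nonneg_right ?_ (sq_nonneg _)
        exact Real.rpow_le_rpow (sq_nonneg _) (hbound t htI x hx) (by linarith)
    _ ≤ ENNReal.ofReal (B ^ (q / 2 - 1)) * ENNReal.ofReal (C * |t| ^ η) := by
        rw [lintegral_const_mul' _ _ ENNReal.ofReal_ne_top]
        gcongr
    _ = _ := by rw [← ENNReal.ofReal_mul (by positivity), mul_assoc]

/-- Where `|τ_p|` is a positive constant, the energies agree to first order up to a factor. -/
theorem IsVariation.hasDerivAt_pqEnergy_sub (g : SmoothMetric m M) (h : SmoothMetric n N)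
    (hp : 2 ≤ p) (hq : 2 ≤ q) (hΦ : IsVariation (m := m) (n := n) φ D ε Φ) (hε : 0 < ε)
    (hD : IsCompact D) {s : ℝ} (hs : 0 < s) (h0 : ∀ x, pTensionNorm g h p φ x = s) :
    HasDerivAt (fun t => pqEnergy g h p q (Φ t) D - s ^ (q - 2) * biPEnergy g h p (Φ t) D) 0 0 := by
  obtain ⟨K, hK, hT⟩ := exists_abs_rpow_taylor_le hq hs
  obtain ⟨L, hL, δ, hδ, hlip⟩ := hΦ.exists_lipschitz g h hp hε hD fun x => by
    rw [h0 x]; exact hs.ne'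
  obtain ⟨r, hr, hball⟩ := Metric.eventually_nhds_iff_ball.1 hT
  have hfin := isFiniteMeasureOnCompacts_riemannianVolume g
  set R : ℝ → ℝ := fun y => 1 / q * y ^ (q / 2) - s ^ (q - 2) * (1 / 2 * y) with hR
  have hF : ∀ t ∈ Ioo (-ε) ε,
      IntegrableOn (fun x => R (pTensionNorm g h p (Φ t) x ^ 2)) D (riemannianVolume g) ∧
      pqEnergy g h p q (Φ t) D - s ^ (q - 2) * biPEnergy g h p (Φ t) D =
        ∫ x in D, R (pTensionNorm g h p (Φ t) x ^ 2) ∂riemannianVolume g := by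
    intro t ht
    have c1 := hΦ.continuous_pTensionNorm_sq g h hp ht
    have c2 : Continuous fun x => (pTensionNorm g h p (Φ t) x ^ 2) ^ (q / 2) :=
      c1.rpow_const fun x => Or.inr (by linarith)
    have i1 : IntegrableOn _ D (riemannianVolume g) := c1.continuousOn.integrableOn_compact hD
    have i2 : IntegrableOn _ D (riemannianVolume g) := c2.continuousOn.integrableOn_compact hD
    refine ⟨(i2.const_mul _).sub ((i1.const_mul _).const_mul _), ?_⟩
    simp only [pqEnergy, biPEnergy, hR, pTensionNorm_rpow_eq g h p q]
    rw [integral_sub (i2.const_mul _) ((i1.const_mul _).const_mul _), integral_const_mul,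
      integral_const_mul, integral_const_mul]
  -- The Taylor remainder is quadratic in |τ_p(φ_t)|² - s², which is O(t) uniformly on D; hence the
  -- exponent 2 and the constant K L² vol(D).
  refine hasDerivAt_zero_of_abs_sub_le (η := 2)
    (C := K * L ^ 2 * (riemannianVolume g).real D) (by norm_num) ?_
  have hsmall : ∀ᶠ t in 𝓝 (0 : ℝ), L * |t| < r := by
    have : ContinuousAt (fun t : ℝ => L * |t|) 0 := by fun_prop
    exact this.eventually_lt continuousAt_const (by simpa using hr)
  filter_upwards [Ioo_mem_nhds (neg_lt_zero.2 hδ) hδ, Ioo_mem_nhds (neg_lt_zero.2 hε) hε, hsmall]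
    with t ht htε htr
  have h00 : (0 : ℝ) ∈ Ioo (-ε) ε := ⟨by linarith, hε⟩
  rw [(hF t htε).2, (hF 0 h00).2, ← integral_sub (hF t htε).1 (hF 0 h00).1, ← Real.norm_eq_abs]
  refine (norm_setIntegral_le_of_norm_le_const (C := K * L ^ 2 * |t| ^ (2 : ℝ))
    hD.measure_lt_top fun x hx => ?_).trans_eq (by ring)
  have h1 := hlip x hx t ht
  rw [h0 x] at h1
  have h2 := hball _ (show pTensionNorm g h p (Φ t) x ^ 2 ∈ Metric.ball (s ^ 2) r by
    rw [Metric.mem_ball, Real.dist_eq]; exact h1.trans_lt htr)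
  rw [hΦ.initial_eq, h0 x]
  refine h2.trans ?_
  rw [mul_assoc, Real.rpow_two, ← mul_pow]
  refine mul_le_mul_of_nonneg_left ?_ hK
  rw [← sq_abs]
  gcongr

end Harmonic

end
theorem mainTheorem2 {m n : ℕ}
    {M : Type*} [TopologicalSpace M] [ChartedSpace (EuclideanSpace ℝ (Fin m)) M]
    [IsManifold (𝓡 m) ∞ M] [T2Space M] [SigmaCompactSpace M] [MeasurableSpace M] [BorelSpace M]
    {N : Type*} [TopologicalSpace N] [ChartedSpace (EuclideanSpace ℝ (Fin n)) N]
    [IsManifold (𝓡 n) ∞ N] [T2Space N] [SigmaCompactSpace N]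
    (g : SmoothMetric m M) (h : SmoothMetric n N)
    (p q : ℝ) (hp : 2 ≤ p) (hq : 2 ≤ q)
    (φ : M → N) (hφ : ContMDiff (𝓡 m) (𝓡 n) ∞ φ)
    (hconst : ∃ c : ℝ, ∀ x : M, pTensionNorm g h p φ x ^ (q - 2) = c) :
    IsPQHarmonic g h p q φ ↔ IsBiPHarmonic g h p φ := by
  rcases eq_or_lt_of_le hq with rfl | hq'
  · rw [IsBiPHarmonic, biPEnergy_eq_pqEnergy, IsPQHarmonic]
  -- For q > 2 the power q - 2 is injective on nonnegative reals, so the norm itself is constant. On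
  -- an empty M the value 0 is arbitrary.
  obtain ⟨s, hs, hτ⟩ : ∃ s ≥ 0, ∀ x, pTensionNorm g h p φ x = s := by
    obtain ⟨c, hc⟩ := hconst
    rcases isEmpty_or_nonempty M with hM | ⟨⟨x₀⟩⟩
    · exact ⟨0, le_rfl, fun x => hM.elim x⟩
    refine ⟨_, pTensionNorm_nonneg g h p φ x₀, fun x => ?_⟩
    exact (Real.rpow_left_inj (pTensionNorm_nonneg g h p φ x) (pTensionNorm_nonneg g h p φ x₀)
      (by linarith : q - 2 ≠ 0)).1 ((hc x).trans (hc x₀).symm)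
  rcases hs.eq_or_lt' with rfl | hs
  -- A p-harmonic map is critical for both energies, so the equivalence holds between true
  -- statements.
  · rw [IsBiPHarmonic, biPEnergy_eq_pqEnergy]
    exact iff_of_true (isPQHarmonic_of_pTensionNorm_eq_zero g h hp hq hτ)
      (isPQHarmonic_of_pTensionNorm_eq_zero g h hp le_rfl hτ)
  have hκ : s ^ (q - 2) ≠ 0 := (Real.rpow_pos_of_pos hs _).ne'
  -- For s > 0 the equivalence holds variation by variation: the energies agree to first order up to
  -- the nonzero factor s^(q-2).
  refine forall₅_congr fun D hD ε hε Φ => forall_congr' fun hΦ => ?_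
  have hdiff := hΦ.hasDerivAt_pqEnergy_sub g h hp hq hε hD hs hτ
  constructor
  · intro hE
    have h1 := (hE.sub hdiff).const_mul (s ^ (q - 2))⁻¹
    rw [sub_zero, mul_zero] at h1
    refine h1.congr_of_eventuallyEq (Filter.Eventually.of_forall fun t => ?_)
    simp only [Pi.sub_apply]
    field_simp
    ring
  · intro hE
    have h1 := hdiff.add (hE.const_mul (s ^ (q - 2)))
    rw [mul_zero, add_zero] at h1
    refine h1.congr_of_eventuallyEq (Filter.Eventually.of_forall fun t => ?_)
    simp only [Pi.add_apply]
    ring
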